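/- A \emph{factor} over a finite set $\mathbf{X}'$ of discrete variables (each with a finite non-empty set of values) maps each instantiation of $\mathbf{X}'$ to a non-negative rational number and is given by its table. Consider instances that consist of finitely many discrete variables $\mathbf{X}$, factors $f_1(\mathbf{X}_1),\ldots,f_n(\mathbf{X}_n)$ with $\mathbf{X}_i\subseteq\mathbf{X}$, and a rational number $k$; let $f = f_1\cdots f_n$ be the joint factor, $f(\mathbf{x})=\prod_i f_i(\mathbf{x}_i)$, where $\mathbf{x}_i$ is the restriction of $\mathbf{x}$ to $\mathbf{X}_i$. Instances are encoded as strings over a finite alphabet, with factors written as tables and all numbers written in binary. Consider the decision problems \begin{itemize} \item \textbf{D-MPE}: is there an instantiation $\mathbf{x}$ of $\mathbf{X}$ with $f(\mathbf{x})>k$? \item \textbf{D-PR}: is $\sum_{\mathbf{x}} f(\mathbf{x})>k$? \end{itemize} Then D-MPE is reducible to D-PR by a polynomial-time many-one reduction: there is a map $r$ on instances, computable in polynomial time by a Turing machine, such that an instance $I$ is a yes-instance of D-MPE if and only if $r(I)$ is a yes-instance of D-PR. Moreover, $r$ can be chosen so that $r(I)$ always consists of $\{0,1\}$-valued factors $g_1,\ldots,g_m$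 over binary variables which form a CNF (each $g_j$ is the indicator of a clause, i.e. it is $0$ at exactly one instantiation of its variables and $1$ at all others), together with the threshold $0$; thus $\sum g_1\cdots g_m>0$ if and only if $f(\mathbf{x})>k$ for some $\mathbf{x}$. -/

import Mathlib

open scoped NNRat

namespace FactorModel

/-! ### Factors and models -/

/-- An instantiation of discrete variables: variable `v` takes one of its `card v` values. -/
abbrev Instantiation {n : ℕ} (card : Fin n → ℕ) : Type := ∀ v, Fin (card v)

/-- A factor `f(X')` over a set `X'` of `arity` distinct variables among the `n` variables of a model
(listed by `scope`). It maps each instantiation of `X'` to a non-negative rational number. -/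
structure Factor {n : ℕ} (card : Fin n → ℕ) where
  arity : ℕ
  scope : Fin arity ↪ Fin n
  val : Instantiation (fun j => card (scope j)) → ℚ≥0

/-- The value of a factor at an instantiation of all the variables. -/
def Factor.eval {n : ℕ} {card : Fin n → ℕ} (f : Factor card) (x : Instantiation card) : ℚ≥0 :=
  f.val fun j => x (f.scope j)

/-- A graphical model: finitely many discrete variables, each with a non-empty finite set of values,
and a finite family of factors `f₁(X₁), …, fₘ(Xₘ)` over subsets of them. -/
structure Model where
  numVars : ℕ
  card : Fin numVars → ℕ
  card_pos : ∀ v, 0 < card v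
  factors : List (Factor card)

/-- The joint factor `f = f₁ ⋯ fₘ`. -/
def Model.joint (M : Model) (x : Instantiation M.card) : ℚ≥0 :=
  (M.factors.map fun f => f.eval x).prod

/-- An instance of the decision problems: a model and a rational number `k`. -/
structure Query where
  model : Model
  k : ℚ

/-- D-MPE: is there an instantiation `x` with `f(x) > k`? -/
def DMPE (Q : Query) : Prop :=
  ∃ x : Instantiation Q.model.card, (Q.model.joint x : ℚ) > Q.k

/-- D-PR: is `∑ₓ f(x) > k`? -/
def DPR (Q : Query) : Prop :=
  (∑ x : Instantiation Q.model.card, (Q.model.joint x : ℚ)) > Q.k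

/-! ### CNFs as models -/

/-- Over binary variables: `f` is the 0/1-valued factor of a clause on its variables, that is, of a
disjunction of one literal for each of them; exactly one row, `y₀`, falsifies the clause. -/
def Factor.IsClause {n : ℕ} {card : Fin n → ℕ} (f : Factor card) : Prop :=
  ∃ y₀ : Instantiation (fun j => card (f.scope j)), ∀ y, f.val y = if y = y₀ then 0 else 1

/-- All variables are binary and every factor is the 0/1-valued factor of a clause. -/
def Model.IsCNF (M : Model) : Prop :=
  (∀ v, M.card v = 2) ∧ ∀ f ∈ M.factors, f.IsClause

/-! ### Encoding of instances as strings -/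

/-- The alphabet. -/
inductive Sym
  | bit (b : Bool)
  | slash
  | minus
  | comma
  | semi
  deriving DecidableEq, Fintype

/-- Natural numbers in binary, least significant bit first. -/
def encNat (n : ℕ) : List Sym := n.bits.map Sym.bit

def encNNRat (q : ℚ≥0) : List Sym := encNat q.num ++ Sym.slash :: encNat q.den

def encRat (q : ℚ) : List Sym :=
  (if q < 0 then [Sym.minus] else []) ++ encNat q.num.natAbs ++ Sym.slash :: encNat q.den

/-- A list: each entry is followed by a comma, and the list is closed by a semicolon. -/
def encList {α : Type} (e : α → List Sym) (l : List α) : List Sym :=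
  l.flatMap (fun a => e a ++ [Sym.comma]) ++ [Sym.semi]

/-- The table of a factor: its values at all the instantiations of its variables, in mixed-radix
order (the first variable of the scope varies fastest). -/
def Factor.table {n : ℕ} {card : Fin n → ℕ} (f : Factor card) : List ℚ≥0 :=
  List.ofFn fun r => f.val (finPiFinEquiv.symm r)

/-- A factor is written as the list of its variables followed by its table. -/
def Factor.encode {n : ℕ} {card : Fin n → ℕ} (f : Factor card) : List Sym :=
  encList (fun v : Fin n => encNat v) (List.ofFn f.scope) ++ encList encNNRat f.table

/-- An instance is written as the number `k`, the list of the numbers of values of the variables,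
and the factors. -/
def Query.encode (Q : Query) : List Sym :=
  encRat Q.k ++ Sym.semi ::
    (encList encNat (List.ofFn Q.model.card) ++ Q.model.factors.flatMap Factor.encode)

/-! ### The encoding is injective -/

theorem append_cons_inj {s : Sym} {l₁ l₂ t₁ t₂ : List Sym} (h₁ : s ∉ l₁) (h₂ : s ∉ l₂)
    (h : l₁ ++ s :: t₁ = l₂ ++ s :: t₂) : l₁ = l₂ ∧ t₁ = t₂ := by
  induction l₁ generalizing l₂ with
  | nil =>
    cases l₂ with
    | nil => simpa using h
    | cons b l₂ => exact absurd (by rw [(List.cons.inj h).1]; simp) h₂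
  | cons a l₁ ih =>
    cases l₂ with
    | nil => exact absurd (by rw [(List.cons.inj h).1]; simp) h₁
    | cons b l₂ =>
      simp only [List.cons_append, List.cons.injEq] at h
      have := ih (l₂ := l₂) (List.not_mem_of_not_mem_cons h₁) (List.not_mem_of_not_mem_cons h₂) h.2
      exact ⟨by rw [h.1, this.1], this.2⟩

theorem encNat_injective : Function.Injective encNat := by
  intro m n h
  have : m.bits = n.bits := List.map_injective_iff.2 (fun a b h => by simpa using h) h
  have hm : ∀ k : ℕ, (k.bits).foldr (fun b r => Nat.bit b r) 0 = k := by
    intro k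
    induction k using Nat.binaryRec' with
    | zero => simp
    | bit b n hn ih => rw [Nat.bits_append_bit n b hn]; simp [ih]
  rw [← hm m, ← hm n, this]

theorem notMem_encNat {s : Sym} (hs : ∀ b, s ≠ Sym.bit b) (n : ℕ) : s ∉ encNat n := by
  simp only [encNat, List.mem_map, not_exists, not_and]
  exact fun b _ h => hs b h.symm

theorem encNNRat_injective : Function.Injective encNNRat := by
  intro p q h
  have := append_cons_inj (notMem_encNat (by simp) _) (notMem_encNat (by simp) _) h
  exact NNRat.ext_num_den (encNat_injective this.1) (encNat_injective this.2)

theorem encRat_injective : Function.Injective encRat := by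
  have key : ∀ q : ℚ, Sym.slash ∉ (if q < 0 then [Sym.minus] else []) ++ encNat q.num.natAbs := by
    intro q
    have := notMem_encNat (s := Sym.slash) (by simp) q.num.natAbs
    split_ifs <;> simp [this]
  intro p q h
  obtain ⟨h₁, h₂⟩ := append_cons_inj (key p) (key q) h
  have hm := notMem_encNat (s := Sym.minus) (by simp)
  refine Rat.ext ?_ (encNat_injective h₂)
  have hp := @Rat.num_neg p
  have hq := @Rat.num_neg q
  split_ifs at h₁ with a b b
  · have := encNat_injective (by simpa using h₁)
    have := hp.2 a
    have := hq.2 b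
    omega
  · exact absurd (by rw [List.nil_append] at h₁; rw [← h₁]; simp) (hm q.num.natAbs)
  · exact absurd (by rw [List.nil_append] at h₁; rw [h₁]; simp) (hm p.num.natAbs)
  · have := encNat_injective (by simpa using h₁)
    have := hp.not.2 a
    have := hq.not.2 b
    omega

theorem encList_append_inj {α : Type} {e : α → List Sym} (he : Function.Injective e)
    (hc : ∀ a, Sym.comma ∉ e a) (hs : ∀ a, Sym.semi ∉ e a) {l₁ l₂ : List α} {t₁ t₂ : List Sym}
    (h : encList e l₁ ++ t₁ = encList e l₂ ++ t₂) : l₁ = l₂ ∧ t₁ = t₂ := by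
  have ne : ∀ (a : α) (u v : List Sym), e a ++ Sym.comma :: u ≠ Sym.semi :: v := by
    intro a u v h
    cases hea : e a with
    | nil => simp [hea] at h
    | cons b l =>
      have := hs a
      simp_all
  induction l₁ generalizing l₂ with
  | nil =>
    cases l₂ with
    | nil => simpa [encList] using h
    | cons b l₂ => exact absurd h.symm (by simpa [encList] using ne b _ _)
  | cons a l₁ ih =>
    cases l₂ with
    | nil => exact absurd h (by simpa [encList] using ne a _ _)
    | cons b l₂ =>
      have h' : e a ++ Sym.comma :: (encList e l₁ ++ t₁)
          = e b ++ Sym.comma :: (encList e l₂ ++ t₂) := by simpa [encList] using h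
      obtain ⟨h₁, h₂⟩ := append_cons_inj (hc a) (hc b) h'
      obtain ⟨h₃, h₄⟩ := ih h₂
      exact ⟨by rw [he h₁, h₃], h₄⟩

theorem Factor.encode_append_inj {n : ℕ} {card : Fin n → ℕ} {f g : Factor card}
    {t₁ t₂ : List Sym} (h : f.encode ++ t₁ = g.encode ++ t₂) : f = g ∧ t₁ = t₂ := by
  simp only [Factor.encode, List.append_assoc] at h
  obtain ⟨h₁, h₂⟩ := encList_append_inj (fun a b h => Fin.ext (encNat_injective h))
    (fun a => notMem_encNat (by simp) _) (fun a => notMem_encNat (by simp) _) h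
  have hr : ∀ s, (∀ b, s ≠ Sym.bit b) → s ≠ Sym.slash → ∀ q : ℚ≥0, s ∉ encNNRat q := by
    intro s hs hs' q
    simp [encNNRat, notMem_encNat hs, hs']
  obtain ⟨h₃, h₄⟩ := encList_append_inj encNNRat_injective (hr _ (by simp) (by simp))
    (hr _ (by simp) (by simp)) h₂
  refine ⟨?_, h₄⟩
  obtain ⟨a, s, u⟩ := f
  obtain ⟨b, s', u'⟩ := g
  obtain rfl : a = b := by simpa using congrArg List.length h₁
  obtain rfl : s = s' := DFunLike.coe_injective (List.ofFn_injective h₁)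
  congr 1
  funext y
  have := congrFun (List.ofFn_injective h₃) (finPiFinEquiv y)
  simpa using this

theorem Query.encode_injective : Function.Injective Query.encode := by
  rintro ⟨⟨n, c, hc, fs⟩, k⟩ ⟨⟨n', c', hc', fs'⟩, k'⟩ h
  have hr : ∀ q : ℚ, Sym.semi ∉ encRat q := by
    intro q
    have := notMem_encNat (s := Sym.semi) (by simp)
    unfold encRat
    split_ifs <;> simp [this]
  obtain ⟨h₁, h₂⟩ := append_cons_inj (hr _) (hr _) h
  obtain rfl := encRat_injective h₁
  obtain ⟨h₃, h₄⟩ := encList_append_inj encNat_injective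
    (fun a => notMem_encNat (by simp) _) (fun a => notMem_encNat (by simp) _) h₂
  obtain rfl : n = n' := by simpa using congrArg List.length h₃
  obtain rfl : c = c' := List.ofFn_injective h₃
  congr 2
  have ne : ∀ f : Factor c, f.encode ≠ [] := by
    intro f; simp [Factor.encode, encList]
  simp only at h₄
  clear h h₁ h₂ h₃
  induction fs generalizing fs' with
  | nil =>
    cases fs' with
    | nil => rfl
    | cons g fs' => simp [ne g] at h₄
  | cons f fs ih =>
    cases fs' with
    | nil => simp [ne f] at h₄
    | cons g fs' =>
      obtain ⟨rfl, h₅⟩ := Factor.encode_append_inj (by simpa using h₄)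
      rw [ih fs' h₅]

/-! ### Polynomial-time reductions -/

/-- `r` is a polynomial-time many-one reduction from `P` to `P'`, where instances are written as
strings by `e` and `e'`: a Turing machine computes `r` in polynomial time, and `r` preserves yes
and no instances. -/
def IsPolyTimeReduction {α β Γ Γ' : Type} (e : α → List Γ) (e' : β → List Γ')
    (P : α → Prop) (P' : β → Prop) (r : α → β) : Prop :=
  Nonempty (Turing.TM2ComputableInPolyTime e e' r) ∧ ∀ a, P a ↔ P' (r a)

end FactorModel

/-!
The argument is that of the Cook–Levin theorem, applied to one deterministic scan of the input.
Reading the encoding of a query once from left to right, and knowing an instantiation `x`, a machine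
with finitely many modes can compare `f(x)` with `k`: it multiplies the numerators and the
denominators into two registers by shift and add, one digit of the current number at a time,
and finds the row of a table that `x` selects by counting down. The registers are exponentially
large, but they grow by at most one digit per step, and all other numbers are at most the length of
the input, because the tables are written out.

So the scan is described by finitely many predicates of at most three positions of the input
(digit `j` of the register `r` at time `i` is `b`, the value chosen for variable `v` is `a`, …), and
by finitely many universally quantified clauses that do not depend on the query. Some interpretation
of the predicates satisfies these clauses if and only if some `x` has `f(x) > k`. The reduction maps
a query to the ground instances of the clauses over the positions of its encoding: this is a CNF of
polynomial size, whose models are counted by D-PR.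

Only the program that writes these ground instances has to run on a Turing machine. It does not
depend on the meaning of the clauses: it consists of loops over tuples of positions, which are
written in a small structured language of programs on stacks and compiled to a machine.
-/

namespace FactorModel

/-- Programs on stacks indexed by `K` with symbols in `Γ`: `case` pops a stack and branches on the
result; `loop` pops a stack and runs its body on the popped symbol, until the stack is empty. -/
inductive Cmd (K Γ : Type)
  | skip
  | push (k : K) (a : Γ)
  | seq (c d : Cmd K Γ)
  | case (k : K) (f : Option Γ → Cmd K Γ)
  | loop (k : K) (f : Γ → Cmd K Γ)

namespace Cmd

variable {K Γ : Type}

/-- The operational semantics: `Run c s t s'` means that the program `c`, started on the stacks `s`,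
ends with the stacks `s'` after `t` steps of the machine `Cmd.machine`. -/
inductive Run [DecidableEq K] : Cmd K Γ → (K → List Γ) → ℕ → (K → List Γ) → Prop
  | skip (s) : Run skip s 1 s
  | push (k a s) : Run (push k a) s 1 (Function.update s k (a :: s k))
  | seq {c d s t s' t' u} : Run c s t s' → Run d s' t' u → Run (seq c d) s (t + t') u
  | case {k f s t s'} : Run (f (s k).head?) (Function.update s k (s k).tail) t s' →
      Run (case k f) s (t + 1) s'
  | loop_nil {k f s} : s k = [] → Run (loop k f) s 1 s
  | loop_cons {k f s a l t s' t' u} : s k = a :: l → Run (f a) (Function.update s k l) t s' →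
      Run (loop k f) s' t' u → Run (loop k f) s (t + t' + 1) u

/-- The program points of a program; `none` is the pop of a `case` or a `loop`. -/
def Label : Cmd K Γ → Type
  | skip => Unit
  | push _ _ => Unit
  | seq c d => c.Label ⊕ d.Label
  | case _ f => Option (Σ o, (f o).Label)
  | loop _ f => Option (Σ a, (f a).Label)

theorem finite_label [Finite Γ] : ∀ c : Cmd K Γ, Finite c.Label
  | skip => inferInstanceAs (Finite Unit)
  | push _ _ => inferInstanceAs (Finite Unit)
  | seq c d =>
    have := finite_label c
    have := finite_label d
    inferInstanceAs (Finite (c.Label ⊕ d.Label))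
  | case _ f =>
    have := fun o => finite_label (f o)
    inferInstanceAs (Finite (Option (Σ o, (f o).Label)))
  | loop _ f =>
    have := fun a => finite_label (f a)
    inferInstanceAs (Finite (Option (Σ a, (f a).Label)))

/-- The program point at which a program starts. -/
def entry : ∀ c : Cmd K Γ, c.Label
  | skip => ()
  | push _ _ => ()
  | seq c _ => Sum.inl c.entry
  | case _ _ => none
  | loop _ _ => none

/-- The machine statement at a program point, when the program points are placed among the labels
`Λ` by `emb` and the program is left to the label `exit`. The local variable of the machine holds
the symbol popped last. -/
def code {Λ : Type} : ∀ c : Cmd K Γ, (c.Label → Λ) → Λ → c.Label →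
    Turing.TM2.Stmt (fun _ : K => Γ) Λ (Option Γ)
  | skip, _, exit, _ => .goto fun _ => exit
  | push k a, _, exit, _ => .push k (fun _ => a) (.goto fun _ => exit)
  | seq c d, emb, _, Sum.inl l => c.code (fun l => emb (Sum.inl l)) (emb (Sum.inr d.entry)) l
  | seq _ d, emb, exit, Sum.inr l => d.code (fun l => emb (Sum.inr l)) exit l
  | case k f, emb, _, none => .pop k (fun _ o => o) (.goto fun o => emb (some ⟨o, (f o).entry⟩))
  | case _ f, emb, exit, some ⟨o, l⟩ => (f o).code (fun l => emb (some ⟨o, l⟩)) exit l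
  | loop k f, emb, exit, none => .pop k (fun _ o => o)
      (.goto fun o => o.elim exit fun a => emb (some ⟨a, (f a).entry⟩))
  | loop _ f, emb, _, some ⟨a, l⟩ => (f a).code (fun l => emb (some ⟨a, l⟩)) (emb none) l

section Reaches

variable [DecidableEq K] {Γ : K → Type} {Λ σ : Type} {M : Λ → Turing.TM2.Stmt Γ Λ σ}
  {l l' l'' : Λ} {s s' s'' : ∀ k, List (Γ k)} {t t' : ℕ} {q : Turing.TM2.Stmt Γ Λ σ}

/-- The machine `M`, at the label `l` with the stacks `s`, is after exactly `t` steps at the label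
`l'` with the stacks `s'`, whatever its local variable contains. -/
def Reaches (M : Λ → Turing.TM2.Stmt Γ Λ σ) (l : Λ) (s : ∀ k, List (Γ k)) (t : ℕ) (l' : Λ)
    (s' : ∀ k, List (Γ k)) : Prop :=
  ∀ v, ∃ v', (flip bind (Turing.TM2.step M))^[t] (some ⟨some l, v, s⟩) = some ⟨some l', v', s'⟩

theorem Reaches.of_stepAux (hl : M l = q)
    (h : ∀ v, ∃ v', Turing.TM2.stepAux q v s = ⟨some l', v', s'⟩) : Reaches M l s 1 l' s' :=
  fun v => (h v).imp fun _ h => congrArg some (hl ▸ h)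

theorem Reaches.trans (h : Reaches M l s t l' s') (h' : Reaches M l' s' t' l'' s'') :
    Reaches M l s (t + t') l'' s'' := by
  intro v
  obtain ⟨v', hv⟩ := h v
  obtain ⟨v'', hv'⟩ := h' v'
  refine ⟨v'', ?_⟩
  rw [add_comm, Function.iterate_add_apply, hv, hv']

end Reaches

theorem Run.reaches [DecidableEq K] {c : Cmd K Γ} {s s' : K → List Γ} {t : ℕ}
    (h : Run c s t s') {Λ : Type} {M : Λ → Turing.TM2.Stmt (fun _ : K => Γ) Λ (Option Γ)}
    {emb : c.Label → Λ} {exit : Λ} (hM : ∀ l, M (emb l) = c.code emb exit l) :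
    Reaches M (emb c.entry) s t exit s' := by
  induction h generalizing exit with
  | skip s => exact .of_stepAux (hM ()) fun v => ⟨v, by simp [code]⟩
  | push k a s => exact .of_stepAux (hM ()) fun v => ⟨v, by simp [code]⟩
  | seq _ _ ih ih' => exact (ih fun l => hM (Sum.inl l)).trans (ih' fun l => hM (Sum.inr l))
  | @case k f s _ _ _ ih =>
    have hpop : Reaches M (emb none) s 1 (emb (some ⟨_, (f (s k).head?).entry⟩))
        (Function.update s k (s k).tail) :=
      .of_stepAux (hM none) fun _ => ⟨(s k).head?, by simp [code]⟩
    rw [add_comm]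
    exact hpop.trans (ih fun l => hM (some ⟨_, l⟩))
  | @loop_nil k f s hk =>
    have hs : Function.update s k [] = s := by rw [← hk, Function.update_eq_self]
    exact .of_stepAux (hM none) fun _ => ⟨none, by simp [code, hk, hs]⟩
  | @loop_cons k f s a l _ _ _ _ hk _ _ ih ih' =>
    have hpop : Reaches M (emb none) s 1 (emb (some ⟨_, (f a).entry⟩)) (Function.update s k l) :=
      .of_stepAux (hM none) fun _ => ⟨some a, by simp [code, hk]⟩
    rw [add_comm, ← add_assoc]
    exact (hpop.trans (ih fun l => hM (some ⟨_, l⟩))).trans (ih' hM)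

/-- The machine that runs a program from the input stack `kin` to the output stack `kout`. The label
`none` resets the local variable, because a machine must halt in its initial local state. -/
noncomputable def machine [DecidableEq K] [Fintype K] [Fintype Γ] (c : Cmd K Γ) (kin kout : K) :
    Turing.FinTM2 :=
  haveI := c.finite_label
  { K := K
    k₀ := kin
    k₁ := kout
    Γ := fun _ => Γ
    Λ := Option c.Label
    main := some c.entry
    ΛFin := Fintype.ofFinite _
    σ := Option Γ
    initialState := none
    Γk₀Fin := inferInstanceAs (Fintype Γ)
    m := fun l => match l with
      | none => .load (fun _ => none) .halt
      | some l => c.code some none l }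

/-- The program `c`, started on the stacks `s`, ends with the stacks `s'` within `T` steps. -/
def RunsWithin [DecidableEq K] (c : Cmd K Γ) (s : K → List Γ) (T : ℕ) (s' : K → List Γ) : Prop :=
  ∃ t ≤ T, Run c s t s'

theorem RunsWithin.loop [DecidableEq K] {k : K} {f : Γ → Cmd K Γ} {T : ℕ} {w : List Γ}
    (state : List Γ → List Γ → K → List Γ)
    (hstate : ∀ y l, Function.update (state y []) k l = state y l)
    (hbody : ∀ y a l, w = y ++ a :: l → RunsWithin (f a) (state y l) T (state (y ++ [a]) l)) :
    RunsWithin (.loop k f) (state [] w) (w.length * (T + 1) + 1) (state w []) := by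
  suffices h : ∀ l y, w = y ++ l →
      RunsWithin (.loop k f) (state y l) (l.length * (T + 1) + 1) (state w []) from h w [] rfl
  intro l
  induction l with
  | nil =>
    intro y hw
    rw [hw, List.append_nil]
    exact ⟨1, by simp, .loop_nil (by rw [← hstate, Function.update_self])⟩
  | cons a l ih =>
    intro y hw
    obtain ⟨t, ht, hr⟩ := hbody y a l hw
    obtain ⟨t', ht', hr'⟩ := ih (y ++ [a]) (by rw [hw, List.append_assoc, List.singleton_append])
    have hpop : Function.update (state y (a :: l)) k l = state y l := by
      rw [← hstate, Function.update_idem, hstate]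
    refine ⟨t + t' + 1, ?_, .loop_cons (by rw [← hstate, Function.update_self])
      (by rw [hpop]; exact hr) hr'⟩
    rw [List.length_cons, add_mul]
    omega

theorem dite_eq_update_nil [DecidableEq K] (k₀ : K) (l : List Γ) :
    (fun k => dite (k = k₀) (fun _ => l.map (Equiv.refl Γ).invFun) fun _ => [])
      = Function.update (fun _ => []) k₀ l := by
  funext k
  by_cases hk : k = k₀
  · subst hk
    simp
  · simp [hk]

theorem tm2ComputableInPolyTime [DecidableEq K] [Finite K] [Finite Γ] {α β : Type}
    {e : α → List Γ} {e' : β → List Γ} {f : α → β} (c : Cmd K Γ) (kin kout : K)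
    (p : Polynomial ℕ)
    (h : ∀ a, RunsWithin c (Function.update (fun _ => []) kin (e a)) (p.eval (e a).length)
      (Function.update (fun _ => []) kout (e' (f a)))) :
    Nonempty (Turing.TM2ComputableInPolyTime e e' f) := by
  have := Fintype.ofFinite K
  have := Fintype.ofFinite Γ
  refine ⟨{ tm := c.machine kin kout, inputAlphabet := Equiv.refl Γ, outputAlphabet := Equiv.refl Γ,
            time := p + 1, outputsFun := fun a => Classical.choice ?_ }⟩
  obtain ⟨t, ht, hr⟩ := h a
  obtain ⟨v, hv⟩ := hr.reaches (M := (c.machine kin kout).m) (emb := some) (fun _ => rfl) none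
  refine ⟨⟨⟨t + 1, ?_⟩, by simpa using ht⟩⟩
  have hinit : Turing.initList (c.machine kin kout) ((e a).map (Equiv.refl Γ).invFun)
      = ⟨some (some c.entry), none, Function.update (fun _ => []) kin (e a)⟩ :=
    congrArg (Turing.TM2.Cfg.mk _ _) (dite_eq_update_nil kin (e a))
  have hhalt : Turing.haltList (c.machine kin kout) ((e' (f a)).map (Equiv.refl Γ).invFun)
      = ⟨none, none, Function.update (fun _ => []) kout (e' (f a))⟩ :=
    congrArg (Turing.TM2.Cfg.mk _ _) (dite_eq_update_nil kout (e' (f a)))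
  rw [Function.iterate_succ_apply']
  exact (congrArg _ ((congrArg _ (congrArg some hinit)).trans hv)).trans (congrArg some hhalt.symm)

end Cmd

section

open Cmd

/-! ### Writing and counting on stacks -/

/-- The stacks of the grounding program: the input, a scratch stack, the output in reverse, the
result, a flag, and `m` binary counters. -/
inductive Stk (m : ℕ)
  | inp
  | tmp
  | out
  | res
  | flag
  | ctr (i : Fin m)
  deriving DecidableEq, Fintype

/-- The contents of the stacks, except that `out` is in the order of writing. -/
structure Store (m : ℕ) where
  inp : List Sym := []
  tmp : List Sym := []
  out : List Sym := []
  res : List Sym := []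
  flag : List Sym := []
  ctr : Fin m → List Sym := fun _ => []

variable {m : ℕ}

namespace Store

/-- The stacks of a store, with `out` reversed. -/
def stk (S : Store m) : Stk m → List Sym
  | .inp => S.inp
  | .tmp => S.tmp
  | .out => S.out.reverse
  | .res => S.res
  | .flag => S.flag
  | .ctr i => S.ctr i

theorem update_inp (S : Store m) (l : List Sym) :
    Function.update S.stk .inp l = { S with inp := l }.stk := by
  funext j; cases j <;> simp [stk]

theorem update_tmp (S : Store m) (l : List Sym) :
    Function.update S.stk .tmp l = { S with tmp := l }.stk := by
  funext j; cases j <;> simp [stk]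

theorem update_out (S : Store m) (l : List Sym) :
    Function.update S.stk .out l = { S with out := l.reverse }.stk := by
  funext j; cases j <;> simp [stk]

theorem update_res (S : Store m) (l : List Sym) :
    Function.update S.stk .res l = { S with res := l }.stk := by
  funext j; cases j <;> simp [stk]

theorem update_flag (S : Store m) (l : List Sym) :
    Function.update S.stk .flag l = { S with flag := l }.stk := by
  funext j; cases j <;> simp [stk]

theorem update_ctr (S : Store m) (i : Fin m) (l : List Sym) :
    Function.update S.stk (.ctr i) l = { S with ctr := Function.update S.ctr i l }.stk := by
  funext j
  cases j with
  | ctr j => by_cases h : j = i <;> simp [stk, Function.update, h]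
  | _ => simp [stk]

end Store

/-- Started on the store `S`, the program `c` ends with the store `S'` within `T` steps. -/
def Exec (c : Cmd (Stk m) Sym) (S : Store m) (T : ℕ) (S' : Store m) : Prop :=
  RunsWithin c S.stk T S'.stk

namespace Exec

variable {c d : Cmd (Stk m) Sym} {S S' S'' : Store m} {T T' : ℕ}

theorem mono (h : Exec c S T S') (hT : T ≤ T') : Exec c S T' S' :=
  h.imp fun _ ht => ht.imp_left (le_trans · hT)

theorem skip : Exec .skip S 1 S := ⟨1, le_rfl, .skip _⟩

theorem seq (h : Exec c S T S') (h' : Exec d S' T' S'') : Exec (.seq c d) S (T + T') S'' := by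
  obtain ⟨t, ht, hr⟩ := h
  obtain ⟨t', ht', hr'⟩ := h'
  exact ⟨_, add_le_add ht ht', hr.seq hr'⟩

theorem push {k : Stk m} {a : Sym} (h : Function.update S.stk k (a :: S.stk k) = S'.stk) :
    Exec (.push k a) S 1 S' :=
  ⟨1, le_rfl, h ▸ .push k a S.stk⟩

theorem push_inp (a : Sym) : Exec (.push .inp a) S 1 { S with inp := a :: S.inp } :=
  push (S.update_inp _)

theorem push_tmp (a : Sym) : Exec (.push .tmp a) S 1 { S with tmp := a :: S.tmp } :=
  push (S.update_tmp _)

theorem push_out (a : Sym) : Exec (.push .out a) S 1 { S with out := S.out ++ [a] } :=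
  push (by simp [Store.update_out, Store.stk])

theorem push_res (a : Sym) : Exec (.push .res a) S 1 { S with res := a :: S.res } :=
  push (S.update_res _)

theorem push_flag (a : Sym) : Exec (.push .flag a) S 1 { S with flag := a :: S.flag } :=
  push (S.update_flag _)

theorem push_ctr (i : Fin m) (a : Sym) :
    Exec (.push (.ctr i) a) S 1 { S with ctr := Function.update S.ctr i (a :: S.ctr i) } :=
  push (S.update_ctr i _)

theorem case_flag {f : Option Sym → Cmd (Stk m) Sym}
    (h : Exec (f S.flag.head?) { S with flag := S.flag.tail } T S') :
    Exec (.case .flag f) S (T + 1) S' := by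
  obtain ⟨t, ht, hr⟩ := h
  exact ⟨t + 1, by omega, .case (by rw [Store.update_flag]; exact hr)⟩

/-- `state y l` is the store when the symbols `y` have been read and the symbols `l` have not. -/
theorem loop {k : Stk m} {f : Sym → Cmd (Stk m) Sym} {w : List Sym}
    (state : List Sym → List Sym → Store m)
    (hstate : ∀ y l, Function.update (state y []).stk k l = (state y l).stk)
    (hbody : ∀ y a l, w = y ++ a :: l → Exec (f a) (state y l) T (state (y ++ [a]) l)) :
    Exec (.loop k f) (state [] w) (w.length * (T + 1) + 1) (state w []) :=
  RunsWithin.loop (fun y l => (state y l).stk) hstate hbody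

end Exec

/-- Write a string. -/
def emit (l : List Sym) : Cmd (Stk m) Sym := l.foldr (fun a c => .seq (.push .out a) c) .skip

theorem exec_emit (l : List Sym) (S : Store m) :
    Exec (emit l) S (l.length + 1) { S with out := S.out ++ l } := by
  induction l generalizing S with
  | nil =>
    rw [List.append_nil]
    exact Exec.skip
  | cons a l ih =>
    have h := (Exec.push_out (S := S) a).seq (ih _)
    rw [List.append_assoc, List.singleton_append] at h
    exact h.mono (by rw [List.length_cons]; omega)

/-- Move the scratch stack to a counter. -/
def restore (i : Fin m) : Cmd (Stk m) Sym := .loop .tmp fun a => .push (.ctr i) a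

theorem exec_restore (i : Fin m) (S : Store m) :
    Exec (restore i) S (2 * S.tmp.length + 1)
      { S with tmp := [], ctr := Function.update S.ctr i (S.tmp.reverse ++ S.ctr i) } := by
  have h := Exec.loop (k := .tmp) (f := fun a => .push (.ctr i) a) (T := 1) (w := S.tmp)
    (fun y l => { S with tmp := l, ctr := Function.update S.ctr i (y.reverse ++ S.ctr i) })
    (fun _ _ => Store.update_tmp _ _) fun y a l _ => by
      simpa using Exec.push_ctr (S := { S with
        tmp := l, ctr := Function.update S.ctr i (y.reverse ++ S.ctr i) }) i a
  simp only [List.reverse_nil, List.nil_append, Function.update_eq_self] at h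
  exact h.mono (by omega)

/-- Write the content of a counter. -/
def emitCtr (i : Fin m) : Cmd (Stk m) Sym :=
  .seq (.loop (.ctr i) fun a => .seq (.push .tmp a) (.push .out a)) (restore i)

theorem exec_emitCtr (i : Fin m) (S : Store m) (h : S.tmp = []) :
    Exec (emitCtr i) S (5 * (S.ctr i).length + 2) { S with out := S.out ++ S.ctr i } := by
  obtain ⟨inp, _, out, res, flag, ctr⟩ := S
  obtain rfl : _ = [] := h
  have hread := Exec.loop (k := .ctr i) (f := fun a => .seq (.push .tmp a) (.push .out a)) (T := 2)
    (w := ctr i) (fun y l => ⟨inp, y.reverse, out ++ y, res, flag, Function.update ctr i l⟩)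
    (fun _ _ => by rw [Store.update_ctr]; simp) fun y a l _ => by
      simpa using (Exec.push_tmp (S := ⟨inp, y.reverse, out ++ y, res, flag,
        Function.update ctr i l⟩) a).seq (Exec.push_out a)
  have h := hread.seq (exec_restore i _)
  simp only [Function.update_eq_self, List.reverse_nil, List.append_nil,
    List.length_reverse, List.reverse_reverse, Function.update_self, Function.update_idem] at h
  exact h.mono (by dsimp only; omega)

/-- The `w` lowest bits of `v`, least significant bit first. -/
def binary (w v : ℕ) : List Bool := (List.range w).map v.testBit

@[simp]
theorem length_binary (w v : ℕ) : (binary w v).length = w := by simp [binary]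

theorem binary_injective {w a b : ℕ} (ha : a < 2 ^ w) (hb : b < 2 ^ w)
    (h : binary w a = binary w b) : a = b := by
  refine Nat.eq_of_testBit_eq fun j => ?_
  rcases lt_or_ge j w with hj | hj
  · exact List.map_inj_left.1 h j (List.mem_range.2 hj)
  · have hw := Nat.pow_le_pow_right two_pos hj
    rw [Nat.testBit_lt_two_pow (ha.trans_le hw), Nat.testBit_lt_two_pow (hb.trans_le hw)]

/-- The content of a counter of width `w` whose value is `v`. -/
def symBinary (w v : ℕ) : List Sym := (binary w v).map Sym.bit

@[simp]
theorem length_symBinary (w v : ℕ) : (symBinary w v).length = w := by simp [symBinary]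

theorem symBinary_succ (w v : ℕ) :
    symBinary (w + 1) v = symBinary w v ++ [Sym.bit (v.testBit w)] := by
  simp [symBinary, binary, List.range_succ]

theorem symBinary_of_dvd {w v : ℕ} (h : 2 ^ w ∣ v) :
    symBinary w v = List.replicate w (Sym.bit false) := by
  obtain ⟨c, rfl⟩ := h
  refine List.eq_replicate_iff.2 ⟨length_symBinary _ _, fun s hs => ?_⟩
  simp only [symBinary, binary, List.mem_map, List.mem_range] at hs
  obtain ⟨_, ⟨j, hj, rfl⟩, rfl⟩ := hs
  rw [Nat.testBit_two_pow_mul, decide_eq_false (by omega), Bool.false_and]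

theorem symBinary_zero (w : ℕ) : symBinary w 0 = List.replicate w (Sym.bit false) :=
  symBinary_of_dvd (dvd_zero _)

theorem eq_bit_testBit_of_symBinary_eq_append {w v : ℕ} {y l : List Sym} {a : Sym}
    (h : symBinary w v = y ++ a :: l) : a = Sym.bit (v.testBit y.length) := by
  have hlen := congrArg List.length h
  have hy : y.length < w := by simp at hlen; omega
  have hget := congrArg (·[y.length]?) h
  simpa [symBinary, binary, hy, eq_comm] using hget

theorem testBit_succ_eq_xor (v j : ℕ) :
    (v + 1).testBit j = (v.testBit j ^^ decide (2 ^ j ∣ v + 1)) := by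
  simp only [Nat.testBit_eq_decide_div_mod_eq, Nat.succ_div]
  by_cases h : 2 ^ j ∣ v + 1
  · rcases Nat.mod_two_eq_zero_or_one (v / 2 ^ j) with e | e <;> simp [h, Nat.add_mod, e]
  · simp [h]

theorem two_pow_succ_dvd_succ_iff (v j : ℕ) :
    2 ^ (j + 1) ∣ v + 1 ↔ 2 ^ j ∣ v + 1 ∧ v.testBit j = true := by
  rw [Nat.testBit_eq_decide_div_mod_eq, decide_eq_true_iff]
  by_cases h : 2 ^ j ∣ v + 1
  · have hdiv : (v + 1) / 2 ^ j = v / 2 ^ j + 1 := by rw [Nat.succ_div, if_pos h]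
    rw [pow_succ, ← Nat.dvd_div_iff_mul_dvd h, hdiv]
    simp only [h, true_and]
    omega
  · simp only [h, false_and, iff_false]
    exact fun h' => h ((pow_dvd_pow 2 j.le_succ).trans h')

/-- The flag as a truth value. -/
def boolFlag (b : Bool) : List Sym := if b then [Sym.bit true] else []

/-- Move a bit of a counter to the scratch stack and add the carry. The argument is the symbol
popped from the flag, which is the carry. -/
def addCarry (a : Sym) : Option Sym → Cmd (Stk m) Sym
  | none => .push .tmp a
  | some _ =>
      if a = Sym.bit true then .seq (.push .tmp (Sym.bit false)) (.push .flag (Sym.bit true))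
      else .push .tmp (Sym.bit true)

theorem exec_addCarry (S : Store m) (b c : Bool) (hS : S.flag = boolFlag c) :
    Exec (.case .flag (addCarry (Sym.bit b))) S 3
      { S with tmp := Sym.bit (b ^^ c) :: S.tmp, flag := boolFlag (c && b) } := by
  refine Exec.case_flag ?_
  rw [hS]
  cases c with
  | false => simpa [boolFlag, addCarry] using (Exec.push_tmp (Sym.bit b)).mono (by omega)
  | true =>
    cases b with
    | false => simpa [boolFlag, addCarry] using (Exec.push_tmp (Sym.bit true)).mono (by omega)
    | true =>
      simpa [boolFlag, addCarry] using (Exec.push_tmp (Sym.bit false)).seq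
        (Exec.push_flag (Sym.bit true))

/-- Increment a counter. The flag is set if the counter overflows. -/
def inc (i : Fin m) : Cmd (Stk m) Sym :=
  .seq (.push .flag (Sym.bit true))
    (.seq (.loop (.ctr i) fun a => .case .flag (addCarry a)) (restore i))

theorem exec_inc (i : Fin m) (S : Store m) (ht : S.tmp = []) (hf : S.flag = []) {w v : ℕ}
    (hi : S.ctr i = symBinary w v) :
    Exec (inc i) S (7 * (w + 1)) { S with
      flag := boolFlag (decide (2 ^ w ∣ v + 1))
      ctr := Function.update S.ctr i (symBinary w (v + 1)) } := by
  obtain ⟨inp, _, out, res, _, ctr⟩ := S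
  obtain rfl : _ = [] := ht
  obtain rfl : _ = [] := hf
  have hloop := Exec.loop (k := .ctr i) (f := fun a => .case .flag (addCarry a)) (T := 3)
    (w := symBinary w v)
    (fun y l => ⟨inp, (symBinary y.length (v + 1)).reverse, out, res,
      boolFlag (decide (2 ^ y.length ∣ v + 1)), Function.update ctr i l⟩)
    (fun _ _ => by rw [Store.update_ctr]; simp) fun y a l hy => by
      obtain rfl := eq_bit_testBit_of_symBinary_eq_append hy
      have h := exec_addCarry ⟨inp, (symBinary y.length (v + 1)).reverse, out, res,
        boolFlag (decide (2 ^ y.length ∣ v + 1)), Function.update ctr i l⟩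
        (v.testBit y.length) _ rfl
      rw [← testBit_succ_eq_xor] at h
      simpa [symBinary_succ, two_pow_succ_dvd_succ_iff] using h
  have hctr : Function.update ctr i (symBinary w v) = ctr := Function.update_eq_self_iff.2 hi.symm
  have hcarry : boolFlag (decide (2 ^ 0 ∣ v + 1)) = [Sym.bit true] := by simp [boolFlag]
  rw [hctr, length_symBinary, List.length_nil, hcarry] at hloop
  have hpush := Exec.push_flag (S := ⟨inp, [], out, res, [], ctr⟩) (Sym.bit true)
  have h := hpush.seq (hloop.seq (exec_restore i _))
  simp only [List.reverse_reverse, Function.update_self, Function.update_idem, List.append_nil,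
    List.length_reverse, length_symBinary] at h
  exact h.mono (by omega)

/-! ### Writing the ground instances of clauses -/

/-- A literal over relation symbols `R`, all of arity three, and variables `Fin m`. -/
structure Lit (R : Type) (m : ℕ) where
  rel : R
  arg : Fin 3 → Fin m
  pos : Bool

/-- The row of the table of a clause that falsifies the clause. -/
def falsifier {R : Type} {m : ℕ} (c : List (Lit R m)) (i : Fin c.length) : Fin 2 :=
  if (c.get i).pos then 0 else 1

/-- The encoding of the table of a clause. -/
def clauseTable {R : Type} {m : ℕ} (c : List (Lit R m)) : List Sym :=
  encList encNNRat (List.ofFn fun r : Fin (∏ _ : Fin c.length, 2) =>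
    if finPiFinEquiv.symm r = falsifier c then 0 else 1)

/-- The number of bits of the counters on inputs of length `n`. -/
def width (n : ℕ) : ℕ := Nat.log 2 (n + 1) + 2

theorem two_pow_width_le (n : ℕ) : 2 ^ width n ≤ 4 * (n + 1) := by
  have := Nat.pow_log_le_self 2 (show n + 1 ≠ 0 by omega)
  rw [width, pow_add]
  omega

theorem width_le (n : ℕ) : width n ≤ 4 * (n + 1) :=
  Nat.lt_two_pow_self.le.trans (two_pow_width_le n)

theorem add_three_lt_two_pow_width (n : ℕ) : n + 3 < 2 ^ width n := by
  have := Nat.lt_pow_succ_log_self one_lt_two (n + 1)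
  rw [width, pow_succ]
  omega

variable {R : Type} {m : ℕ}

section Strings

variable (tag : R → List Bool) (w : ℕ)

/-- The bits of the propositional variable of a ground atom. -/
def atomBits (r : R) (a : Fin 3 → ℕ) : List Bool :=
  binary w (a 0) ++ binary w (a 1) ++ binary w (a 2) ++ tag r

/-- The string of the ground instance of a literal at a valuation, as an entry of a list. -/
def litStr (l : Lit R m) (v : Fin m → ℕ) : List Sym :=
  (atomBits tag w l.rel fun k => v (l.arg k)).map Sym.bit ++ [Sym.comma]

/-- The string of the ground instance of a clause at a valuation. -/
def clauseStr (c : List (Lit R m)) (v : Fin m → ℕ) : List Sym :=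
  c.flatMap (litStr tag w · v) ++ Sym.semi :: clauseTable c

end Strings

/-- The store between two programs that write: the counters contain the valuation `v`. -/
def work (w : ℕ) (inp out : List Sym) (v : Fin m → ℕ) : Store m :=
  { inp := inp, out := out, ctr := fun i => symBinary w (v i) }

theorem update_symBinary (w : ℕ) (v : Fin m → ℕ) (i : Fin m) (a : ℕ) :
    Function.update (fun j => symBinary w (v j)) i (symBinary w a)
      = fun j => symBinary w (Function.update v i a j) := by
  funext j
  by_cases h : j = i
  · subst h
    simp
  · simp [h]

theorem exec_inc_work {w : ℕ} (i : Fin m) (inp out : List Sym) (v : Fin m → ℕ) :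
    Exec (inc i) (work w inp out v) (7 * (w + 1))
      { work w inp out (Function.update v i (v i + 1)) with
        flag := boolFlag (decide (2 ^ w ∣ v i + 1)) } := by
  simpa only [work, update_symBinary] using exec_inc i (work w inp out v) rfl rfl rfl

theorem exec_inc_work_of_lt {w : ℕ} (i : Fin m) (inp out : List Sym) (v : Fin m → ℕ)
    (h : v i + 1 < 2 ^ w) :
    Exec (inc i) (work w inp out v) (7 * (w + 1))
      (work w inp out (Function.update v i (v i + 1))) := by
  have hdvd : ¬ 2 ^ w ∣ v i + 1 := fun h' => (Nat.le_of_dvd (by omega) h').not_gt h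
  have hinc := exec_inc_work (w := w) i inp out v
  rwa [decide_eq_false hdvd] at hinc

/-- If the counters in `l` are zero, then `c` writes `str w v` in polynomial time, where `w` is the
width and `v` the contents of the counters. -/
def Writes (l : List (Fin m)) (c : Cmd (Stk m) Sym) (str : ℕ → (Fin m → ℕ) → List Sym) : Prop :=
  ∃ p : Polynomial ℕ, ∀ n inp out v, (∀ i ∈ l, v i = 0) →
    Exec c (work (width n) inp out v) (p.eval n)
      (work (width n) inp (out ++ str (width n) v) v)

theorem writes_skip : Writes [] (.skip : Cmd (Stk m) Sym) fun _ _ => [] :=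
  ⟨1, fun _ _ _ _ _ => by simpa using Exec.skip⟩

theorem Writes.seq {l : List (Fin m)} {c d : Cmd (Stk m) Sym}
    {str str' : ℕ → (Fin m → ℕ) → List Sym} (h : Writes l c str) (h' : Writes l d str') :
    Writes l (.seq c d) (fun w v => str w v ++ str' w v) := by
  obtain ⟨p, hp⟩ := h
  obtain ⟨q, hq⟩ := h'
  refine ⟨p + q, fun n inp out v hv => ?_⟩
  simpa using (hp n inp out v hv).seq (hq n inp _ v hv)

theorem writes_emit (s : List Sym) : Writes (m := m) [] (emit s) fun _ _ => s :=
  ⟨.C (s.length + 1), fun _ _ _ _ _ => by rw [Polynomial.eval_C]; exact exec_emit s _⟩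

theorem writes_emitCtr (i : Fin m) : Writes [] (emitCtr i) fun w v => symBinary w (v i) := by
  refine ⟨.C 5 * (.C 4 * (.X + 1)) + .C 2, fun n inp out v _ => (exec_emitCtr i _ rfl).mono ?_⟩
  simp [work, width_le]

/-- Write the ground instance of a literal. -/
def emitLit (tag : R → List Bool) (l : Lit R m) : Cmd (Stk m) Sym :=
  .seq (emitCtr (l.arg 0)) (.seq (emitCtr (l.arg 1)) (.seq (emitCtr (l.arg 2))
    (emit ((tag l.rel).map Sym.bit ++ [Sym.comma]))))

theorem writes_emitLit (tag : R → List Bool) (l : Lit R m) :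
    Writes [] (emitLit tag l) fun w v => litStr tag w l v := by
  have h := (writes_emitCtr (l.arg 0)).seq ((writes_emitCtr (l.arg 1)).seq
    ((writes_emitCtr (l.arg 2)).seq (writes_emit ((tag l.rel).map Sym.bit ++ [Sym.comma]))))
  simp only [litStr, atomBits, symBinary, List.map_append, List.append_assoc] at h ⊢
  exact h

/-- Run the programs of a list. -/
def seqAll (l : List (Cmd (Stk m) Sym)) : Cmd (Stk m) Sym := l.foldr .seq .skip

theorem writes_seqAll {α : Type} {f : α → Cmd (Stk m) Sym} {str : ℕ → α → (Fin m → ℕ) → List Sym}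
    (h : ∀ a, Writes [] (f a) fun w v => str w a v) (l : List α) :
    Writes [] (seqAll (l.map f)) fun w v => l.flatMap (str w · v) := by
  induction l with
  | nil => exact writes_skip
  | cons a l ih => exact (h a).seq ih

/-- Write the ground instance of a clause. -/
def emitClause (tag : R → List Bool) (c : List (Lit R m)) : Cmd (Stk m) Sym :=
  .seq (seqAll (c.map (emitLit tag))) (emit (Sym.semi :: clauseTable c))

theorem writes_emitClause (tag : R → List Bool) (c : List (Lit R m)) :
    Writes [] (emitClause tag c) fun w v => clauseStr tag w c v :=
  (writes_seqAll (writes_emitLit tag) c).seq (writes_emit _)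

/-! ### Loops over valuations -/

/-- The loop that runs as long as its body sets the flag. -/
theorem exec_loop_flag {c : Cmd (Stk m) Sym} {T N : ℕ} (state : ℕ → Store m)
    (hbody : ∀ a < N, Exec c (state a) T
      { state (a + 1) with flag := boolFlag (decide (a + 1 < N)) })
    (hflag : ∀ a, (state a).flag = []) (hN : 0 < N) :
    Exec (.loop .flag fun _ => c) { state 0 with flag := [Sym.bit true] } (N * (T + 1) + 1)
      (state N) := by
  have hpop : ∀ a l, Function.update { state a with flag := l : Store m }.stk .flag []
      = (state a).stk := by
    intro a l
    rw [Store.update_flag, ← hflag a]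
  suffices h : ∀ k a, a + k = N → Exec (.loop .flag fun _ => c)
      { state a with flag := boolFlag (decide (a < N)) } (k * (T + 1) + 1) (state N) by
    simpa [boolFlag, hN] using h N 0 (by omega)
  intro k
  induction k with
  | zero =>
    rintro a rfl
    have hnil : { state a with flag := [] } = state a := by rw [← hflag a]
    simp only [add_zero, lt_irrefl, decide_false, boolFlag, Bool.false_eq_true, if_false, hnil]
    exact ⟨1, by simp, .loop_nil (hflag a)⟩
  | succ k ih =>
    intro a ha
    obtain ⟨t, ht, hr⟩ := hbody a (by omega)
    obtain ⟨t', ht', hr'⟩ := ih (a + 1) (by omega)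
    refine ⟨t + t' + 1, by rw [add_mul k]; omega,
      .loop_cons (a := Sym.bit true) (l := []) ?_ ?_ hr'⟩
    · simp [Store.stk, boolFlag, show a < N by omega]
    · rw [hpop]
      exact hr

/-- Run a program for all the values of a counter that is zero. -/
def forAll (i : Fin m) (c : Cmd (Stk m) Sym) : Cmd (Stk m) Sym :=
  .seq (.push .flag (Sym.bit true)) (.loop .flag fun _ => .seq c (.seq (inc i)
    (.case .flag fun o => if o.isSome then .skip else .push .flag (Sym.bit true))))

theorem exec_inc_continue {w a : ℕ} (i : Fin m) (inp out : List Sym) (v : Fin m → ℕ)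
    (ha : a < 2 ^ w) :
    Exec (.seq (inc i) (.case .flag fun o =>
        if o.isSome then .skip else .push .flag (Sym.bit true)))
      (work w inp out (Function.update v i a)) (7 * (w + 1) + 2)
      { work w inp out (Function.update v i (a + 1)) with
        flag := boolFlag (decide (a + 1 < 2 ^ w)) } := by
  have h := exec_inc_work i inp out (Function.update v i a) (w := w)
  rw [Function.update_self, Function.update_idem] at h
  refine h.seq (Exec.case_flag (T := 1) ?_)
  have hdvd : 2 ^ w ∣ a + 1 ↔ ¬ a + 1 < 2 ^ w :=
    ⟨fun h => (Nat.le_of_dvd (by omega) h).not_gt, fun h => by rw [show a + 1 = 2 ^ w by omega]⟩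
  by_cases h : a + 1 < 2 ^ w
  · simpa [boolFlag, hdvd, h] using Exec.push_flag (Sym.bit true)
  · simpa [boolFlag, hdvd, h] using Exec.skip

theorem exec_forAll {w T : ℕ} (i : Fin m) {c : Cmd (Stk m) Sym} (inp out : List Sym)
    (v : Fin m → ℕ) (hv : v i = 0) {str : ℕ → List Sym}
    (h : ∀ a < 2 ^ w, ∀ out, Exec c (work w inp out (Function.update v i a)) T
      (work w inp (out ++ str a) (Function.update v i a))) :
    Exec (forAll i c) (work w inp out v) (2 ^ w * (T + (7 * (w + 1) + 2) + 1) + 2)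
      (work w inp (out ++ (List.range (2 ^ w)).flatMap str) v) := by
  have hloop := exec_loop_flag (N := 2 ^ w) (fun a =>
      work w inp (out ++ (List.range a).flatMap str) (Function.update v i a))
    (fun a ha => by
      rw [List.range_succ, List.flatMap_append, List.flatMap_singleton, ← List.append_assoc]
      exact (h a ha _).seq (exec_inc_continue i inp _ v ha))
    (fun _ => rfl) (by positivity)
  have hstart : Function.update v i 0 = v := Function.update_eq_self_iff.2 hv.symm
  have hend : work w inp (out ++ (List.range (2 ^ w)).flatMap str) (Function.update v i (2 ^ w))
      = work w inp (out ++ (List.range (2 ^ w)).flatMap str) v := by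
    conv_rhs => rw [← hstart]
    simp only [work, ← update_symBinary, symBinary_of_dvd dvd_rfl, symBinary_zero]
  rw [hend] at hloop
  simp only [List.range_zero, List.flatMap_nil, List.append_nil, hstart] at hloop
  exact ((Exec.push_flag _).seq hloop).mono (by omega)

theorem Writes.forAll {l : List (Fin m)} {i : Fin m} (hi : i ∉ l) {c : Cmd (Stk m) Sym}
    {str : ℕ → (Fin m → ℕ) → List Sym} (h : Writes l c str) :
    Writes (i :: l) (forAll i c) fun w v =>
      (List.range (2 ^ w)).flatMap fun a => str w (Function.update v i a) := by
  obtain ⟨p, hp⟩ := h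
  refine ⟨.C 4 * (.X + 1) * (p + (.C 7 * (.C 4 * (.X + 1) + 1) + .C 2) + 1) + .C 2,
    fun n inp out v hv => ?_⟩
  have hzero : ∀ a, ∀ j ∈ l, Function.update v i a j = 0 := by
    intro a j hj
    rw [Function.update_of_ne (ne_of_mem_of_not_mem hj hi), hv j (List.mem_cons_of_mem i hj)]
  refine (exec_forAll i inp out v (hv i List.mem_cons_self)
    fun a _ out => hp n inp out _ (hzero a)).mono ?_
  simp only [Polynomial.eval_add, Polynomial.eval_mul, Polynomial.eval_C, Polynomial.eval_X,
    Polynomial.eval_one]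
  gcongr
  · exact two_pow_width_le n
  · exact width_le n

/-- All the valuations that take values below `N` at `l` and agree with `v` elsewhere. -/
def tuples (N : ℕ) : List (Fin m) → (Fin m → ℕ) → List (Fin m → ℕ)
  | [], v => [v]
  | i :: l, v => (List.range N).flatMap fun a => tuples N l (Function.update v i a)

/-- Run a program for all the values of some counters that are zero. -/
def forTuples (l : List (Fin m)) (c : Cmd (Stk m) Sym) : Cmd (Stk m) Sym := l.foldr forAll c

theorem Writes.forTuples {l : List (Fin m)} (hl : l.Nodup) {c : Cmd (Stk m) Sym}
    {str : ℕ → (Fin m → ℕ) → List Sym} (h : Writes [] c str) :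
    Writes l (forTuples l c) fun w v => (tuples (2 ^ w) l v).flatMap (str w) := by
  induction l with
  | nil => simpa [tuples, FactorModel.forTuples] using h
  | cons i l ih =>
    rw [List.nodup_cons] at hl
    have h' := (ih hl.2).forAll hl.1
    simp only [tuples, List.flatMap_assoc] at h' ⊢
    exact h'

/-- The valuations with values below `2 ^ w`. -/
def valuations (m w : ℕ) : List (Fin m → ℕ) := tuples (2 ^ w) (List.finRange m) fun _ => 0

/-! ### The grounding program -/

theorem Cmd.Run.length_le {K Γ : Type} [DecidableEq K] {c : Cmd K Γ} {s s' : K → List Γ} {t : ℕ}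
    (h : Run c s t s') (k : K) : (s' k).length ≤ (s k).length + t := by
  have hupdate : ∀ (s : K → List Γ) (k' : K) (l : List Γ), l.length ≤ (s k').length →
      (Function.update s k' l k).length ≤ (s k).length := by
    intro s k' l hl
    rcases eq_or_ne k k' with rfl | e
    · rwa [Function.update_self]
    · rw [Function.update_of_ne e]
  induction h with
  | skip s => omega
  | push k' a s =>
    rcases eq_or_ne k k' with rfl | e
    · simp
    · simp [e]
  | seq _ _ ih ih' => omega
  | @case k' _ s t s' _ ih =>
    have := hupdate s k' (s k').tail (by simp)
    omega
  | loop_nil => omega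
  | @loop_cons k' _ s a l t s' t' s'' hk _ _ ih ih' =>
    have := hupdate s k' l (by simp [hk])
    omega

variable {R : Type} {m : ℕ}

/-- Increment a counter, which is lengthened when it overflows. -/
def grow (i : Fin m) : Cmd (Stk m) Sym :=
  .seq (inc i) (.case .flag fun o => if o.isSome then .push (.ctr i) (Sym.bit false) else .skip)

/-- The content of the growing counter after `k` increments: the number `k + 1` without its leading
bit. -/
def grown (k : ℕ) : List Sym := symBinary (Nat.log 2 (k + 1)) (k + 1)

theorem grown_succ (k : ℕ) : grown (k + 1) =
    (if 2 ^ Nat.log 2 (k + 1) ∣ k + 1 + 1 then [Sym.bit false] else []) ++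
      symBinary (Nat.log 2 (k + 1)) (k + 1 + 1) := by
  have hle := Nat.pow_log_le_self 2 (show k + 1 ≠ 0 by omega)
  have hlt := Nat.lt_pow_succ_log_self one_lt_two (k + 1)
  rw [grown]
  generalize Nat.log 2 (k + 1) = w at *
  split_ifs with h
  · have hk : k + 1 + 1 = 2 ^ (w + 1) := by
      obtain ⟨c, hc⟩ := h
      rw [pow_succ] at hlt ⊢
      have hc1 : 1 < c := lt_of_mul_lt_mul_left (a := 2 ^ w) (by omega) (by positivity)
      have hc2 : c ≤ 2 := le_of_mul_le_mul_left (a := 2 ^ w) (by omega) (by positivity)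
      rw [hc, show c = 2 by omega]
    rw [hk, Nat.log_pow one_lt_two, symBinary_of_dvd dvd_rfl,
      symBinary_of_dvd (pow_dvd_pow 2 w.le_succ)]
    rfl
  · have hne : k + 1 + 1 ≠ 2 ^ (w + 1) := fun e => h (e ▸ pow_dvd_pow 2 w.le_succ)
    rw [Nat.log_eq_of_pow_le_of_lt_pow (by omega) (show k + 1 + 1 < 2 ^ (w + 1) by omega),
      List.nil_append]

theorem exec_grow (i : Fin m) (S : Store m) (ht : S.tmp = []) (hf : S.flag = []) {k : ℕ}
    (hi : S.ctr i = grown k) :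
    Exec (grow i) S (7 * (k + 2) + 2)
      { S with ctr := Function.update S.ctr i (grown (k + 1)) } := by
  have hlog := Nat.log_le_self 2 (k + 1)
  obtain ⟨inp, tmp, out, res, _, ctr⟩ := S
  obtain rfl : _ = [] := hf
  refine ((exec_inc i _ ht rfl hi).seq (Exec.case_flag (T := 1) ?_)).mono (by omega)
  simp only [grown_succ]
  by_cases h : 2 ^ Nat.log 2 (k + 1) ∣ k + 1 + 1
  · simpa [boolFlag, h] using Exec.push_ctr (S := ⟨inp, tmp, out, res, [],
      Function.update ctr i (symBinary (Nat.log 2 (k + 1)) (k + 1 + 1))⟩) i (Sym.bit false)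
  · simpa [boolFlag, h] using Exec.skip

/-- Run a program for each counter. -/
def forCtrs (f : Fin m → Cmd (Stk m) Sym) : Cmd (Stk m) Sym := seqAll ((List.finRange m).map f)

theorem exec_forCtrs {f : Fin m → Cmd (Stk m) Sym} {T : ℕ} (g : List Sym → List Sym) (S : Store m)
    (h : ∀ i ctr, ctr i = S.ctr i → Exec (f i) { S with ctr := ctr } T
      { S with ctr := Function.update ctr i (g (ctr i)) }) :
    Exec (forCtrs f) S (m * T + 1) { S with ctr := fun i => g (S.ctr i) } := by
  suffices hl : ∀ l : List (Fin m), l.Nodup → ∀ ctr, (∀ i ∈ l, ctr i = S.ctr i) →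
      Exec (seqAll (l.map f)) { S with ctr := ctr } (l.length * T + 1)
        { S with ctr := fun i => if i ∈ l then g (ctr i) else ctr i } by
    have hall := hl _ (List.nodup_finRange m) S.ctr fun _ _ => rfl
    simp only [List.length_finRange, List.mem_finRange, if_true] at hall
    exact hall
  intro l
  induction l with
  | nil =>
    intro _ ctr _
    simp only [List.not_mem_nil, if_false]
    exact Exec.skip.mono (by omega)
  | cons i l ih =>
    intro hl ctr hctr
    rw [List.nodup_cons] at hl
    have hstep := (h i ctr (hctr i List.mem_cons_self)).seq
      (ih hl.2 (Function.update ctr i (g (ctr i))) fun j hj => by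
        rw [Function.update_of_ne (ne_of_mem_of_not_mem hj hl.1),
          hctr j (List.mem_cons_of_mem i hj)])
    have hend : (fun j => if j ∈ l then g (Function.update ctr i (g (ctr i)) j)
        else Function.update ctr i (g (ctr i)) j)
        = fun j => if j ∈ i :: l then g (ctr j) else ctr j := by
      funext j
      rcases eq_or_ne j i with rfl | hj
      · simp [hl.1]
      · simp [hj]
    rw [hend] at hstep
    exact hstep.mono (by rw [List.length_cons, add_mul]; omega)

/-- Move the input to the result in reverse and count its symbols. -/
def countInput (i : Fin m) : Cmd (Stk m) Sym := .loop .inp fun a => .seq (.push .res a) (grow i)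

theorem exec_countInput (i : Fin m) (w : List Sym) :
    Exec (countInput i) { inp := w } (w.length * (7 * (w.length + 2) + 4) + 1)
      { res := w.reverse, ctr := Function.update (fun _ => []) i (grown w.length) } := by
  have h := Exec.loop (k := .inp) (f := fun a => .seq (.push .res a) (grow i)) (w := w)
    (T := 1 + (7 * (w.length + 2) + 2))
    (fun y l => { inp := l, res := y.reverse
                  ctr := Function.update (fun _ => []) i (grown y.length) })
    (fun _ _ => Store.update_inp _ _) fun y a l hw => by
      have hy : y.length ≤ w.length := by rw [hw]; simp
      have hgrow := (exec_grow i { inp := l, res := a :: y.reverse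
                                   ctr := Function.update (fun _ => []) i (grown y.length) }
        rfl rfl (k := y.length) (by simp)).mono (T' := 7 * (w.length + 2) + 2) (by omega)
      simp only [Function.update_idem] at hgrow
      simp only [List.length_append, List.length_singleton, List.reverse_append,
        List.reverse_singleton, List.singleton_append]
      exact (Exec.push_res a).seq hgrow
  have hzero : Function.update (fun _ : Fin m => ([] : List Sym)) i (grown ([] : List Sym).length)
      = fun _ => [] := Function.update_eq_self_iff.2 rfl
  rw [hzero] at h
  exact h.mono (by rw [show 1 + (7 * (w.length + 2) + 2) + 1 = 7 * (w.length + 2) + 4 by omega])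

/-- Move the result back to the input. -/
def restoreInput : Cmd (Stk m) Sym := .loop .res fun a => .push .inp a

theorem exec_restoreInput (w : List Sym) (ctr : Fin m → List Sym) :
    Exec restoreInput { res := w.reverse, ctr := ctr } (w.length * 2 + 1)
      { inp := w, ctr := ctr } := by
  have h := Exec.loop (k := .res) (f := fun a => .push .inp a) (w := w.reverse) (T := 1)
    (fun y l => { inp := y.reverse, res := l, ctr := ctr })
    (fun _ _ => Store.update_res _ _) fun y a l _ => by simpa using Exec.push_inp a
  rwa [List.length_reverse, List.reverse_nil, List.reverse_reverse] at h

/-- Turn a counter of length `Nat.log 2 (n + 1)` into `width n` zeros on the scratch stack. -/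
def measureWidth (i : Fin m) : Cmd (Stk m) Sym :=
  .seq (.loop (.ctr i) fun _ => .push .tmp (Sym.bit false))
    (.seq (.push .tmp (Sym.bit false)) (.push .tmp (Sym.bit false)))

theorem exec_measureWidth (i : Fin m) (w : List Sym) (n : ℕ) :
    Exec (measureWidth i) { inp := w, ctr := Function.update (fun _ => []) i (grown n) }
      (width n * 2 + 3) { inp := w, tmp := List.replicate (width n) (Sym.bit false) } := by
  have h := Exec.loop (k := .ctr i) (f := fun _ => .push .tmp (Sym.bit false)) (w := grown n)
    (T := 1) (fun y l => { inp := w, tmp := List.replicate y.length (Sym.bit false)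
                           ctr := Function.update (fun _ => []) i l })
    (fun _ _ => by simp [Store.update_ctr]) fun y a l _ => by
      simpa [List.replicate_succ] using Exec.push_tmp (Sym.bit false)
  have hnil : Function.update (fun _ : Fin m => ([] : List Sym)) i [] = fun _ => [] :=
    Function.update_eq_self_iff.2 rfl
  rw [hnil, grown, length_symBinary] at h
  exact (h.seq ((Exec.push_tmp _).seq (Exec.push_tmp _))).mono (by rw [width]; omega)

/-- Push a zero on each counter for each symbol on the scratch stack. -/
def pushZeros : Cmd (Stk m) Sym :=
  .loop .tmp fun _ => forCtrs fun i => .push (.ctr i) (Sym.bit false)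

theorem exec_pushZeros (w : List Sym) (k : ℕ) :
    Exec pushZeros { inp := w, tmp := List.replicate k (Sym.bit false) } (k * (m + 2) + 1)
      (work k w [] fun _ : Fin m => 0) := by
  have h := Exec.loop (m := m) (k := .tmp)
    (f := fun _ => forCtrs fun i => .push (.ctr i) (Sym.bit false))
    (w := List.replicate k (Sym.bit false)) (T := m * 1 + 1)
    (fun y l => { inp := w, tmp := l, ctr := fun _ => List.replicate y.length (Sym.bit false) })
    (fun _ _ => Store.update_tmp _ _) fun y a l _ => by
      simpa [List.replicate_succ] using exec_forCtrs (Sym.bit false :: ·)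
        { inp := w, tmp := l, ctr := fun _ => List.replicate y.length (Sym.bit false) }
        fun i ctr _ => Exec.push_ctr i (Sym.bit false)
  simp only [List.length_replicate, mul_one] at h
  simp only [work, symBinary_zero]
  exact h

/-- Give all the counters their width, which depends on the length of the input. -/
def setup (i : Fin m) : Cmd (Stk m) Sym :=
  .seq (countInput i) (.seq restoreInput (.seq (measureWidth i) pushZeros))

theorem exec_setup (i : Fin m) : ∃ p : Polynomial ℕ, ∀ w : List Sym,
    Exec (setup i) { inp := w } (p.eval w.length) (work (width w.length) w [] fun _ => 0) := by
  refine ⟨.X * (.C 7 * (.X + .C 2) + .C 4) + 1 + (.X * .C 2 + 1 + (.C 4 * (.X + 1) * .C 2 + .C 3 +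
    (.C 4 * (.X + 1) * .C (m + 2) + 1))), fun w => ?_⟩
  refine ((exec_countInput i w).seq ((exec_restoreInput w _).seq
    ((exec_measureWidth i w w.length).seq (exec_pushZeros w _)))).mono ?_
  simp only [Polynomial.eval_add, Polynomial.eval_mul, Polynomial.eval_C, Polynomial.eval_X,
    Polynomial.eval_one]
  gcongr <;> exact width_le _

/-- Set a counter to zero. -/
def reset (i : Fin m) : Cmd (Stk m) Sym :=
  .seq (.loop (.ctr i) fun _ => .push .tmp (Sym.bit false)) (restore i)

theorem exec_reset {w : ℕ} (i : Fin m) (inp out : List Sym) (v : Fin m → ℕ) :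
    Exec (reset i) (work w inp out v) (4 * w + 2) (work w inp out (Function.update v i 0)) := by
  have h := Exec.loop (k := .ctr i) (f := fun _ => .push .tmp (Sym.bit false))
    (w := symBinary w (v i)) (T := 1)
    (fun y l => { work w inp out v with
      tmp := List.replicate y.length (Sym.bit false)
      ctr := Function.update (fun j => symBinary w (v j)) i l })
    (fun _ _ => by rw [Store.update_ctr]; simp) fun y a l _ => by
      simpa [List.replicate_succ] using Exec.push_tmp (Sym.bit false)
  have h' := h.seq (exec_restore i _)
  simp only [length_symBinary, Function.update_self, Function.update_idem, Function.update_eq_self,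
    List.append_nil, List.reverse_replicate, List.length_replicate, List.length_nil,
    List.replicate_zero] at h'
  rw [← symBinary_zero w, update_symBinary] at h'
  exact h'.mono (by omega)

/-- Empty the counters and move the output to the result. -/
def flush : Cmd (Stk m) Sym :=
  .seq (forCtrs fun i => .loop (.ctr i) fun _ => .skip) (.loop .out fun a => .push .res a)

theorem exec_flush {w : ℕ} (out : List Sym) (v : Fin m → ℕ) :
    Exec flush (work w [] out v) (m * (w * 2 + 1) + 1 + (out.length * 2 + 1)) { res := out } := by
  have hclear := exec_forCtrs (f := fun i => .loop (.ctr i) fun _ => .skip) (T := w * 2 + 1)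
    (fun _ => []) (work w [] out v) fun i ctr hctr => by
      have h := Exec.loop (k := .ctr i) (f := fun _ => .skip) (w := ctr i) (T := 1)
        (fun _ l => { work w [] out v with ctr := Function.update ctr i l })
        (fun _ _ => by rw [Store.update_ctr]; simp) fun _ _ _ _ => Exec.skip
      rw [Function.update_eq_self] at h
      exact h.mono (by simp [hctr, work])
  have hmove := Exec.loop (m := m) (k := .out) (f := fun a => .push .res a) (w := out.reverse)
    (T := 1) (fun y l => { out := l.reverse, res := y.reverse })
    (fun _ _ => Store.update_out _ _) fun y a l _ => by simpa using Exec.push_res a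
  simp only [List.reverse_reverse, List.reverse_nil, List.length_reverse] at hmove
  exact hclear.seq hmove

/-- The letters of a string with end markers. -/
inductive Mark
  | first
  | symb (s : Sym)
  | last
  deriving Fintype

/-- The string with end markers. -/
def marks (w : List Sym) : List Mark := .first :: w.map .symb ++ [.last]

/-- A finite set of universal clauses, together with clauses that describe a string: for each
position of the string with end markers, an instance of the clause of the mark at the position and
an instance of `next`. In these instances `i₀` is the position, `i₁` is the next position, and all
the other variables are zero. -/
structure Theory (R : Type) (m : ℕ) where
  i₀ : Fin m
  i₁ : Fin m
  ne : i₀ ≠ i₁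
  mark : Mark → List (Lit R m)
  next : List (Lit R m)
  rules : List (List (Lit R m))

namespace Theory

variable {R : Type} {m : ℕ} (Θ : Theory R m) (tag : R → List Bool)

/-- The valuation of the clauses about the position `a`. -/
def posVal (a : ℕ) : Fin m → ℕ :=
  Function.update (Function.update (fun _ => 0) Θ.i₁ (a + 1)) Θ.i₀ a

theorem posVal_i₀ (a : ℕ) : Θ.posVal a Θ.i₀ = a := Function.update_self ..

theorem posVal_i₁ (a : ℕ) : Θ.posVal a Θ.i₁ = a + 1 := by
  rw [posVal, Function.update_of_ne Θ.ne.symm, Function.update_self]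

theorem posVal_zero : Θ.posVal 0 = Function.update (fun _ => 0) Θ.i₁ 1 :=
  Function.update_eq_self_iff.2 (by rw [Function.update_of_ne Θ.ne])

theorem update_update_posVal (a x y : ℕ) :
    Function.update (Function.update (Θ.posVal a) Θ.i₀ x) Θ.i₁ y
      = Function.update (Function.update (fun _ => 0) Θ.i₁ y) Θ.i₀ x := by
  rw [posVal, Function.update_idem, Function.update_comm Θ.ne, Function.update_idem]

/-- The ground instances of the clauses about the positions of a list of marks. -/
def posInstances (l : List Mark) : List (List (Lit R m) × (Fin m → ℕ)) :=
  l.zipIdx.flatMap fun k => [(Θ.mark k.1, Θ.posVal k.2), (Θ.next, Θ.posVal k.2)]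

theorem posInstances_concat (l : List Mark) (k : Mark) : Θ.posInstances (l ++ [k]) =
    Θ.posInstances l ++ [(Θ.mark k, Θ.posVal l.length), (Θ.next, Θ.posVal l.length)] := by
  simp [posInstances, List.zipIdx_append]

/-- The ground instances of the clauses for the string `w`. -/
def instances (w : List Sym) : List (List (Lit R m) × (Fin m → ℕ)) :=
  Θ.posInstances (marks w) ++
    (valuations m (width w.length)).flatMap fun v => Θ.rules.map fun c => (c, v)

/-- The string of some ground instances of clauses. -/
def instancesStr (w : ℕ) (l : List (List (Lit R m) × (Fin m → ℕ))) : List Sym :=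
  l.flatMap fun i => clauseStr tag w i.1 i.2

/-- The output of the grounding program; `unit` is written for each valuation. -/
def text (unit w : List Sym) : List Sym :=
  [Sym.slash, Sym.bit true, Sym.semi] ++
    (valuations m (width w.length)).flatMap (fun _ => unit) ++ [Sym.semi] ++
    instancesStr tag (width w.length) (Θ.instances w)

/-- Advance the position. -/
def advance : Cmd (Stk m) Sym := .seq (inc Θ.i₀) (inc Θ.i₁)

theorem exec_advance {w : ℕ} (inp out : List Sym) {a : ℕ} (h : a + 2 < 2 ^ w) :
    Exec Θ.advance (work w inp out (Θ.posVal a)) (7 * (w + 1) + 7 * (w + 1))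
      (work w inp out (Θ.posVal (a + 1))) := by
  have h₀ := exec_inc_work_of_lt Θ.i₀ inp out (Θ.posVal a) (w := w) (by rw [posVal_i₀]; omega)
  rw [posVal_i₀] at h₀
  have hi₁ : Function.update (Θ.posVal a) Θ.i₀ (a + 1) Θ.i₁ = a + 1 := by
    rw [Function.update_of_ne Θ.ne.symm, posVal_i₁]
  have h₁ := exec_inc_work_of_lt Θ.i₁ inp out (Function.update (Θ.posVal a) Θ.i₀ (a + 1)) (w := w)
    (by omega)
  rw [hi₁, update_update_posVal] at h₁
  exact h₀.seq h₁

/-- Write the clauses about a position with the mark `k`, and advance the position. -/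
def emitMark (k : Mark) : Cmd (Stk m) Sym :=
  .seq (.seq (emitClause tag (Θ.mark k)) (emitClause tag Θ.next)) Θ.advance

/-- The store when the clauses about the positions of the marks `l` have been written. -/
def written (w : ℕ) (inp out : List Sym) (l : List Mark) : Store m :=
  work w inp (out ++ instancesStr tag w (Θ.posInstances l)) (Θ.posVal l.length)

theorem exec_emitMark : ∃ p : Polynomial ℕ, ∀ n inp out l k, l.length + 2 < 2 ^ width n →
    Exec (Θ.emitMark tag k) (Θ.written tag (width n) inp out l) (p.eval n)
      (Θ.written tag (width n) inp out (l ++ [k])) := by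
  choose p hp using fun k => (writes_emitClause tag (Θ.mark k)).seq (writes_emitClause tag Θ.next)
  refine ⟨∑ k, p k + .C 14 * (.C 4 * (.X + 1) + 1), fun n inp out l k hl => ?_⟩
  have h := (hp k n inp (out ++ instancesStr tag (width n) (Θ.posInstances l)) (Θ.posVal l.length)
    (by simp)).seq (Θ.exec_advance inp _ hl)
  have hstr : out ++ instancesStr tag (width n) (Θ.posInstances l) ++
      (clauseStr tag (width n) (Θ.mark k) (Θ.posVal l.length) ++
        clauseStr tag (width n) Θ.next (Θ.posVal l.length))
      = out ++ instancesStr tag (width n) (Θ.posInstances (l ++ [k])) := by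
    simp [posInstances_concat, instancesStr]
  rw [hstr] at h
  rw [written, written, List.length_append, List.length_singleton]
  refine h.mono ?_
  simp only [Polynomial.eval_add, Polynomial.eval_mul, Polynomial.eval_C, Polynomial.eval_X,
    Polynomial.eval_one, Polynomial.eval_finsetSum]
  have hk := Finset.single_le_sum (f := fun k => (p k).eval n) (fun _ _ => Nat.zero_le _)
    (Finset.mem_univ k)
  have hw := width_le n
  omega

/-- Write the clauses about the positions of the input. -/
def emitMarks : Cmd (Stk m) Sym :=
  .seq (Θ.emitMark tag .first) (.seq (.loop .inp fun s => Θ.emitMark tag (.symb s))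
    (Θ.emitMark tag .last))

theorem exec_emitMarks : ∃ p : Polynomial ℕ, ∀ w out : List Sym,
    Exec (Θ.emitMarks tag) (Θ.written tag (width w.length) w out []) (p.eval w.length)
      (Θ.written tag (width w.length) [] out (marks w)) := by
  obtain ⟨p, hp⟩ := Θ.exec_emitMark tag
  refine ⟨p + (.X * (p + 1) + 1 + p), fun w out => ?_⟩
  have hN := add_three_lt_two_pow_width w.length
  have hloop := Exec.loop (k := .inp) (f := fun s => Θ.emitMark tag (.symb s)) (w := w)
    (fun y l => Θ.written tag (width w.length) l out (.first :: y.map .symb))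
    (fun _ _ => Store.update_inp _ _) fun y a l hw => by
      have hlen := congrArg List.length hw
      simp only [List.length_append, List.length_cons] at hlen
      simpa using hp w.length l out (.first :: y.map .symb) (.symb a)
        (by simp only [List.length_cons, List.length_map]; omega)
  have hfirst := hp w.length w out [] .first (by simp only [List.length_nil]; omega)
  have hlast := hp w.length [] out (.first :: w.map .symb) .last
    (by simp only [List.length_cons, List.length_map]; omega)
  refine (hfirst.seq (hloop.seq hlast)).mono ?_
  simp

/-- Write the clauses about the positions and return to zero counters. -/
def emitPositions : Cmd (Stk m) Sym :=
  .seq (inc Θ.i₁) (.seq (Θ.emitMarks tag) (.seq (reset Θ.i₀) (reset Θ.i₁)))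

theorem exec_emitPositions : ∃ p : Polynomial ℕ, ∀ w out : List Sym,
    Exec (Θ.emitPositions tag) (work (width w.length) w out fun _ => 0) (p.eval w.length)
      (work (width w.length) []
        (out ++ instancesStr tag (width w.length) (Θ.posInstances (marks w))) fun _ => 0) := by
  obtain ⟨p, hp⟩ := Θ.exec_emitMarks tag
  refine ⟨.C 7 * (.C 4 * (.X + 1) + 1) + (p + ((.C 4 * (.C 4 * (.X + 1)) + .C 2) +
    (.C 4 * (.C 4 * (.X + 1)) + .C 2))), fun w out => ?_⟩
  have hN := add_three_lt_two_pow_width w.length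
  have hstart := exec_inc_work_of_lt Θ.i₁ w out (fun _ => 0) (w := width w.length) (by omega)
  rw [← posVal_zero] at hstart
  have hmarks := hp w out
  simp only [written, List.length_nil, posInstances, List.zipIdx_nil, List.flatMap_nil,
    instancesStr, List.append_nil] at hmarks
  have hend : Function.update (Function.update (Θ.posVal (marks w).length) Θ.i₀ 0) Θ.i₁ 0
      = fun _ => 0 := by
    rw [update_update_posVal, Function.update_eq_self_iff.2 rfl, Function.update_eq_self_iff.2 rfl]
  have h := hstart.seq (hmarks.seq ((exec_reset Θ.i₀ _ _ _).seq (exec_reset Θ.i₁ _ _ _)))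
  rw [hend] at h
  refine h.mono ?_
  simp only [Polynomial.eval_add, Polynomial.eval_mul, Polynomial.eval_C, Polynomial.eval_X,
    Polynomial.eval_one]
  gcongr <;> exact width_le _

/-- Write the output of the grounding program. -/
def emitText (unit : List Sym) : Cmd (Stk m) Sym :=
  .seq (setup Θ.i₀) (.seq (emit [Sym.slash, Sym.bit true, Sym.semi])
    (.seq (forTuples (List.finRange m) (emit unit)) (.seq (emit [Sym.semi])
      (.seq (Θ.emitPositions tag)
        (forTuples (List.finRange m) (seqAll (Θ.rules.map (emitClause tag))))))))

theorem exec_emitText (unit : List Sym) : ∃ p : Polynomial ℕ, ∀ w : List Sym,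
    Exec (Θ.emitText tag unit) { inp := w } (p.eval w.length)
      (work (width w.length) [] (Θ.text tag unit w) fun _ => 0) := by
  have hnodup := List.nodup_finRange m
  obtain ⟨p₁, h₁⟩ := exec_setup Θ.i₀
  obtain ⟨p₂, h₂⟩ := (writes_emit unit).forTuples hnodup
  obtain ⟨p₃, h₃⟩ := Θ.exec_emitPositions tag
  obtain ⟨p₄, h₄⟩ := (writes_seqAll (writes_emitClause tag) Θ.rules).forTuples hnodup
  refine ⟨p₁ + (.C 4 + (p₂ + (.C 2 + (p₃ + p₄)))), fun w => ?_⟩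
  have h := (h₁ w).seq ((exec_emit [Sym.slash, Sym.bit true, Sym.semi] _).seq
    ((h₂ w.length w _ _ fun _ _ => rfl).seq ((exec_emit [Sym.semi] _).seq
      ((h₃ w _).seq (h₄ w.length [] _ _ fun _ _ => rfl)))))
  have htext : [] ++ [Sym.slash, Sym.bit true, Sym.semi] ++
      (valuations m (width w.length)).flatMap (fun _ => unit) ++ [Sym.semi] ++
      instancesStr tag (width w.length) (Θ.posInstances (marks w)) ++
      (valuations m (width w.length)).flatMap
        (fun v => Θ.rules.flatMap (clauseStr tag (width w.length) · v)) = Θ.text tag unit w := by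
    simp [text, instances, instancesStr, List.flatMap_assoc, List.flatMap_map]
  rw [← htext]
  exact h.mono (by simp)

/-- The grounding program. -/
def program (unit : List Sym) : Cmd (Stk m) Sym := .seq (Θ.emitText tag unit) flush

theorem exec_program (unit : List Sym) : ∃ p : Polynomial ℕ, ∀ w : List Sym,
    Exec (Θ.program tag unit) { inp := w } (p.eval w.length) { res := Θ.text tag unit w } := by
  obtain ⟨p, hp⟩ := Θ.exec_emitText tag unit
  refine ⟨p + (.C m * (.C 4 * (.X + 1) * .C 2 + 1) + 1 + (p * .C 2 + 1)), fun w => ?_⟩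
  have hlength : (Θ.text tag unit w).length ≤ p.eval w.length := by
    obtain ⟨t, ht, hr⟩ := hp w
    have hout := hr.length_le .out
    simp only [Store.stk, work, List.length_reverse, List.length_nil] at hout
    omega
  refine ((hp w).seq (exec_flush _ _)).mono ?_
  simp only [Polynomial.eval_add, Polynomial.eval_mul, Polynomial.eval_C, Polynomial.eval_X,
    Polynomial.eval_one]
  gcongr
  exact width_le _

end Theory

end

/-- The number with the given binary digits, least significant first. -/
def ofBits (l : List Bool) : ℕ :=
  Nat.ofDigits 2 (l.map Bool.toNat)

theorem ofBits_cons (b : Bool) (l : List Bool) : ofBits (b :: l) = b.toNat + 2 * ofBits l :=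
  Nat.ofDigits_cons

theorem map_toNat_bits (k : ℕ) : k.bits.map Bool.toNat = Nat.digits 2 k := by
  rw [Nat.digits_two_eq_bits]
  exact List.map_congr_left fun b _ => by cases b <;> rfl

theorem ofBits_bits (k : ℕ) : ofBits k.bits = k := by
  rw [ofBits, map_toNat_bits, Nat.ofDigits_digits]

theorem bits_ofBits (l : List Bool) : (ofBits (l ++ [true])).bits = l ++ [true] := by
  have hinj : Function.Injective Bool.toNat := by decide
  refine List.map_injective_iff.2 hinj ?_
  have hdigits : Nat.digits 2 (ofBits (l ++ [true])) = (l ++ [true]).map Bool.toNat :=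
    Nat.digits_ofDigits 2 one_lt_two _
      (fun a ha => by obtain ⟨b, -, rfl⟩ := List.mem_map.1 ha; exact b.toNat_lt) (by simp)
  rw [map_toNat_bits, hdigits]

theorem flatten_replicate_mul {α : Type*} (a b : ℕ) (s : List α) :
    (List.replicate (a * b) s).flatten
      = (List.replicate a (List.replicate b s).flatten).flatten := by
  induction a with
  | zero => simp
  | succ a ih =>
    rw [Nat.succ_mul, Nat.add_comm, List.replicate_add, List.flatten_append, ih,
      List.replicate_succ, List.flatten_cons]

section Atoms

variable {R : Type} [Fintype R]

/-- The bits that name a relation symbol. The last one is set, so that the bits of an atom are those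
of a number. -/
noncomputable def relTag (r : R) : List Bool :=
  binary (Fintype.card R) (Fintype.equivFin R r) ++ [true]

theorem length_relTag (r : R) : (relTag r).length = Fintype.card R + 1 := by simp [relTag]

theorem relTag_injective : Function.Injective (relTag (R := R)) := fun r s h =>
  (Fintype.equivFin R).injective <| Fin.ext <|
    binary_injective ((Fintype.equivFin R r).2.trans Nat.lt_two_pow_self)
      ((Fintype.equivFin R s).2.trans Nat.lt_two_pow_self) (List.append_cancel_right h)

/-- The propositional variable of a ground atom. -/
noncomputable def atomVar (w : ℕ) (r : R) (a : Fin 3 → ℕ) : ℕ :=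
  ofBits (atomBits relTag w r a)

theorem bits_atomVar (w : ℕ) (r : R) (a : Fin 3 → ℕ) :
    (atomVar w r a).bits = atomBits relTag w r a := by
  rw [atomVar, atomBits, relTag, ← List.append_assoc]
  exact bits_ofBits _

theorem atomVar_lt (w : ℕ) (r : R) (a : Fin 3 → ℕ) :
    atomVar w r a < 2 ^ (w * 3 + (Fintype.card R + 1)) := by
  have hlen : ((atomBits relTag w r a).map Bool.toNat).length = w * 3 + (Fintype.card R + 1) := by
    simp only [atomBits, List.length_map, List.length_append, length_binary, length_relTag]
    omega
  rw [← hlen]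
  refine Nat.ofDigits_lt_base_pow_length one_lt_two fun d hd => ?_
  obtain ⟨b, -, rfl⟩ := List.mem_map.1 hd
  exact b.toNat_lt

theorem eq_of_atomVar_eq {w : ℕ} {r s : R} {a b : Fin 3 → ℕ} (h : atomVar w r a = atomVar w s b) :
    r = s ∧ ∀ k, binary w (a k) = binary w (b k) := by
  have hbits : atomBits relTag w r a = atomBits relTag w s b := by
    rw [← bits_atomVar, h, bits_atomVar]
  obtain ⟨h₀₁₂, hrel⟩ := List.append_inj hbits (by simp)
  obtain ⟨h₀₁, h₂⟩ := List.append_inj h₀₁₂ (by simp)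
  obtain ⟨h₀, h₁⟩ := List.append_inj h₀₁ (by simp)
  exact ⟨relTag_injective hrel, Fin.forall_fin_succ.2 ⟨h₀, Fin.forall_fin_two.2 ⟨h₁, h₂⟩⟩⟩

end Atoms

/-- The factor of a clause over binary variables that is falsified by the row `y₀`. -/
def clauseFactor {n k : ℕ} (var : Fin k ↪ Fin n) (y₀ : Fin k → Fin 2) :
    Factor (fun _ : Fin n => 2) where
  arity := k
  scope := var
  val y := if y = y₀ then 0 else 1

theorem clauseFactor_isClause {n k : ℕ} (var : Fin k ↪ Fin n) (y₀ : Fin k → Fin 2) :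
    (clauseFactor var y₀).IsClause := ⟨y₀, fun _ => rfl⟩

theorem clauseFactor_eval_eq_zero {n k : ℕ} (var : Fin k ↪ Fin n) (y₀ : Fin k → Fin 2)
    (x : Fin n → Fin 2) : (clauseFactor var y₀).eval x = 0 ↔ (fun j => x (var j)) = y₀ := by
  change (if (fun j => x (var j)) = y₀ then (0 : ℚ≥0) else 1) = 0 ↔ _
  simp

theorem dpr_iff_exists_joint_ne_zero {Q : Query} (h : Q.k = 0) :
    DPR Q ↔ ∃ x, Q.model.joint x ≠ 0 := by
  rw [DPR, h, gt_iff_lt, (Finset.sum_nonneg fun x _ => NNRat.coe_nonneg _).lt_iff_ne', Ne,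
    Finset.sum_eq_zero_iff_of_nonneg fun x _ => NNRat.coe_nonneg _]
  simp

theorem joint_ne_zero_iff {M : Model} {x : Instantiation M.card} :
    M.joint x ≠ 0 ↔ ∀ f ∈ M.factors, f.eval x ≠ 0 := by
  simp [Model.joint, List.prod_eq_zero_iff]

variable {R : Type} {m : ℕ}

/-- The structure `A` satisfies the clause `c` at the valuation `v`. -/
def Holds (A : R → (Fin 3 → ℕ) → Prop) (c : List (Lit R m)) (v : Fin m → ℕ) : Prop :=
  ∃ l ∈ c, (A l.rel (fun k => v (l.arg k)) ↔ l.pos = true)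

theorem ne_falsifier_iff {c : List (Lit R m)} {y : Fin c.length → Fin 2} :
    y ≠ falsifier c ↔ ∃ j, (y j = 1 ↔ (c.get j).pos = true) := by
  have hbit : ∀ (b : Fin 2) (p : Bool), b ≠ (if p then 0 else 1) ↔ (b = 1 ↔ p = true) := by decide
  simp only [Ne, funext_iff, not_forall, falsifier, ← hbit]

theorem length_tuples (N : ℕ) (l : List (Fin m)) (v : Fin m → ℕ) :
    (tuples N l v).length = N ^ l.length := by
  induction l generalizing v with
  | nil => simp [tuples]
  | cons i l ih => simp [tuples, List.length_flatMap, ih, pow_succ']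

theorem mem_tuples {N : ℕ} {l : List (Fin m)} {v u : Fin m → ℕ} :
    u ∈ tuples N l v ↔ (∀ i ∈ l, u i < N) ∧ ∀ i ∉ l, u i = v i := by
  induction l generalizing v with
  | nil => simp [tuples, funext_iff]
  | cons i l ih =>
    simp only [tuples, List.mem_flatMap, List.mem_range, ih, List.forall_mem_cons]
    constructor
    · rintro ⟨a, ha, hlt, heq⟩
      refine ⟨⟨?_, hlt⟩, fun j hj => ?_⟩
      · by_cases hil : i ∈ l
        · exact hlt i hil
        · rwa [heq i hil, Function.update_self]
      · rw [List.mem_cons, not_or] at hj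
        rw [heq j hj.2, Function.update_of_ne hj.1]
    · rintro ⟨⟨hi, hlt⟩, heq⟩
      refine ⟨u i, hi, hlt, fun j hj => ?_⟩
      by_cases hji : j = i
      · rw [hji, Function.update_self]
      · rw [Function.update_of_ne hji, heq j (by simp [hj, hji])]

theorem mem_valuations {w : ℕ} {v : Fin m → ℕ} : v ∈ valuations m w ↔ ∀ i, v i < 2 ^ w := by
  simp [valuations, mem_tuples]

theorem length_valuations (m w : ℕ) : (valuations m w).length = (2 ^ w) ^ m := by
  simp [valuations, length_tuples]

namespace Theory

variable (Θ : Theory R m)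

/-- The clauses of a theory. -/
def clauses : Set (List (Lit R m)) := Set.range Θ.mark ∪ {c | c = Θ.next ∨ c ∈ Θ.rules}

/-- The structure `A` is a model of the ground instances of the theory for the string `w`. -/
def Models (A : R → (Fin 3 → ℕ) → Prop) (w : List Sym) : Prop :=
  ∀ i ∈ Θ.instances w, Holds A i.1 i.2

theorem posVal_lt {a n : ℕ} (h : a ≤ n + 1) (i : Fin m) : Θ.posVal a i < 2 ^ width n := by
  have hn := add_three_lt_two_pow_width n
  simp only [posVal, Function.update_apply]
  split_ifs <;> omega

theorem mem_posInstances {l : List Mark} {i : List (Lit R m) × (Fin m → ℕ)} :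
    i ∈ Θ.posInstances l ↔ ∃ j k, l[j]? = some k ∧
      (i = (Θ.mark k, Θ.posVal j) ∨ i = (Θ.next, Θ.posVal j)) := by
  simp only [posInstances, List.mem_flatMap, Prod.exists, List.mem_zipIdx_iff_getElem?,
    List.mem_cons, List.not_mem_nil, or_false]
  exact exists_comm

theorem length_marks (w : List Sym) : (marks w).length = w.length + 2 := by simp [marks]

variable {Θ} in
theorem clause_mem_and_lt {w : List Sym} {i : List (Lit R m) × (Fin m → ℕ)}
    (hi : i ∈ Θ.instances w) : i.1 ∈ Θ.clauses ∧ ∀ j, i.2 j < 2 ^ width w.length := by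
  simp only [instances, List.mem_append, mem_posInstances, List.mem_flatMap, List.mem_map] at hi
  rcases hi with ⟨j, k, hj, hi⟩ | ⟨v, hv, c, hc, rfl⟩
  · have hlt := (List.getElem?_eq_some_iff.1 hj).1
    rw [length_marks] at hlt
    rcases hi with rfl | rfl
    · exact ⟨.inl ⟨k, rfl⟩, Θ.posVal_lt (by omega)⟩
    · exact ⟨.inr (.inl rfl), Θ.posVal_lt (by omega)⟩
  · exact ⟨.inr (.inr hc), mem_valuations.1 hv⟩

/-- No two literals of a clause have the same relation symbol, so that the ground instances of a
clause are clauses over distinct variables. -/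
def IsLinear : Prop := ∀ c ∈ Θ.clauses, (c.map Lit.rel).Nodup

variable [Fintype R]

/-- The number of propositional variables. -/
def numVars (R : Type) [Fintype R] (m : ℕ) (w : List Sym) : ℕ :=
  (2 ^ width w.length) ^ m * 2 ^ (Fintype.card R + 1)

theorem atomVar_lt_numVars (hm : 3 ≤ m) (w : List Sym) (r : R) (a : Fin 3 → ℕ) :
    atomVar (width w.length) r a < numVars R m w := by
  refine (atomVar_lt _ r a).trans_le ?_
  rw [numVars, pow_add, pow_mul]
  gcongr
  exact Nat.one_le_two_pow

variable {Θ} (h : Θ.IsLinear) (hm : 3 ≤ m) (w : List Sym)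

/-- The propositional variables of the ground instance of a clause. -/
noncomputable def clauseVars {c : List (Lit R m)} (hc : c ∈ Θ.clauses) (v : Fin m → ℕ) :
    Fin c.length ↪ Fin (numVars R m w) where
  toFun i := ⟨atomVar (width w.length) (c.get i).rel fun k => v ((c.get i).arg k),
    atomVar_lt_numVars hm w _ _⟩
  inj' i j hij := by
    have hrel := (eq_of_atomVar_eq (congrArg Fin.val hij)).1
    have hinj := List.nodup_iff_injective_get.1 (h c hc)
    have hij' := @hinj (i.cast (List.length_map _).symm) (j.cast (List.length_map _).symm)
      (by simpa using hrel)
    exact Fin.cast_injective _ hij'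

/-- The factors of the ground instances of the clauses. -/
noncomputable def groundFactors : List (Factor fun _ : Fin (numVars R m w) => 2) :=
  (Θ.instances w).attach.map fun i =>
    clauseFactor (clauseVars h hm w (clause_mem_and_lt i.2).1 i.1.2) (falsifier i.1.1)

/-- The ground instances of the clauses as a CNF. -/
noncomputable def query : Query where
  model :=
    { numVars := numVars R m w
      card := fun _ => 2
      card_pos := fun _ => two_pos
      factors := groundFactors h hm w }
  k := 0

theorem query_isCNF : (query h hm w).model.IsCNF := by
  refine ⟨fun _ => rfl, fun f hf => ?_⟩
  obtain ⟨i, -, rfl⟩ := List.mem_map.1 hf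
  exact clauseFactor_isClause _ _

/-- The string to write for each valuation, so that the numbers of values of all the variables are
written. -/
def unitStr (R : Type) [Fintype R] : List Sym :=
  (List.replicate (2 ^ (Fintype.card R + 1)) (encNat 2 ++ [Sym.comma])).flatten

theorem encode_card (w : List Sym) : encList encNat (List.ofFn fun _ : Fin (numVars R m w) => 2)
    = (valuations m (width w.length)).flatMap (fun _ => unitStr R) ++ [Sym.semi] := by
  rw [encList, List.ofFn_const, List.flatMap_def, List.map_replicate, numVars,
    flatten_replicate_mul, List.flatMap_def, List.map_const', length_valuations, unitStr]

theorem encode_clauseFactor {c : List (Lit R m)} (hc : c ∈ Θ.clauses) (v : Fin m → ℕ) :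
    (clauseFactor (clauseVars h hm w hc v) (falsifier c)).encode
      = clauseStr relTag (width w.length) c v := by
  have hvars : encList (fun u : Fin (numVars R m w) => encNat u)
      (List.ofFn (clauseVars h hm w hc v)) =
      c.flatMap (litStr relTag (width w.length) · v) ++ [Sym.semi] := by
    rw [encList, List.flatMap_def, List.flatMap_def]
    refine congrArg (fun l => l.flatten ++ [Sym.semi]) (List.ext_getElem ?_ fun i _ _ => ?_)
    · rw [List.length_map, List.length_map, List.length_ofFn]
    · simp [clauseVars, litStr, encNat, bits_atomVar]
  rw [clauseStr, List.append_cons, ← hvars]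
  rfl

theorem encode_groundFactors : (groundFactors h hm w).flatMap Factor.encode
    = instancesStr relTag (width w.length) (Θ.instances w) := by
  rw [groundFactors, List.flatMap_map]
  rw [instancesStr]
  conv_rhs => rw [← List.attach_map_subtype_val (Θ.instances w), List.flatMap_map]
  exact List.flatMap_congr fun i _ => encode_clauseFactor h hm w _ _

theorem encode_query : (query h hm w).encode = Θ.text relTag (unitStr R) w := by
  have hk : encRat (query h hm w).k = [Sym.slash, Sym.bit true] := by simp [query, encRat, encNat]
  have hcard : encList encNat (List.ofFn (query h hm w).model.card) = _ := encode_card w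
  have hfactors : (query h hm w).model.factors.flatMap Factor.encode = _ :=
    encode_groundFactors h hm w
  rw [Query.encode, hk, hcard, hfactors, text]
  simp

theorem dpr_query_iff_falsifier : DPR (query h hm w) ↔
    ∃ x : Fin (numVars R m w) → Fin 2, ∀ i (hi : i ∈ Θ.instances w),
      (fun j => x (clauseVars h hm w (clause_mem_and_lt hi).1 i.2 j)) ≠ falsifier i.1 := by
  rw [dpr_iff_exists_joint_ne_zero rfl]
  refine exists_congr fun x => joint_ne_zero_iff.trans ?_
  refine List.forall_mem_map.trans ⟨fun hx i hi => ?_, fun hx i _ => ?_⟩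
  · exact (clauseFactor_eval_eq_zero _ _ _).not.1 (hx ⟨i, hi⟩ (List.mem_attach _ _))
  · exact (clauseFactor_eval_eq_zero _ _ _).not.2 (hx i.1 i.2)

theorem dpr_query : DPR (query h hm w) ↔ ∃ A, Θ.Models A w := by
  rw [dpr_query_iff_falsifier]
  simp only [ne_falsifier_iff]
  constructor
  · rintro ⟨x, hx⟩
    refine ⟨fun r a => x ⟨_, atomVar_lt_numVars hm w r a⟩ = 1, fun i hi => ?_⟩
    obtain ⟨j, hj⟩ := hx i hi
    exact ⟨i.1.get j, List.get_mem _ _, hj⟩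
  · rintro ⟨A, hA⟩
    classical
    refine ⟨fun u => if ∃ r a, (∀ k, a k < 2 ^ width w.length) ∧ atomVar (width w.length) r a = u ∧
      A r a then 1 else 0, fun i hi => ?_⟩
    obtain ⟨l, hl, hsat⟩ := hA i hi
    obtain ⟨j, rfl⟩ := List.get_of_mem hl
    have hlt := (clause_mem_and_lt hi).2
    refine ⟨j, Iff.trans ?_ hsat⟩
    simp only [ite_eq_left_iff, zero_ne_one, imp_false, not_not]
    refine ⟨?_, fun hj => ⟨_, _, fun k => hlt _, rfl, hj⟩⟩
    rintro ⟨r, a, ha, hvar, hr⟩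
    obtain ⟨hrel, hbits⟩ := eq_of_atomVar_eq (s := (i.1.get j).rel)
      (b := fun k => i.2 ((i.1.get j).arg k)) hvar
    have harg : a = fun k => i.2 ((i.1.get j).arg k) :=
      funext fun k => binary_injective (ha k) (hlt _) (hbits k)
    rwa [← hrel, ← harg]

end Theory

namespace Theory

variable {R : Type} {m : ℕ} (Θ : Theory R m)

theorem finite_clauses : Θ.clauses.Finite :=
  (Set.finite_range Θ.mark).union ((List.finite_toSet (Θ.next :: Θ.rules)).subset fun _ => by simp)

variable (S : ℕ) [NeZero S]

/-- Replace the relation symbol of each literal of a clause by the copy of it that is numbered by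
the position of the literal. -/
def slotted (c : List (Lit R m)) : List (Lit (R × Fin S) m) :=
  c.mapIdx fun i l => ⟨(l.rel, Fin.ofNat S i), l.arg, l.pos⟩

variable {S}

/-- The clause that the copy `s` of the relation symbol `r` implies the copy `t`. -/
def link (a : Fin 3 → Fin m) (r : R) (s t : Fin S) : List (Lit (R × Fin S) m) :=
  [⟨(r, s), a, false⟩, ⟨(r, t), a, true⟩]

variable [Fintype R]

/-- The clauses that all the copies of each relation symbol are equivalent. -/
noncomputable def links (a : Fin 3 → Fin m) : List (List (Lit (R × Fin S) m)) :=
  ((Finset.univ : Finset (R × Fin S × Fin S)).filter fun x => x.2.1 ≠ x.2.2).toList.map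
    fun x => link a x.1 x.2.1 x.2.2

omit [NeZero S] in
theorem mem_links {a : Fin 3 → Fin m} {c : List (Lit (R × Fin S) m)} :
    c ∈ links a ↔ ∃ r s t, s ≠ t ∧ link a r s t = c := by
  simp only [links, List.mem_map, Finset.mem_toList, Finset.mem_filter, Finset.mem_univ, true_and,
    Prod.exists]

/-- An equivalent theory without repeated relation symbols in the clauses. -/
noncomputable def linearize (S : ℕ) [NeZero S] (a : Fin 3 → Fin m) : Theory (R × Fin S) m where
  i₀ := Θ.i₀
  i₁ := Θ.i₁
  ne := Θ.ne
  mark k := slotted S (Θ.mark k)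
  next := slotted S Θ.next
  rules := Θ.rules.map (slotted S) ++ links a

omit [Fintype R] in
theorem nodup_slotted {c : List (Lit R m)} (hc : c.length ≤ S) :
    ((slotted S c).map Lit.rel).Nodup := by
  rw [List.Nodup, List.pairwise_iff_getElem]
  intro i j hi hj hij heq
  simp only [slotted, List.length_map, List.length_mapIdx, List.getElem_map, List.getElem_mapIdx,
    Prod.mk.injEq, Fin.ext_iff, Fin.val_ofNat] at hi hj heq
  rw [Nat.mod_eq_of_lt (by omega), Nat.mod_eq_of_lt (by omega)] at heq
  exact hij.ne heq.2

variable {a : Fin 3 → Fin m}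

theorem isLinear_linearize (hS : ∀ c ∈ Θ.clauses, c.length ≤ S) : (Θ.linearize S a).IsLinear := by
  rintro c (⟨k, rfl⟩ | rfl | hc)
  · exact nodup_slotted (hS _ (.inl ⟨k, rfl⟩))
  · exact nodup_slotted (hS _ (.inr (.inl rfl)))
  · rcases List.mem_append.1 hc with hc | hc
    · obtain ⟨d, hd, rfl⟩ := List.mem_map.1 hc
      exact nodup_slotted (hS _ (.inr (.inr hd)))
    · obtain ⟨r, s, t, hst, rfl⟩ := mem_links.1 hc
      simp [link, hst]

theorem models_linearize {A : R × Fin S → (Fin 3 → ℕ) → Prop} {w : List Sym} :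
    (Θ.linearize S a).Models A w ↔ (∀ i ∈ Θ.instances w, Holds A (slotted S i.1) i.2) ∧
      ∀ v, (∀ k, v k < 2 ^ width w.length) → ∀ r s t, s ≠ t → Holds A (link a r s t) v := by
  have hpos : (Θ.linearize S a).posInstances (marks w)
      = (Θ.posInstances (marks w)).map fun i => (slotted S i.1, i.2) := by
    rw [posInstances, posInstances, List.map_flatMap]
    rfl
  have hrules : (Θ.linearize S a).rules = Θ.rules.map (slotted S) ++ links a := rfl
  simp only [Models, instances, hpos, hrules, List.mem_append, List.mem_flatMap, List.mem_map,
    mem_links, mem_valuations]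
  constructor
  · refine fun h => ⟨?_, fun v hv r s t hst =>
      h (_, v) (.inr ⟨v, hv, _, .inr ⟨r, s, t, hst, rfl⟩, rfl⟩)⟩
    rintro i (hi | ⟨v, hv, c, hc, rfl⟩)
    · exact h (_, _) (.inl ⟨i, hi, rfl⟩)
    · exact h (_, v) (.inr ⟨v, hv, _, .inl ⟨c, hc, rfl⟩, rfl⟩)
  · rintro ⟨hinst, hlink⟩ i (⟨j, hj, rfl⟩ | ⟨v, hv, c, ⟨d, hd, rfl⟩ | ⟨r, s, t, hst, rfl⟩, rfl⟩)
    · exact hinst j (.inl hj)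
    · exact hinst (d, v) (.inr ⟨v, hv, d, hd, rfl⟩)
    · exact hlink v hv r s t hst

omit [Fintype R] in
theorem holds_slotted {A : R × Fin S → (Fin 3 → ℕ) → Prop} {l : List (Lit R m)} {v : Fin m → ℕ} :
    Holds A (slotted S l) v ↔ ∃ (i : ℕ) (h : i < l.length),
      (A (l[i].rel, Fin.ofNat S i) (fun k => v (l[i].arg k)) ↔ l[i].pos = true) := by
  simp only [Holds, slotted, List.mem_mapIdx]
  constructor
  · rintro ⟨_, ⟨i, hi, rfl⟩, h⟩
    exact ⟨i, hi, h⟩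
  · rintro ⟨i, hi, h⟩
    exact ⟨_, ⟨i, hi, rfl⟩, h⟩

omit [NeZero S] [Fintype R] in
theorem holds_link {A : R × Fin S → (Fin 3 → ℕ) → Prop} {r : R} {s t : Fin S} {v : Fin m → ℕ} :
    Holds A (link a r s t) v ↔ (A (r, s) (fun k => v (a k)) → A (r, t) fun k => v (a k)) := by
  simp [Holds, link, imp_iff_not_or]

theorem copy_imp_copy (ha : Function.Injective a) {A : R × Fin S → (Fin 3 → ℕ) → Prop}
    {w : List Sym} (hA : (Θ.linearize S a).Models A w) {b : Fin 3 → ℕ}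
    (hb : ∀ k, b k < 2 ^ width w.length) {r : R} {s t : Fin S} (h : A (r, s) b) : A (r, t) b := by
  by_cases hst : s = t
  · rwa [← hst]
  · have hlt : ∀ k, Function.extend a b (fun _ => 0) k < 2 ^ width w.length := by
      intro k
      by_cases hk : ∃ j, a j = k
      · obtain ⟨j, rfl⟩ := hk
        rw [ha.extend_apply]
        exact hb j
      · rw [Function.extend_apply' _ _ _ hk]
        exact Nat.two_pow_pos _
    have hlink := holds_link.1 ((Θ.models_linearize.1 hA).2 _ hlt r s t hst)
    simp only [ha.extend_apply] at hlink
    exact hlink h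

theorem exists_models_linearize (ha : Function.Injective a) (w : List Sym) :
    (∃ A, (Θ.linearize S a).Models A w) ↔ ∃ A, Θ.Models A w := by
  constructor
  · rintro ⟨A, hA⟩
    refine ⟨fun r b => A (r, 0) b, fun i hi => ?_⟩
    obtain ⟨j, hj, hsat⟩ := holds_slotted.1 ((Θ.models_linearize.1 hA).1 i hi)
    have hb : ∀ k, i.2 (i.1[j].arg k) < 2 ^ width w.length := fun k => (clause_mem_and_lt hi).2 _
    exact ⟨i.1[j], List.getElem_mem _,
      Iff.trans ⟨Θ.copy_imp_copy ha hA hb, Θ.copy_imp_copy ha hA hb⟩ hsat⟩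
  · rintro ⟨A, hA⟩
    refine ⟨fun r b => A r.1 b, Θ.models_linearize.2
      ⟨fun i hi => ?_, fun v _ r s t _ => holds_link.2 id⟩⟩
    obtain ⟨l, hl, hsat⟩ := hA i hi
    obtain ⟨k, hk, rfl⟩ := List.getElem_of_mem hl
    exact holds_slotted.2 ⟨k, hk, hsat⟩

theorem nonempty_tm2ComputableInPolyTime_query {α : Type} (e : α → List Sym) {Θ : Theory R m}
    (h : Θ.IsLinear) (hm : 3 ≤ m) :
    Nonempty (Turing.TM2ComputableInPolyTime e Query.encode fun x => query h hm (e x)) := by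
  obtain ⟨p, hp⟩ := Θ.exec_program relTag (unitStr R)
  refine Cmd.tm2ComputableInPolyTime (Θ.program relTag (unitStr R)) .inp .res p fun x => ?_
  have hinp : Function.update (fun _ : Stk m => []) Stk.inp (e x) = Store.stk { inp := e x } := by
    funext k
    cases k <;> simp [Store.stk]
  have hres : Function.update (fun _ : Stk m => []) Stk.res (query h hm (e x)).encode
      = Store.stk { res := Θ.text relTag (unitStr R) (e x) } := by
    rw [encode_query]
    funext k
    cases k <;> simp [Store.stk]
  rw [hinp, hres]
  exact hp (e x)

omit [Fintype R] in
/-- A problem that asks for a model of the ground instances of a finite theory is reducible in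
polynomial time to the satisfiability of a CNF. -/
theorem exists_reduction [Finite R] {α : Type} (e : α → List Sym) (hm : 3 ≤ m) :
    ∃ r : α → Query, Nonempty (Turing.TM2ComputableInPolyTime e Query.encode r) ∧
      ∀ x, ((r x).model.IsCNF ∧ (r x).k = 0) ∧ (DPR (r x) ↔ ∃ A, Θ.Models A (e x)) := by
  cases nonempty_fintype R
  obtain ⟨S, hS⟩ := (Θ.finite_clauses.image List.length).bddAbove
  have hlin := Θ.isLinear_linearize (S := S + 1) (a := Fin.castLE hm) fun c hc =>
    (hS ⟨c, hc, rfl⟩).trans (Nat.le_succ S)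
  refine ⟨fun x => query hlin hm (e x), nonempty_tm2ComputableInPolyTime_query e hlin hm,
    fun x => ⟨⟨query_isCNF _ _ _, rfl⟩, ?_⟩⟩
  rw [dpr_query, Θ.exists_models_linearize (Fin.castLE_injective hm)]

end Theory

/-- What the scan of an encoded query is reading: a numerator or a denominator of the threshold or
of the selected entry of a table, a number of values (its first digit, or the rest), a variable in
the scope of a factor (likewise), a table before the selected entry or after it. A negative
threshold leads to `dead`. -/
inductive Mode
  | kNum | kDen | card | cardRest | scope | scopeRest | tab | tabSkip | num | den | done | dead
  deriving DecidableEq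

instance : Fintype Mode :=
  Fintype.ofList [.kNum, .kDen, .card, .cardRest, .scope, .scopeRest, .tab, .tabSkip, .num, .den,
    .done, .dead] fun m => by cases m <;> simp

/-- The registers of the scan that hold large numbers: two products `x` and `y`, whose order tells
in the end whether the joint factor exceeds the threshold, the current multiple `s` of one of them,
and the accumulator `a` of the next one. -/
inductive Reg
  | x | y | s | a
  deriving DecidableEq

instance : Fintype Reg := Fintype.ofList [.x, .y, .s, .a] fun r => by cases r <;> simp

/-- Operations on the registers: do nothing, add the next digit of a multiplier, or move the
accumulator on after a number. -/
inductive RegOp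
  | keep | bit (b : Bool) | swap | finish

/-- Operations on the stride, the number of rows between successive values of a variable. -/
inductive StrideOp
  | keep | one | inc | mul

/-- Operations on the target, the number of entries before the selected one. -/
inductive TargetOp
  | keep | dec | add

/-- What a step of the scan does. -/
structure Instr where
  mode : Mode
  reg : RegOp := .keep
  stride : StrideOp := .keep
  target : TargetOp := .keep

/-- The control table of the scan; the last argument tells whether the target is `0`. -/
def instr : Mode → Sym → Bool → Instr
  | .kNum, .bit b, _ => { mode := .kNum, reg := .bit b }
  | .kNum, .slash, _ => { mode := .kDen, reg := .swap }
  | .kDen, .bit b, _ => { mode := .kDen, reg := .bit b }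
  | .kDen, .semi, _ => { mode := .card, reg := .finish }
  | .card, .bit _, _ => { mode := .cardRest }
  | .card, .semi, _ => { mode := .scope, stride := .one }
  | .cardRest, .bit _, _ => { mode := .cardRest }
  | .cardRest, .comma, _ => { mode := .card, stride := .inc }
  | .scope, .bit _, _ => { mode := .scopeRest, stride := .mul, target := .add }
  | .scope, .comma, _ => { mode := .scope, stride := .mul, target := .add }
  | .scope, .semi, _ => { mode := .tab }
  | .scopeRest, .bit _, _ => { mode := .scopeRest }
  | .scopeRest, .comma, _ => { mode := .scope }
  | .tab, .bit b, true => { mode := .num, reg := .bit b }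
  | .tab, .slash, true => { mode := .den, reg := .swap }
  | .tab, .bit _, false => { mode := .tabSkip, target := .dec }
  | .tab, .slash, false => { mode := .tabSkip, target := .dec }
  | .tabSkip, .comma, _ => { mode := .tab }
  | .tabSkip, .bit _, _ => { mode := .tabSkip }
  | .tabSkip, .slash, _ => { mode := .tabSkip }
  | .num, .bit b, _ => { mode := .num, reg := .bit b }
  | .num, .slash, _ => { mode := .den, reg := .swap }
  | .den, .bit b, _ => { mode := .den, reg := .bit b }
  | .den, .comma, _ => { mode := .done, reg := .swap }
  | .done, .semi, _ => { mode := .scope, stride := .one }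
  | .done, .bit _, _ => { mode := .done }
  | .done, .slash, _ => { mode := .done }
  | .done, .comma, _ => { mode := .done }
  | _, _, _ => { mode := .dead }

/-- The state of the scan. In the list of the numbers of values, the stride counts the variables
that are complete, and `seen` those that have been started. -/
structure State where
  mode : Mode
  x : ℕ
  y : ℕ
  s : ℕ
  a : ℕ
  stride : ℕ
  target : ℕ
  seen : ℕ

/-- The contents of a register. -/
def State.reg (st : State) : Reg → ℕ
  | .x => st.x
  | .y => st.y
  | .s => st.s
  | .a => st.a

/-- Where the new contents of a register come from: `dbl` is `2 * s` and `sum` is `a + s`. -/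
inductive Src
  | copy (r : Reg) | zero | dbl | sum

/-- The effect of an operation on a register. A product with a multiplier read in binary is
accumulated in `a` while `s` is doubled; then `swap` exchanges the roles of `x` and `y`. -/
def RegOp.src : RegOp → Reg → Src
  | .keep, r => .copy r
  | .bit _, .s => .dbl
  | .bit true, .a => .sum
  | .bit _, r => .copy r
  | .swap, .x => .copy .y
  | .swap, .y => .copy .a
  | .swap, .s => .copy .y
  | .swap, .a => .zero
  | .finish, .x => .copy .a
  | .finish, .y => .copy .y
  | .finish, .s => .copy .a
  | .finish, .a => .zero

/-- The value of a source in a state. -/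
def Src.eval (st : State) : Src → ℕ
  | .copy r => st.reg r
  | .zero => 0
  | .dbl => 2 * st.s
  | .sum => st.a + st.s

/-- The number written at the beginning of a string. -/
def numAt : List Sym → ℕ
  | .bit b :: l => b.toNat + 2 * numAt l
  | _ => 0

/-- The numbers of values of the variables, and an instantiation, both without bounds. -/
structure Env where
  card : ℕ → ℕ
  val : ℕ → ℕ

/-- The new stride when the scan is at the string `l`. -/
def StrideOp.eval (E : Env) (st : State) (l : List Sym) : StrideOp → ℕ
  | .keep => st.stride
  | .one => 1
  | .inc => st.stride + 1
  | .mul => st.stride * E.card (numAt l)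

/-- The new target when the scan is at the string `l`. -/
def TargetOp.eval (E : Env) (st : State) (l : List Sym) : TargetOp → ℕ
  | .keep => st.target
  | .dec => st.target - 1
  | .add => st.target + st.stride * E.val (numAt l)

/-- The instruction executed in a state at a symbol. -/
def State.instr (st : State) (c : Sym) : Instr :=
  FactorModel.instr st.mode c (decide (st.target = 0))

/-- A step of the scan at the string `c :: l`. -/
def Env.step (E : Env) (st : State) (c : Sym) (l : List Sym) : State where
  mode := (st.instr c).mode
  x := ((st.instr c).reg.src .x).eval st
  y := ((st.instr c).reg.src .y).eval st
  s := ((st.instr c).reg.src .s).eval st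
  a := ((st.instr c).reg.src .a).eval st
  stride := (st.instr c).stride.eval E st (c :: l)
  target := (st.instr c).target.eval E st (c :: l)
  seen := if st.mode = .card ∧ ∃ b, c = .bit b then st.seen + 1 else st.seen

/-- A step of the scan at `c :: l` respects the bound `B` on the small numbers, and the part of the
string that it reads agrees with `E`, where `n` is the number of variables. -/
structure Env.Good (E : Env) (n B : ℕ) (st : State) (c : Sym) (l : List Sym) : Prop where
  stride_le : (E.step st c l).stride ≤ B
  target_le : (E.step st c l).target ≤ B
  card : st.mode = .card → (∃ b, c = .bit b) →
    st.stride = st.seen ∧ st.seen < n ∧ E.card st.seen = numAt (c :: l)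
  scope : st.mode = .scope → c ≠ .semi → numAt (c :: l) < st.seen ∧ numAt (c :: l) ≤ B ∧
    0 < E.card (numAt (c :: l)) ∧ E.card (numAt (c :: l)) ≤ B ∧
      E.val (numAt (c :: l)) < E.card (numAt (c :: l))

/-- `E.Path n B st l st' l'`: by good steps, the scan goes from the state `st` at the string `l` to
the state `st'` at the rest `l'` of the string. -/
inductive Env.Path (E : Env) (n B : ℕ) : State → List Sym → State → List Sym → Prop
  | refl (st l) : Path E n B st l st l
  | step {st c l st' l'} : E.Good n B st c l → Path E n B (E.step st c l) l st' l' →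
      Path E n B st (c :: l) st' l'

theorem numAt_encNat (k : ℕ) {c : Sym} (hc : ∀ b, c ≠ .bit b) (l : List Sym) :
    numAt (encNat k ++ c :: l) = k := by
  have numAt_bits (bs : List Bool) : numAt (bs.map Sym.bit ++ c :: l) = ofBits bs := by
    induction bs with
    | nil =>
      cases c with
      | bit b => exact absurd rfl (hc b)
      | _ => rfl
    | cons b bs ih => rw [ofBits_cons, ← ih]; rfl
  rw [encNat, numAt_bits, ofBits_bits]

theorem mem_encNNRat {q : ℚ≥0} {c : Sym} (hc : c ∈ encNNRat q) :
    (∃ b, c = .bit b) ∨ c = .slash := by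
  simp only [encNNRat, encNat, List.mem_append, List.mem_map, List.mem_cons] at hc
  rcases hc with ⟨b, -, rfl⟩ | rfl | ⟨b, -, rfl⟩ <;> simp

theorem encList_cons_append {α : Type} (e : α → List Sym) (b : α) (L : List α) (l : List Sym) :
    encList e (b :: L) ++ l = e b ++ Sym.comma :: (encList e L ++ l) := by
  simp [encList]

namespace Env

variable {E : Env} {n B : ℕ}

theorem Path.trans {st st' st'' : State} {l l' l'' : List Sym} (h : E.Path n B st l st' l')
    (h' : E.Path n B st' l' st'' l'') : E.Path n B st l st'' l'' := by
  induction h with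
  | refl => exact h'
  | step hg _ ih => exact .step hg (ih h')

theorem Path.single {st st' : State} {c : Sym} {l : List Sym} (h : E.Good n B st c l)
    (e : E.step st c l = st') : E.Path n B st (c :: l) st' l :=
  .step h (e ▸ .refl _ _)

theorem Path.single_of_not_reading {st st' : State} {c : Sym} {l : List Sym}
    (e : E.step st c l = st') (hu : st'.stride ≤ B) (ht : st'.target ≤ B)
    (hcard : st.mode = .card → c = .semi) (hscope : st.mode = .scope → c = .semi) :
    E.Path n B st (c :: l) st' l := by
  refine .single ⟨by rwa [e], by rwa [e], fun h ⟨b, hb⟩ => ?_, fun h h' => absurd (hscope h) h'⟩ e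
  cases hb.symm.trans (hcard h)

theorem Path.digits {M : Mode} (hM : M = .kNum ∨ M = .kDen ∨ M = .num ∨ M = .den)
    {x y s a u t k : ℕ} (hu : u ≤ B) (ht : t ≤ B) (bs : List Bool) (l : List Sym) :
    ∃ s', E.Path n B ⟨M, x, y, s, a, u, t, k⟩ (bs.map Sym.bit ++ l)
      ⟨M, x, y, s', a + s * ofBits bs, u, t, k⟩ l := by
  induction bs generalizing s a with
  | nil => exact ⟨s, .refl _ _⟩
  | cons b bs ih =>
    obtain ⟨s', h⟩ := ih (s := 2 * s) (a := a + s * b.toNat)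
    refine ⟨s', ?_⟩
    rw [ofBits_cons, show a + s * (b.toNat + 2 * ofBits bs)
      = a + s * b.toNat + 2 * s * ofBits bs by ring]
    have hstep : E.step ⟨M, x, y, s, a, u, t, k⟩ (.bit b) (bs.map Sym.bit ++ l)
        = ⟨M, x, y, 2 * s, a + s * b.toNat, u, t, k⟩ := by
      rcases hM with rfl | rfl | rfl | rfl <;> cases b <;>
        simp [Env.step, State.instr, instr, RegOp.src, Src.eval, State.reg, StrideOp.eval,
          TargetOp.eval]
    refine .trans (.single_of_not_reading hstep hu ht ?_ ?_) h <;>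
      rcases hM with rfl | rfl | rfl | rfl <;> simp

theorem Path.skip {st : State} (hu : st.stride ≤ B) (ht : st.target ≤ B) (hcard : st.mode ≠ .card)
    (hscope : st.mode ≠ .scope) (l l' : List Sym)
    (hl : ∀ c ∈ l, instr st.mode c (decide (st.target = 0)) = { mode := st.mode }) :
    E.Path n B st (l ++ l') st l' := by
  induction l with
  | nil => exact .refl _ _
  | cons c l ih =>
    have hstep : E.step st c (l ++ l') = st := by
      have hinstr : st.instr c = { mode := st.mode } := hl c List.mem_cons_self
      rw [Env.step, hinstr, if_neg fun h => hcard h.1]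
      rfl
    exact .trans (.single_of_not_reading hstep hu ht (fun h => absurd h hcard)
      (fun h => absurd h hscope)) (ih fun c hc => hl c (List.mem_cons_of_mem _ hc))

theorem Path.skip_bits {M : Mode} (hM : M = .cardRest ∨ M = .scopeRest)
    {x y s a u t k : ℕ} (hu : u ≤ B) (ht : t ≤ B) (bs : List Bool) (l : List Sym) :
    E.Path n B ⟨M, x, y, s, a, u, t, k⟩ (bs.map Sym.bit ++ l) ⟨M, x, y, s, a, u, t, k⟩ l := by
  refine .skip hu ht ?_ ?_ _ _ fun c hc => ?_
  · rcases hM with rfl | rfl <;> exact nofun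
  · rcases hM with rfl | rfl <;> exact nofun
  · obtain ⟨b, -, rfl⟩ := List.mem_map.1 hc
    rcases hM with rfl | rfl <;> rfl

theorem Path.cardEntry {x y s a k v : ℕ} (hk : k < n) (hn : n ≤ B) (hE : E.card k = v)
    (hv : 0 < v) (l : List Sym) :
    E.Path n B ⟨.card, x, y, s, a, k, 0, k⟩ (encNat v ++ Sym.comma :: l)
      ⟨.card, x, y, s, a, k + 1, 0, k + 1⟩ l := by
  have hnum := numAt_encNat v (c := .comma) nofun l
  have hne : v.bits ≠ [] := fun h => hv.ne (by rw [← ofBits_bits v, h]; rfl)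
  obtain ⟨b, bs, hb⟩ := List.exists_cons_of_ne_nil hne
  rw [encNat, hb, List.map_cons, List.cons_append] at hnum ⊢
  have hfirst : E.Good n B ⟨.card, x, y, s, a, k, 0, k⟩ (.bit b)
      (bs.map Sym.bit ++ Sym.comma :: l) :=
    ⟨hk.le.trans hn, Nat.zero_le _, fun _ _ => ⟨rfl, hk, hE.trans hnum.symm⟩, nofun⟩
  refine .trans (.single (st' := ⟨.cardRest, x, y, s, a, k, 0, k + 1⟩) hfirst ?_)
    (.trans (.skip_bits (.inl rfl) (hk.le.trans hn) (Nat.zero_le _) bs _)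
      (.single_of_not_reading rfl (Nat.succ_le_of_lt (hk.trans_le hn)) (Nat.zero_le _) nofun nofun))
  rw [Env.step, if_pos ⟨rfl, b, rfl⟩]
  rfl

theorem Path.cards {x y s a k : ℕ} (hB : 1 ≤ B) (L : List ℕ) (l : List Sym) (hL : k + L.length ≤ n)
    (hn : n ≤ B) (hE : ∀ j (hj : j < L.length), E.card (k + j) = L[j] ∧ 0 < L[j]) :
    E.Path n B ⟨.card, x, y, s, a, k, 0, k⟩ (encList encNat L ++ l)
      ⟨.scope, x, y, s, a, 1, 0, k + L.length⟩ l := by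
  induction L generalizing k with
  | nil =>
    refine .single_of_not_reading ?_ hB (Nat.zero_le _) (fun _ => rfl) nofun
    rw [Env.step, if_neg (by simp)]
    rfl
  | cons v L ih =>
    obtain ⟨hv, hpos⟩ := hE 0 (Nat.succ_pos _)
    rw [List.length_cons] at hL
    rw [encList_cons_append, List.length_cons, ← Nat.succ_add_eq_add_succ]
    refine .trans (.cardEntry (by omega) hn hv hpos _) (ih (by omega) fun j hj => ?_)
    rw [add_assoc, add_comm 1]
    exact hE (j + 1) (Nat.succ_lt_succ hj)

/-- The stride and the target after the variables in `L`, starting from the pair `p`. -/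
def rowOf (E : Env) (p : ℕ × ℕ) (L : List ℕ) : ℕ × ℕ :=
  L.foldl (fun p v => (p.1 * E.card v, p.2 + p.1 * E.val v)) p

theorem Path.scopeVar {x y s a u t k v : ℕ} (hvk : v < k) (hvB : v ≤ B) (hpos : 0 < E.card v)
    (hcard : E.card v ≤ B) (hval : E.val v < E.card v) (hu : u * E.card v ≤ B)
    (ht : t + u * E.val v ≤ B) (l : List Sym) :
    E.Path n B ⟨.scope, x, y, s, a, u, t, k⟩ (encNat v ++ Sym.comma :: l)
      ⟨.scope, x, y, s, a, u * E.card v, t + u * E.val v, k⟩ l := by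
  have hnum := numAt_encNat v (c := .comma) nofun l
  rw [encNat] at hnum ⊢
  have hgood (c : Sym) (l' : List Sym) (hc : c = .comma ∨ ∃ b, c = .bit b)
      (hv : numAt (c :: l') = v) : E.Good n B ⟨.scope, x, y, s, a, u, t, k⟩ c l' := by
    subst hv
    refine ⟨?_, ?_, nofun, fun _ _ => ⟨hvk, hvB, hpos, hcard, hval⟩⟩ <;>
      rcases hc with rfl | ⟨b, rfl⟩ <;> assumption
  rcases hb : v.bits with _ | ⟨b, bs⟩ <;> rw [hb] at hnum
  · refine .single (hgood _ _ (.inl rfl) hnum) ?_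
    subst hnum
    rfl
  · refine .trans (.single (st' := ⟨.scopeRest, x, y, s, a, u * E.card v, t + u * E.val v, k⟩)
      (hgood _ _ (.inr ⟨b, rfl⟩) hnum) ?_) (.trans (.skip_bits (.inr rfl) hu ht bs _)
        (.single_of_not_reading rfl hu ht nofun nofun))
    subst hnum
    rfl

theorem le_fst_rowOf {L : List ℕ} (hE : ∀ v ∈ L, 0 < E.card v) (p : ℕ × ℕ) :
    p.1 ≤ (E.rowOf p L).1 := by
  induction L generalizing p with
  | nil => exact le_rfl
  | cons v L ih =>
    rw [List.forall_mem_cons] at hE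
    exact (Nat.le_mul_of_pos_right _ hE.1).trans (ih hE.2 (p.1 * E.card v, p.2 + p.1 * E.val v))

theorem Path.scope {x y s a u t k : ℕ} (L : List ℕ) (l : List Sym)
    (hE : ∀ v ∈ L, v < k ∧ v ≤ B ∧ 0 < E.card v ∧ E.card v ≤ B ∧ E.val v < E.card v)
    (ht : t < u) (hu : (E.rowOf (u, t) L).1 ≤ B) :
    E.Path n B ⟨.scope, x, y, s, a, u, t, k⟩ (encList encNat L ++ l)
      ⟨.tab, x, y, s, a, (E.rowOf (u, t) L).1, (E.rowOf (u, t) L).2, k⟩ l := by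
  induction L generalizing u t with
  | nil => exact .single_of_not_reading rfl hu (ht.le.trans hu) nofun fun _ => rfl
  | cons v L ih =>
    rw [List.forall_mem_cons] at hE
    obtain ⟨⟨hvk, hvB, hpos, hcard, hval⟩, hL⟩ := hE
    have ht' : t + u * E.val v < u * E.card v :=
      calc t + u * E.val v < u + u * E.val v := Nat.add_lt_add_right ht _
        _ = u * (E.val v + 1) := by ring
        _ ≤ u * E.card v := Nat.mul_le_mul_left _ hval
    have hu' : u * E.card v ≤ B := (le_fst_rowOf (fun v hv => (hL v hv).2.2.1) _).trans hu
    rw [encList_cons_append]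
    exact .trans (.scopeVar hvk hvB hpos hcard hval hu' (ht'.le.trans hu') _) (ih hL ht' hu)

theorem Path.numerator {x y u k : ℕ} (hu : u ≤ B) (p : ℕ) (l : List Sym) :
    E.Path n B ⟨.tab, x, y, x, 0, u, 0, k⟩ (encNat p ++ Sym.slash :: l)
      ⟨.den, y, x * p, y, 0, u, 0, k⟩ l := by
  have hp := ofBits_bits p
  rw [encNat]
  rcases hb : p.bits with _ | ⟨b, bs⟩ <;> rw [hb] at hp <;> subst hp
  · exact .single_of_not_reading rfl hu (Nat.zero_le _) nofun nofun
  · obtain ⟨s', h⟩ := Path.digits (E := E) (n := n) (M := .num) (by simp) (x := x) (y := y)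
      (s := 2 * x) (a := 0 + x * b.toNat) (k := k) hu (Nat.zero_le _) bs (Sym.slash :: l)
    refine .trans (.single_of_not_reading (st' := ⟨.num, x, y, 2 * x, 0 + x * b.toNat, u, 0, k⟩)
      ?_ hu (Nat.zero_le _) nofun nofun)
      (h.trans (.single_of_not_reading ?_ hu (Nat.zero_le _) nofun nofun))
    · cases b <;> simp [Env.step, State.instr, instr, RegOp.src, Src.eval, State.reg,
        StrideOp.eval, TargetOp.eval]
    · rw [ofBits_cons, show x * (b.toNat + 2 * ofBits bs)
        = 0 + x * b.toNat + 2 * x * ofBits bs by ring]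
      rfl

theorem Path.entry {x y u k : ℕ} (hu : u ≤ B) (q : ℚ≥0) (l : List Sym) :
    E.Path n B ⟨.tab, x, y, x, 0, u, 0, k⟩ (encNNRat q ++ Sym.comma :: l)
      ⟨.done, x * q.num, y * q.den, x * q.num, 0, u, 0, k⟩ l := by
  rw [encNNRat, List.append_assoc, List.cons_append]
  refine (Path.numerator hu _ _).trans ?_
  obtain ⟨s', h⟩ := Path.digits (E := E) (n := n) (M := .den) (by simp) (x := y) (y := x * q.num)
    (s := y) (a := 0) (k := k) hu (Nat.zero_le _) q.den.bits (Sym.comma :: l)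
  rw [ofBits_bits, zero_add] at h
  exact h.trans (.single_of_not_reading rfl hu (Nat.zero_le _) nofun nofun)

theorem Path.skipEntry {x y s a u t k : ℕ} (hu : u ≤ B) (ht : t ≤ B) (q : ℚ≥0) (l : List Sym) :
    E.Path n B ⟨.tab, x, y, s, a, u, t + 1, k⟩ (encNNRat q ++ Sym.comma :: l)
      ⟨.tab, x, y, s, a, u, t, k⟩ l := by
  have hne : encNNRat q ≠ [] := by simp [encNNRat]
  obtain ⟨c, cs, hq⟩ := List.exists_cons_of_ne_nil hne
  have hmem : ∀ c' ∈ c :: cs, (∃ b, c' = .bit b) ∨ c' = .slash := fun _ h => mem_encNNRat (hq ▸ h)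
  rw [List.forall_mem_cons] at hmem
  obtain ⟨hc, hcs⟩ := hmem
  rw [hq, List.cons_append]
  refine .trans (.single_of_not_reading (st' := ⟨.tabSkip, x, y, s, a, u, t, k⟩) ?_ hu ht
    nofun nofun) (.trans (.skip hu ht (by simp) (by simp) _ _ fun c' hc' => ?_)
      (.single_of_not_reading rfl hu ht nofun nofun))
  · rcases hc with ⟨b, rfl⟩ | rfl <;> rfl
  · rcases hcs c' hc' with ⟨b, rfl⟩ | rfl <;> rfl

theorem Path.skipTable {x y s a u t k : ℕ} (hB : 1 ≤ B) (hu : u ≤ B) (ht : t ≤ B) (L : List ℚ≥0)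
    (l : List Sym) :
    E.Path n B ⟨.done, x, y, s, a, u, t, k⟩ (encList encNNRat L ++ l)
      ⟨.scope, x, y, s, a, 1, t, k⟩ l := by
  rw [encList, List.append_assoc]
  refine .trans (.skip hu ht (by simp) (by simp) _ _ fun c hc => ?_)
    (.single_of_not_reading rfl hB ht nofun nofun)
  simp only [List.mem_flatMap, List.mem_append, List.mem_singleton] at hc
  obtain ⟨q, -, hc | rfl⟩ := hc
  · rcases mem_encNNRat hc with ⟨b, rfl⟩ | rfl <;> rfl
  · rfl

theorem Path.table {x y u t k : ℕ} (hB : 1 ≤ B) (hu : u ≤ B) (L : List ℚ≥0) (l : List Sym)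
    (ht : t < L.length) (htB : t ≤ B) :
    E.Path n B ⟨.tab, x, y, x, 0, u, t, k⟩ (encList encNNRat L ++ l)
      ⟨.scope, x * L[t].num, y * L[t].den, x * L[t].num, 0, 1, 0, k⟩ l := by
  induction L generalizing t with
  | nil => cases ht
  | cons q L ih =>
    rw [encList_cons_append]
    cases t with
    | zero => exact (Path.entry hu q _).trans (.skipTable hB hu (Nat.zero_le _) L l)
    | succ t =>
      have htB : t ≤ B := (Nat.le_succ t).trans htB
      exact (Path.skipEntry hu htB q _).trans (ih (Nat.lt_of_succ_lt_succ ht) htB)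

end Env

theorem Env.rowOf_ofFn (E : Env) {a : ℕ} (g : Fin a → ℕ) :
    E.rowOf (1, 0) (List.ofFn g) = (∏ j, E.card (g j),
      ∑ i : Fin a, E.val (g i) * ∏ j : Fin i, E.card (g (Fin.castLE i.is_lt.le j))) := by
  induction a with
  | zero => rfl
  | succ a ih =>
    have ih := ih fun i => g i.castSucc
    rw [rowOf] at ih ⊢
    rw [List.ofFn_succ_last, List.foldl_append, ih, Fin.prod_univ_castSucc, Fin.sum_univ_castSucc,
      List.foldl_cons, List.foldl_nil, mul_comm (E.val _)]
    rfl

/-- The environment of an instantiation. -/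
def Model.env (M : Model) (x : Instantiation M.card) : Env where
  card v := if h : v < M.numVars then M.card ⟨v, h⟩ else 0
  val v := if h : v < M.numVars then x ⟨v, h⟩ else 0

theorem Model.env_card (M : Model) (x : Instantiation M.card) (v : Fin M.numVars) :
    (M.env x).card v = M.card v :=
  dif_pos v.2

theorem Model.env_val (M : Model) (x : Instantiation M.card) (v : Fin M.numVars) :
    (M.env x).val v = x v :=
  dif_pos v.2

section Factors

variable {M : Model} (x : Instantiation M.card)

theorem Factor.length_table (f : Factor M.card) : f.table.length = ∏ j, M.card (f.scope j) :=
  List.length_ofFn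

theorem Factor.rowOf_scope (f : Factor M.card) :
    (M.env x).rowOf (1, 0) (List.ofFn fun j => (f.scope j : ℕ))
      = (f.table.length, (finPiFinEquiv fun j => x (f.scope j)).val) := by
  rw [f.length_table, Env.rowOf_ofFn, finPiFinEquiv_apply]
  simp only [M.env_card, M.env_val]

theorem Factor.getElem_table (f : Factor M.card)
    (h : (finPiFinEquiv fun j => x (f.scope j)).val < f.table.length) :
    f.table[(finPiFinEquiv fun j => x (f.scope j)).val] = f.eval x := by
  simp [Factor.table, Factor.eval]

theorem encList_ofFn_val {a n : ℕ} (g : Fin a → Fin n) :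
    encList (fun v : Fin n => encNat v) (List.ofFn g)
      = encList encNat (List.ofFn fun j => (g j : ℕ)) := by
  have hmap : (List.ofFn fun j => (g j : ℕ)) = (List.ofFn g).map Fin.val := List.map_ofFn.symm
  rw [encList, encList, hmap, List.flatMap_map]

variable {B : ℕ}

theorem Env.Path.factor (f : Factor M.card) (hn : M.numVars ≤ B) (hf : f.table.length ≤ B)
    (X Y : ℕ) (l : List Sym) :
    (M.env x).Path M.numVars B ⟨.scope, X, Y, X, 0, 1, 0, M.numVars⟩ (f.encode ++ l)
      ⟨.scope, X * (f.eval x).num, Y * (f.eval x).den, X * (f.eval x).num, 0, 1, 0,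
        M.numVars⟩ l := by
  have hpos : 0 < ∏ j, M.card (f.scope j) := Finset.prod_pos fun j _ => M.card_pos _
  have hrow := f.rowOf_scope x
  have hlt : (finPiFinEquiv fun j => x (f.scope j)).val < f.table.length :=
    (Fin.is_lt _).trans_eq f.length_table.symm
  rw [Factor.encode, encList_ofFn_val, List.append_assoc, ← f.getElem_table x hlt]
  refine .trans (.scope _ _ (fun v hv => ?_) one_pos ?_) ?_
  · obtain ⟨j, rfl⟩ := List.mem_ofFn.1 hv
    rw [M.env_card, M.env_val]
    refine ⟨(f.scope j).2, (f.scope j).2.le.trans hn, M.card_pos _, ?_, (x _).2⟩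
    refine (Nat.le_of_dvd hpos (Finset.dvd_prod_of_mem _ (Finset.mem_univ j))).trans ?_
    rwa [← f.length_table]
  · rwa [hrow]
  · rw [hrow]
    exact .table ((f.length_table ▸ hpos : 0 < f.table.length).trans_le hf) hf _ l hlt
      (hlt.le.trans hf)

theorem Env.Path.factors (fs : List (Factor M.card)) (hn : M.numVars ≤ B)
    (hf : ∀ f ∈ fs, f.table.length ≤ B) (X Y : ℕ) :
    (M.env x).Path M.numVars B ⟨.scope, X, Y, X, 0, 1, 0, M.numVars⟩ (fs.flatMap Factor.encode)
      ⟨.scope, X * (fs.map fun f => (f.eval x).num).prod, Y * (fs.map fun f => (f.eval x).den).prod,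
        X * (fs.map fun f => (f.eval x).num).prod, 0, 1, 0, M.numVars⟩ [] := by
  induction fs generalizing X Y with
  | nil => simpa only [List.flatMap_nil, List.map_nil, List.prod_nil, mul_one] using .refl _ _
  | cons f fs ih =>
    rw [List.forall_mem_cons] at hf
    simp only [List.flatMap_cons, List.map_cons, List.prod_cons, ← mul_assoc]
    exact (Env.Path.factor x f hn hf.1 X Y _).trans (ih hf.2 _ _)

end Factors

/-- The initial state of the scan. -/
def State.start : State := ⟨.kNum, 1, 1, 1, 0, 0, 0, 0⟩

theorem Env.Path.threshold {E : Env} {n B : ℕ} {k : ℚ} (hk : 0 ≤ k) (l : List Sym) :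
    E.Path n B .start (encRat k ++ Sym.semi :: l)
      ⟨.card, k.den, k.num.natAbs, k.den, 0, 0, 0, 0⟩ l := by
  rw [encRat, if_neg hk.not_gt, List.nil_append, List.append_assoc, List.cons_append]
  obtain ⟨s₁, h₁⟩ := Path.digits (E := E) (n := n) (M := .kNum) (by simp) (x := 1) (y := 1) (s := 1)
    (a := 0) (k := 0) (Nat.zero_le B) (Nat.zero_le B) k.num.natAbs.bits
    (Sym.slash :: (encNat k.den ++ Sym.semi :: l))
  obtain ⟨s₂, h₂⟩ := Path.digits (E := E) (n := n) (M := .kDen) (by simp) (x := 1)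
    (y := k.num.natAbs) (s := 1) (a := 0) (k := 0) (Nat.zero_le B) (Nat.zero_le B) k.den.bits
    (Sym.semi :: l)
  rw [ofBits_bits, one_mul, zero_add] at h₁ h₂
  exact h₁.trans (.trans (.single_of_not_reading rfl (Nat.zero_le _) (Nat.zero_le _) nofun nofun)
    (h₂.trans (.single_of_not_reading rfl (Nat.zero_le _) (Nat.zero_le _) nofun nofun)))

theorem Env.Path.dead {E : Env} {n B : ℕ} {k : ℚ} (hk : k < 0) (l : List Sym) :
    ∃ st : State, st.mode = .dead ∧ E.Path n B .start (encRat k ++ l) st [] := by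
  rw [encRat, if_pos hk, List.append_assoc, List.append_assoc, List.singleton_append]
  refine ⟨⟨.dead, 1, 1, 1, 0, 0, 0, 0⟩, rfl,
    .trans (.single_of_not_reading rfl (Nat.zero_le _) (Nat.zero_le _) nofun nofun) ?_⟩
  rw [← List.append_nil (encNat _ ++ _)]
  exact .skip (st := ⟨.dead, 1, 1, 1, 0, 0, 0, 0⟩) (Nat.zero_le _) (Nat.zero_le _) nofun nofun _ _
    fun c _ => by cases c <;> rfl

theorem length_le_length_encList {α : Type} (e : α → List Sym) (L : List α) :
    L.length ≤ (encList e L).length := by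
  induction L with
  | nil => exact Nat.zero_le _
  | cons a L ih =>
    have hlen := congrArg List.length (encList_cons_append e a L [])
    simp only [List.append_nil, List.length_append, List.length_cons] at hlen ⊢
    omega

theorem Query.numVars_le (Q : Query) : Q.model.numVars ≤ Q.encode.length := by
  have hlen := length_le_length_encList encNat (List.ofFn Q.model.card)
  simp only [List.length_ofFn] at hlen
  simp only [Query.encode, List.length_append, List.length_cons]
  omega

theorem Query.length_table_le (Q : Query) {f : Factor Q.model.card} (hf : f ∈ Q.model.factors) :
    f.table.length ≤ Q.encode.length := by
  have htable := length_le_length_encList encNNRat f.table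
  have hfactors : f.encode.length ≤ (Q.model.factors.flatMap Factor.encode).length :=
    (List.sublist_flatten_of_mem (List.mem_map_of_mem hf)).length_le
  simp only [Factor.encode, List.length_append] at hfactors
  simp only [Query.encode, List.length_append, List.length_cons]
  omega

theorem prod_map_div {α : Type} (num den : α → ℕ) (fs : List α) :
    (fs.map fun f => (num f / den f : ℚ≥0)).prod = (fs.map num).prod / (fs.map den).prod := by
  induction fs with
  | nil => simp
  | cons f fs ih => simp only [List.map_cons, List.prod_cons, ih, Nat.cast_mul, div_mul_div_comm]

theorem Model.joint_eq_div (M : Model) (x : Instantiation M.card) :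
    M.joint x = (M.factors.map fun f => (f.eval x).num).prod /
      (M.factors.map fun f => (f.eval x).den).prod := by
  rw [← prod_map_div, Model.joint]
  simp only [NNRat.num_div_den]

theorem Model.lt_joint_iff (M : Model) (x : Instantiation M.card) {k : ℚ} (hk : 0 ≤ k) :
    k < M.joint x ↔ k.num.natAbs * (M.factors.map fun f => (f.eval x).den).prod <
      k.den * (M.factors.map fun f => (f.eval x).num).prod := by
  have hden : 0 < (M.factors.map fun f => (f.eval x).den).prod := by
    refine List.prod_pos fun d hd => ?_
    obtain ⟨f, -, rfl⟩ := List.mem_map.1 hd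
    exact NNRat.den_pos _
  have hk' : k = k.num.natAbs / k.den := by
    rw [Nat.cast_natAbs, abs_of_nonneg (Rat.num_nonneg.2 hk), Rat.num_div_den]
  rw [M.joint_eq_div, mul_comm k.den]
  nth_rw 1 [hk']
  rw [NNRat.cast_div, NNRat.cast_natCast, NNRat.cast_natCast]
  rw [div_lt_div_iff₀ (by exact_mod_cast k.den_pos) (by exact_mod_cast hden)]
  exact_mod_cast Iff.rfl

theorem Query.exists_path (Q : Query) (hk : 0 ≤ Q.k) (x : Instantiation Q.model.card) {B : ℕ}
    (hB : Q.encode.length < B) :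
    ∃ st : State, st.mode = .scope ∧ (st.y < st.x ↔ (Q.model.joint x : ℚ) > Q.k) ∧
      (Q.model.env x).Path Q.model.numVars B .start Q.encode st [] := by
  have hn := Q.numVars_le.trans hB.le
  have hlen : (List.ofFn Q.model.card).length = Q.model.numVars := List.length_ofFn
  have hcards := Env.Path.cards (E := Q.model.env x) (n := Q.model.numVars) (x := Q.k.den)
    (y := Q.k.num.natAbs) (s := Q.k.den) (a := 0) (k := 0) (Nat.one_le_of_lt hB)
    (List.ofFn Q.model.card) (Q.model.factors.flatMap Factor.encode) (by rw [hlen, zero_add]) hn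
    fun j hj => by
      rw [List.getElem_ofFn, zero_add]
      exact ⟨Q.model.env_card x ⟨j, hlen ▸ hj⟩, Q.model.card_pos _⟩
  rw [hlen, zero_add] at hcards
  have hfactors := Env.Path.factors x Q.model.factors hn
    (fun f hf => (Q.length_table_le hf).trans hB.le) Q.k.den Q.k.num.natAbs
  exact ⟨_, rfl, (Q.model.lt_joint_iff x hk).symm,
    (Env.Path.threshold hk _).trans (hcards.trans hfactors)⟩

/-- The state of the scan of a string after some steps. -/
def Env.run (E : Env) : State → List Sym → ℕ → State
  | st, _, 0 => st
  | st, [], _ + 1 => st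
  | st, c :: l, i + 1 => E.run (E.step st c l) l i

namespace Env

variable {E : Env} {n B : ℕ}

theorem run_zero (st : State) (w : List Sym) : E.run st w 0 = st := by
  rw [run]

theorem run_succ {st : State} {w : List Sym} {i : ℕ} {c : Sym} {l : List Sym}
    (h : w.drop i = c :: l) : E.run st w (i + 1) = E.step (E.run st w i) c l := by
  induction i generalizing st w with
  | zero =>
    obtain rfl : w = c :: l := h
    simp only [run]
  | succ i ih =>
    cases w with
    | nil => cases h
    | cons d w => rw [run, run, ih h]

theorem Path.run_length {st st' : State} {w : List Sym} (h : E.Path n B st w st' []) :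
    E.run st w w.length = st' := by
  generalize hl : ([] : List Sym) = l at h
  induction h with
  | refl => subst hl; rfl
  | step _ _ ih => exact ih hl

theorem Path.good {st st' : State} {w : List Sym} (h : E.Path n B st w st' []) {i : ℕ} {c : Sym}
    {l : List Sym} (hi : w.drop i = c :: l) : E.Good n B (E.run st w i) c l := by
  generalize hl : ([] : List Sym) = l' at h
  induction h generalizing i with
  | refl => subst hl; simp at hi
  | step hgood _ ih =>
    cases i with
    | zero =>
      obtain ⟨rfl, rfl⟩ := List.cons.inj hi
      rwa [run_zero]
    | succ i => exact ih hi hl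

theorem step_reg_le {st : State} {b : ℕ} (hx : st.x ≤ b) (hy : st.y ≤ b) (hs : st.s ≤ b)
    (ha : st.a ≤ st.s) (c : Sym) (l : List Sym) :
    (E.step st c l).x ≤ 2 * b ∧ (E.step st c l).y ≤ 2 * b ∧ (E.step st c l).s ≤ 2 * b ∧
      (E.step st c l).a ≤ (E.step st c l).s := by
  simp only [step]
  rcases (st.instr c).reg with _ | (_ | _) | _ | _ <;>
    simp only [RegOp.src, Src.eval, State.reg] <;> omega

theorem run_reg_le (w : List Sym) (i : ℕ) {st : State} {k : ℕ} (hx : st.x ≤ 2 ^ k)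
    (hy : st.y ≤ 2 ^ k) (hs : st.s ≤ 2 ^ k) (ha : st.a ≤ st.s) :
    (E.run st w i).x ≤ 2 ^ (k + i) ∧ (E.run st w i).y ≤ 2 ^ (k + i) := by
  induction i generalizing st w k with
  | zero => rw [run_zero]; exact ⟨hx, hy⟩
  | succ i ih =>
    cases w with
    | nil =>
      have hle : 2 ^ k ≤ 2 ^ (k + (i + 1)) := Nat.pow_le_pow_right two_pos (Nat.le_add_right _ _)
      exact ⟨hx.trans hle, hy.trans hle⟩
    | cons c l =>
      obtain ⟨hx', hy', hs', ha'⟩ := step_reg_le (E := E) hx hy hs ha c l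
      rw [← pow_succ'] at hx' hy' hs'
      rw [run, ← Nat.succ_add_eq_add_succ]
      exact ih l hx' hy' hs' ha'

end Env

theorem forall_getElem?_marks {w : List Sym} {P : ℕ → Mark → Prop} :
    (∀ j k, (marks w)[j]? = some k → P j k) ↔
      P 0 .first ∧ (∀ j s, w[j]? = some s → P (j + 1) (.symb s)) ∧ P (w.length + 1) .last := by
  constructor
  · refine fun h => ⟨h 0 _ rfl, fun j s hj => h _ _ ?_, h _ _ ?_⟩
    · rw [marks, List.cons_append, List.getElem?_cons_succ, List.getElem?_append_left,
        List.getElem?_map, hj, Option.map_some]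
      rw [List.length_map]
      exact (List.getElem?_eq_some_iff.1 hj).1
    · simp [marks]
  · rintro ⟨h_first, h_symb, h_last⟩ (_ | j) k hk
    · cases hk
      exact h_first
    · rw [marks, List.cons_append, List.getElem?_cons_succ, List.getElem?_append,
        List.length_map] at hk
      split at hk
      · rw [List.getElem?_map, Option.map_eq_some_iff] at hk
        obtain ⟨s, hs, rfl⟩ := hk
        exact h_symb j s hs
      · obtain ⟨hj, rfl⟩ := by simpa only [List.getElem?_singleton, Option.ite_none_right_eq_some,
          Option.some.injEq] using hk
        rwa [show j = w.length by omega]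

namespace Theory

variable {R : Type} {m : ℕ} (Θ : Theory R m)

theorem forall_mem_instances {w : List Sym} {P : List (Lit R m) × (Fin m → ℕ) → Prop} :
    (∀ i ∈ Θ.instances w, P i) ↔
      (∀ j k, (marks w)[j]? = some k → P (Θ.mark k, Θ.posVal j)) ∧
      (∀ j ≤ w.length + 1, P (Θ.next, Θ.posVal j)) ∧
      ∀ c ∈ Θ.rules, ∀ v, (∀ k, v k < 2 ^ width w.length) → P (c, v) := by
  simp only [instances, List.mem_append, mem_posInstances, List.mem_flatMap, List.mem_map,
    mem_valuations]
  constructor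
  · refine fun h => ⟨fun j k hk => h _ (.inl ⟨j, k, hk, .inl rfl⟩), fun j hj => ?_,
      fun c hc v hv => h _ (.inr ⟨v, hv, c, hc, rfl⟩)⟩
    have hj' : j < (marks w).length := by rw [length_marks]; omega
    exact h _ (.inl ⟨j, _, List.getElem?_eq_getElem hj', .inr rfl⟩)
  · rintro ⟨h_mark, h_next, h_rules⟩ i (⟨j, k, hk, rfl | rfl⟩ | ⟨v, hv, c, hc, rfl⟩)
    · exact h_mark j k hk
    · have hj := (List.getElem?_eq_some_iff.1 hk).1
      rw [length_marks] at hj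
      exact h_next j (by omega)
    · exact h_rules c hc v hv

end Theory

/-! ### The rules of the scan -/

/-- The predicates that describe a scan. A position of the scanned string with end markers stands
for the moment at which the scan reads it. `num` is the number written at a position, `inst M s z`
marks the positions at which the instruction `instr M s z` is executed, `card` and `choice` relate
the variables of the scanned model to their numbers of values and to the values chosen, `free a b`
says that the value chosen for `a` is not below `b`, `bit r b` says which digits of the register `r`
are `b`, `carry` the same of the carries in `a + s`, and `le` compares the lower digits of `x` and
`y`. -/
inductive Pred
  | first | last | next | sym (s : Sym) | plus | times | num
  | mode (M : Mode) | inst (M : Mode) (s : Sym) (z : Bool) | stride | target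
  | card | choice | free | bit (r : Reg) (b : Bool) | carry (b : Bool) | le
  deriving Fintype

/-- A predicate applied to variables. -/
structure Atom where
  pred : Pred
  x : Fin 8
  y : Fin 8
  z : Fin 8

/-- The implication from the conjunction of the `body` to the disjunction of the `head`. -/
structure Rule where
  body : List Atom
  head : List Atom

/-- Interpretations of the predicates. -/
abbrev Interp : Type := Pred → ℕ → ℕ → ℕ → Prop

/-- The truth of an atom. -/
def Atom.Sat (I : Interp) (v : Fin 8 → ℕ) (a : Atom) : Prop := I a.pred (v a.x) (v a.y) (v a.z)

/-- The truth of one of several atoms. -/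
def Atom.AnySat (I : Interp) (v : Fin 8 → ℕ) : List Atom → Prop
  | [] => False
  | [a] => a.Sat I v
  | a :: l => a.Sat I v ∨ AnySat I v l

/-- The truth of a rule, as an iterated implication, so that a proof of it can be applied to proofs
of the atoms of the body. -/
def Rule.Sat (I : Interp) (v : Fin 8 → ℕ) (r : Rule) : Prop :=
  r.body.foldr (fun a P => a.Sat I v → P) (Atom.AnySat I v r.head)

theorem Atom.anySat_iff {I : Interp} {v : Fin 8 → ℕ} {l : List Atom} :
    Atom.AnySat I v l ↔ ∃ a ∈ l, a.Sat I v := by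
  induction l using Atom.AnySat.induct with
  | case1 => simp [AnySat]
  | case2 a => simp [AnySat]
  | case3 a l hl ih =>
    rw [AnySat, ih, List.exists_mem_cons_iff]
    exact hl

theorem Rule.sat_iff {I : Interp} {v : Fin 8 → ℕ} {r : Rule} :
    r.Sat I v ↔ ((∀ a ∈ r.body, a.Sat I v) → ∃ a ∈ r.head, a.Sat I v) := by
  have h_body : ∀ (l : List Atom) (Q : Prop),
      l.foldr (fun a P => a.Sat I v → P) Q ↔ ((∀ a ∈ l, a.Sat I v) → Q) := fun l Q => by
    induction l with
    | nil => simp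
    | cons a l ih => rw [List.foldr_cons, ih, List.forall_mem_cons, and_imp]
  rw [Rule.Sat, h_body, Atom.anySat_iff]

/-- An atom or its negation as a literal. -/
def Atom.lit (b : Bool) (a : Atom) : Lit Pred 8 := ⟨a.pred, ![a.x, a.y, a.z], b⟩

/-- A rule as a clause. -/
def Rule.clause (r : Rule) : List (Lit Pred 8) :=
  r.body.map (Atom.lit false) ++ r.head.map (Atom.lit true)

theorem Atom.lit_apply (A : Pred → (Fin 3 → ℕ) → Prop) (b : Bool) (a : Atom) (v : Fin 8 → ℕ) :
    A (a.lit b).rel (fun k => v ((a.lit b).arg k)) ↔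
      a.Sat (fun p x y z => A p ![x, y, z]) v := by
  have h_arg : (fun k => v ((a.lit b).arg k)) = ![v a.x, v a.y, v a.z] := by
    funext k
    fin_cases k <;> rfl
  rw [h_arg]
  rfl

theorem Rule.holds_clause (A : Pred → (Fin 3 → ℕ) → Prop) (r : Rule) (v : Fin 8 → ℕ) :
    Holds A r.clause v ↔ r.Sat (fun p x y z => A p ![x, y, z]) v := by
  simp only [Holds, Rule.clause, List.mem_append, List.mem_map, or_and_right, exists_or,
    exists_exists_and_eq_and, Atom.lit_apply]
  rw [Rule.sat_iff, imp_iff_not_or]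
  simp [Atom.lit]

namespace Pred

/-- The atom of a property; predicates have three arguments, and the last one is repeated. -/
def un (p : Pred) (x : Fin 8) : Atom := ⟨p, x, x, x⟩

/-- The atom of a binary relation. -/
def bin (p : Pred) (x y : Fin 8) : Atom := ⟨p, x, y, y⟩

/-- The atom of a ternary relation. -/
def tri (p : Pred) (x y z : Fin 8) : Atom := ⟨p, x, y, z⟩

/-- Addition and multiplication. -/
def arithRules : List Rule :=
  [⟨[un first 0], [tri plus 1 0 1]⟩,
   ⟨[tri plus 0 1 2, bin next 1 3, bin next 2 4], [tri plus 0 3 4]⟩,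
   ⟨[un first 0], [tri times 1 0 0]⟩,
   ⟨[tri times 0 1 2, tri plus 2 0 3, bin next 1 4], [tri times 0 4 3]⟩]

/-- The number that is written at a position, by the symbol read there. -/
def numRules : Option Sym → List Rule
  | none => [⟨[un last 0, un first 1], [bin num 0 1]⟩]
  | some (.bit false) => [⟨[un (sym (.bit false)) 0, bin next 0 1, bin num 1 2,
      tri plus 2 2 3], [bin num 0 3]⟩]
  | some (.bit true) => [⟨[un (sym (.bit true)) 0, bin next 0 1, bin num 1 2,
      tri plus 2 2 3, bin next 3 4], [bin num 0 4]⟩]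
  | some s => [⟨[un (sym s) 0, un first 1], [bin num 0 1]⟩]

/-- The carries in the addition of the shifted factor to the accumulator. -/
def carryRules (x y c : Bool) : List Rule :=
  [⟨[un first 1], [bin (carry false) 0 1]⟩,
   ⟨[bin (bit .a x) 0 1, bin (bit .s y) 0 1, bin (carry c) 0 1, bin next 1 2],
    [bin (carry (Bool.atLeastTwo x y c)) 0 2]⟩]

/-- The initial state, at the position after the first one. -/
def initRules (r : Reg) : List Rule :=
  [⟨[un first 0, bin next 0 1], [un (mode .kNum) 1]⟩,
   ⟨[un first 0, bin next 0 1], [bin stride 1 0]⟩,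
   ⟨[un first 0, bin next 0 1], [bin target 1 0]⟩,
   ⟨[un first 0, bin next 0 1], [bin (bit r (r ≠ .a)) 1 0]⟩,
   ⟨[un first 0, bin next 0 1, bin next 2 3], [bin (bit r false) 1 3]⟩]

/-- The choice of the instruction, and the reading of the numbers of values. -/
def fetchRules (M : Mode) (s : Sym) : List Rule :=
  [⟨[un (mode M) 0, un (sym s) 0, bin target 0 1, un first 1],
    [un (inst M s true) 0]⟩,
   ⟨[un (mode M) 0, un (sym s) 0, bin target 0 1, bin next 2 1],
    [un (inst M s false) 0]⟩] ++
  match M, s with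
  | .card, .bit b => [⟨[un (mode .card) 0, un (sym (.bit b)) 0, bin stride 0 1, bin num 0 2],
      [bin card 1 2]⟩]
  | _, _ => []

/-- The new digits of a register. -/
def srcRules (i : Pred) (r : Reg) (x y c : Bool) : Src → List Rule
  | .copy r' => [⟨[un i 0, bin next 0 1, bin (bit r' x) 0 2], [bin (bit r x) 1 2]⟩]
  | .zero => [⟨[un i 0, bin next 0 1], [bin (bit r false) 1 2]⟩]
  | .dbl =>
    [⟨[un i 0, bin next 0 1, un first 2], [bin (bit r false) 1 2]⟩,
     ⟨[un i 0, bin next 0 1, bin (bit .s x) 0 2, bin next 2 3], [bin (bit r x) 1 3]⟩]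
  | .sum => [⟨[un i 0, bin next 0 1, bin (bit .a x) 0 2, bin (bit .s y) 0 2,
      bin (carry c) 0 2], [bin (bit r ((x ^^ y) ^^ c)) 1 2]⟩]

/-- The new stride. -/
def strideRules (i : Pred) : StrideOp → List Rule
  | .keep => [⟨[un i 0, bin next 0 1, bin stride 0 2], [bin stride 1 2]⟩]
  | .one => [⟨[un i 0, bin next 0 1, un first 2, bin next 2 3], [bin stride 1 3]⟩]
  | .inc => [⟨[un i 0, bin next 0 1, bin stride 0 2, bin next 2 3], [bin stride 1 3]⟩]
  | .mul => [⟨[un i 0, bin next 0 1, bin num 0 2, bin card 2 3, bin stride 0 4,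
      tri times 4 3 5], [bin stride 1 5]⟩]

/-- The new target. -/
def targetRules (i : Pred) : TargetOp → List Rule
  | .keep => [⟨[un i 0, bin next 0 1, bin target 0 2], [bin target 1 2]⟩]
  | .dec => [⟨[un i 0, bin next 0 1, bin target 0 2, bin next 3 2], [bin target 1 3]⟩]
  | .add => [⟨[un i 0, bin next 0 1, bin num 0 2, bin choice 2 3, bin stride 0 4,
      tri times 4 3 5, bin target 0 6, tri plus 6 5 7], [bin target 1 7]⟩]

/-- The execution of an instruction. -/
def instRules (M : Mode) (s : Sym) (z : Bool) (r : Reg) (x y c : Bool) : List Rule :=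
  [⟨[un (inst M s z) 0, bin next 0 1], [un (mode (instr M s z).mode) 1]⟩] ++
  srcRules (inst M s z) r x y c ((instr M s z).reg.src r) ++
  strideRules (inst M s z) (instr M s z).stride ++ targetRules (inst M s z) (instr M s z).target

/-- The choice of an instantiation: starting from `0`, each candidate for the value of a variable
is chosen or passed over, and the candidates have run out at the number of values. -/
def choiceRules : List Rule :=
  [⟨[un first 1], [bin free 0 1]⟩,
   ⟨[bin free 0 1, bin next 1 2], [bin choice 0 1, bin free 0 2]⟩,
   ⟨[bin card 0 1, bin free 0 1], []⟩]

/-- The comparison of the two products at the end, from the lowest digit upwards. -/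
def compareRules (b : Bool) : List Rule :=
  [⟨[un first 0], [un le 0]⟩,
   ⟨[un last 0, bin next 1 2, un le 1, bin (bit .x b) 0 1, bin (bit .y b) 0 1],
    [un le 2]⟩,
   ⟨[un last 0, bin next 1 2, bin (bit .x false) 0 1, bin (bit .y true) 0 1],
    [un le 2]⟩,
   ⟨[un last 0, un (mode .scope) 0, un le 0], []⟩]

/-- The list of all the elements of a finite type. -/
noncomputable def all (α : Type) [Fintype α] : List α := Finset.univ.toList

theorem mem_all {α : Type} [Fintype α] (a : α) : a ∈ all α :=
  Finset.mem_toList.2 (Finset.mem_univ a)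

/-- The rules of the scan. -/
noncomputable def rules : List Rule :=
  arithRules ++ (all (Option Sym)).flatMap numRules ++
  (all (Bool × Bool × Bool)).flatMap (fun b => carryRules b.1 b.2.1 b.2.2) ++
  (all Reg).flatMap initRules ++ (all (Mode × Sym)).flatMap (fun i => fetchRules i.1 i.2) ++
  (all (Mode × Sym × Bool × Reg × Bool × Bool × Bool)).flatMap (fun i =>
    instRules i.1 i.2.1 i.2.2.1 i.2.2.2.1 i.2.2.2.2.1 i.2.2.2.2.2.1 i.2.2.2.2.2.2) ++
  choiceRules ++ (all Bool).flatMap compareRules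

theorem mem_rules {r : Rule} : r ∈ rules ↔ r ∈ arithRules ∨ (∃ s, r ∈ numRules s) ∨
    (∃ x y c, r ∈ carryRules x y c) ∨ (∃ g, r ∈ initRules g) ∨ (∃ M s, r ∈ fetchRules M s) ∨
    (∃ M s z g x y c, r ∈ instRules M s z g x y c) ∨ r ∈ choiceRules ∨ ∃ b, r ∈ compareRules b := by
  simp only [rules, List.mem_append, List.mem_flatMap, mem_all, true_and, Prod.exists, or_assoc]

end Pred

/-- The description of a scan of a string, with a choice of the instantiation. -/
noncomputable def scanTheory : Theory Pred 8 where
  i₀ := 0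
  i₁ := 1
  ne := by decide
  mark
    | .first => Rule.clause ⟨[], [Pred.un .first 0]⟩
    | .symb s => Rule.clause ⟨[], [Pred.un (.sym s) 0]⟩
    | .last => Rule.clause ⟨[], [Pred.un .last 0]⟩
  next := Rule.clause ⟨[], [Pred.bin .next 0 1]⟩
  rules := Pred.rules.map Rule.clause

/-- The interpretation `I` describes a scan of the string `w`. -/
structure Interp.Describes (I : Interp) (w : List Sym) : Prop where
  first : I .first 0 0 0
  last : I .last (w.length + 1) (w.length + 1) (w.length + 1)
  next : ∀ a ≤ w.length + 1, I .next a (a + 1) (a + 1)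
  sym : ∀ j s, w[j]? = some s → I (.sym s) (j + 1) (j + 1) (j + 1)
  rules : ∀ r ∈ Pred.rules, ∀ v, (∀ k, v k < 2 ^ width w.length) → r.Sat I v

theorem models_scanTheory_iff {A : Pred → (Fin 3 → ℕ) → Prop} {w : List Sym} :
    scanTheory.Models A w ↔ Interp.Describes (fun p x y z => A p ![x, y, z]) w := by
  have h₀ (a : ℕ) : scanTheory.posVal a 0 = a := scanTheory.posVal_i₀ a
  have h₁ (a : ℕ) : scanTheory.posVal a 1 = a + 1 := scanTheory.posVal_i₁ a
  have h_un (p : Pred) (a : ℕ) : Holds A (Rule.clause ⟨[], [Pred.un p 0]⟩) (scanTheory.posVal a) ↔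
      A p ![a, a, a] := by
    simp [Rule.holds_clause, Rule.sat_iff, Atom.Sat, Pred.un, h₀]
  have h_next (a : ℕ) : Holds A scanTheory.next (scanTheory.posVal a) ↔
      A .next ![a, a + 1, a + 1] := by
    refine (Rule.holds_clause A ⟨[], [Pred.bin .next 0 1]⟩ _).trans ?_
    simp [Rule.sat_iff, Atom.Sat, Pred.bin, h₀, h₁]
  have h_rules : scanTheory.rules = Pred.rules.map Rule.clause := rfl
  rw [Theory.Models, scanTheory.forall_mem_instances,
    forall_getElem?_marks (P := fun j k => Holds A (scanTheory.mark k) (scanTheory.posVal j))]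
  simp only [h_rules, List.forall_mem_map, h_next, Rule.holds_clause A]
  refine ⟨fun ⟨⟨hfirst, hsym, hlast⟩, hnext, hrules⟩ => ⟨(h_un _ _).1 hfirst, (h_un _ _).1 hlast,
    hnext, fun j s hj => (h_un _ _).1 (hsym j s hj), hrules⟩, fun h => ⟨⟨(h_un _ _).2 h.first,
    fun j s hj => (h_un _ _).2 (h.sym j s hj), (h_un _ _).2 h.last⟩, h.next, h.rules⟩⟩

theorem exists_models_iff (w : List Sym) :
    (∃ A, scanTheory.Models A w) ↔ ∃ I : Interp, I.Describes w :=
  ⟨fun ⟨_, hA⟩ => ⟨_, models_scanTheory_iff.1 hA⟩,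
    fun ⟨I, hI⟩ => ⟨fun p f => I p (f 0) (f 1) (f 2), models_scanTheory_iff.2 hI⟩⟩

/-- The carry into a digit of a sum. -/
def carryBit (a b j : ℕ) : Bool := decide (2 ^ j ≤ a % 2 ^ j + b % 2 ^ j)

theorem carryBit_zero (a b : ℕ) : carryBit a b 0 = false := by simp [carryBit, Nat.mod_one]

theorem mod_two_pow_succ (a j : ℕ) : a % 2 ^ (j + 1) = a % 2 ^ j + 2 ^ j * (a.testBit j).toNat := by
  rw [Nat.mod_pow_succ, Nat.toNat_testBit]

theorem carryBit_succ (a b j : ℕ) :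
    carryBit a b (j + 1) = Bool.atLeastTwo (a.testBit j) (b.testBit j) (carryBit a b j) := by
  have ha := Nat.mod_lt a (Nat.two_pow_pos j)
  have hb := Nat.mod_lt b (Nat.two_pow_pos j)
  simp only [carryBit, mod_two_pow_succ]
  rw [pow_succ]
  cases a.testBit j <;> cases b.testBit j <;>
    simp only [Bool.toNat_false, Bool.toNat_true, Bool.atLeastTwo_false_left,
      Bool.atLeastTwo_true_left, Bool.false_and, Bool.true_and, Bool.false_or, Bool.true_or,
      decide_eq_false_iff_not, decide_eq_true_iff, decide_eq_decide] <;>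
    omega

theorem testBit_add_eq (a b j : ℕ) :
    (a + b).testBit j = ((a.testBit j ^^ b.testBit j) ^^ carryBit a b j) := by
  simp only [carryBit, Nat.testBit_eq_decide_div_mod_eq, Nat.add_div (Nat.two_pow_pos j)]
  rcases Nat.mod_two_eq_zero_or_one (a / 2 ^ j) with h | h <;>
    rcases Nat.mod_two_eq_zero_or_one (b / 2 ^ j) with h' | h' <;>
    by_cases hc : 2 ^ j ≤ a % 2 ^ j + b % 2 ^ j <;>
    simp [hc, h, h', Nat.add_mod]

theorem getElem?_of_drop_eq_cons {α : Type*} {w l : List α} {i : ℕ} {a : α}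
    (h : w.drop i = a :: l) : w[i]? = some a := by
  rw [← List.head?_drop, h, List.head?_cons]

theorem lt_length_of_drop_eq_cons {α : Type*} {w l : List α} {i : ℕ} {a : α}
    (h : w.drop i = a :: l) : i < w.length :=
  (List.getElem?_eq_some_iff.1 (getElem?_of_drop_eq_cons h)).1

theorem drop_succ_of_drop_eq_cons {α : Type*} {w l : List α} {i : ℕ} {a : α}
    (h : w.drop i = a :: l) : w.drop (i + 1) = l := by
  rw [← List.tail_drop, h, List.tail_cons]

/-! ### A description of a scan determines the scan -/

/-- The valuation of the variables by a list. -/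
def val (l : List ℕ) (i : Fin 8) : ℕ := l.getD i 0

namespace Interp.Describes

variable {I : Interp} {w : List Sym}

theorem rule (h : I.Describes w) {r : Rule} (hr : r ∈ Pred.rules) (l : List ℕ)
    (hl : ∀ a ∈ l, a ≤ w.length + 2 := by
      simp only [List.forall_mem_cons, List.not_mem_nil, IsEmpty.forall_iff, implies_true, and_true]
      omega) :
    r.Sat I (val l) := by
  refine h.rules r hr _ fun k => ?_
  have h_width := add_three_lt_two_pow_width w.length
  rw [val, List.getD_eq_getElem?_getD]
  cases hk : l[(k : ℕ)]? with
  | none => exact Nat.two_pow_pos _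
  | some a =>
    have ha := hl a (List.mem_of_getElem? hk)
    rw [Option.getD_some]
    omega

theorem plus (h : I.Describes w) (a b : ℕ) (hab : a + b ≤ w.length + 2) :
    I .plus a b (a + b) := by
  have hm : ∀ r ∈ Pred.arithRules, r ∈ Pred.rules := fun r hr => Pred.mem_rules.2 (.inl hr)
  induction b with
  | zero => exact (h.rule (hm _ (.head _)) [0, a]) h.first
  | succ b ih =>
    exact (h.rule (hm _ (.tail _ (.head _))) [a, b, a + b, b + 1, a + b + 1])
      (ih (by omega)) (h.next b (by omega)) (h.next (a + b) (by omega))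

theorem times (h : I.Describes w) (a b : ℕ) (ha : a ≤ w.length + 2) (hb : b ≤ w.length + 2)
    (hab : a * b ≤ w.length + 2) : I .times a b (a * b) := by
  have hm : ∀ r ∈ Pred.arithRules, r ∈ Pred.rules := fun r hr => Pred.mem_rules.2 (.inl hr)
  induction b with
  | zero => exact (h.rule (hm _ (.tail _ (.tail _ (.head _)))) [0, a]) h.first
  | succ b ih =>
    rw [Nat.mul_succ] at hab ⊢
    exact (h.rule (hm _ (.tail _ (.tail _ (.tail _ (.head _))))) [a, b, a * b, a * b + a, b + 1])
      (ih (by omega) (by omega)) (h.plus _ _ hab) (h.next b (by omega))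

theorem num_bit (h : I.Describes w) {p k : ℕ} {b : Bool} (hp : p ≤ w.length)
    (hk : b.toNat + 2 * k ≤ w.length + 2) (hs : I (.sym (.bit b)) p p p)
    (hnum : I .num (p + 1) k k) : I .num p (b.toNat + 2 * k) (b.toNat + 2 * k) := by
  have hm : ∀ s, ∀ r ∈ Pred.numRules s, r ∈ Pred.rules :=
    fun s r hr => Pred.mem_rules.2 (.inr (.inl ⟨s, hr⟩))
  have h_next := h.next p (by omega)
  have h_dbl := h.plus k k (by omega)
  cases b with
  | false =>
    rw [Bool.toNat_false, zero_add, two_mul] at hk ⊢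
    exact (h.rule (hm (some (.bit false)) _ (.head _)) [p, p + 1, k, k + k]) hs h_next hnum h_dbl
  | true =>
    rw [Bool.toNat_true, add_comm, two_mul] at hk ⊢
    exact (h.rule (hm (some (.bit true)) _ (.head _)) [p, p + 1, k, k + k, k + k + 1])
      hs h_next hnum h_dbl (h.next (k + k) (by omega))

theorem num (h : I.Describes w) {i : ℕ} (hi : i ≤ w.length)
    (hn : numAt (w.drop i) ≤ w.length + 2) :
    I .num (i + 1) (numAt (w.drop i)) (numAt (w.drop i)) := by
  have hm : ∀ s, ∀ r ∈ Pred.numRules s, r ∈ Pred.rules :=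
    fun s r hr => Pred.mem_rules.2 (.inr (.inl ⟨s, hr⟩))
  induction hl : w.drop i generalizing i with
  | nil =>
    obtain rfl : i = w.length := le_antisymm hi (List.drop_eq_nil_iff.1 hl)
    exact (h.rule (hm none _ (.head _)) [w.length + 1, 0]) h.last h.first
  | cons s l ih =>
    have hlt := lt_length_of_drop_eq_cons hl
    have hs := h.sym i s (getElem?_of_drop_eq_cons hl)
    have hl' := drop_succ_of_drop_eq_cons hl
    rw [hl] at hn
    cases s with
    | bit b =>
      rw [numAt] at hn ⊢
      exact h.num_bit (by omega) hn hs (ih hlt (by rw [hl']; omega) hl')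
    | slash => exact (h.rule (hm (some .slash) _ (.head _)) [i + 1, 0]) hs h.first
    | minus => exact (h.rule (hm (some .minus) _ (.head _)) [i + 1, 0]) hs h.first
    | comma => exact (h.rule (hm (some .comma) _ (.head _)) [i + 1, 0]) hs h.first
    | semi => exact (h.rule (hm (some .semi) _ (.head _)) [i + 1, 0]) hs h.first

theorem exists_choice (h : I.Describes w) {v k : ℕ} (hv : v ≤ w.length + 2) (hk : k ≤ w.length + 2)
    (hcard : I .card v k k) : ∃ a < k, I .choice v a a := by
  have hm : ∀ r ∈ Pred.choiceRules, r ∈ Pred.rules :=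
    fun r hr => Pred.mem_rules.2 (by simp only [hr, true_or, or_true])
  by_contra! hne
  have h_free : ∀ a ≤ k, I .free v a a := by
    intro a ha
    induction a with
    | zero => exact (h.rule (hm _ (.head _)) [v, 0]) h.first
    | succ a ih =>
      exact ((h.rule (hm _ (.tail _ (.head _))) [v, a, a + 1])
        (ih (by omega)) (h.next a (by omega))).resolve_left (hne a ha)
  exact (h.rule (hm _ (.tail _ (.tail _ (.head _)))) [v, k]) hcard (h_free k le_rfl)

end Interp.Describes

/-- The state of the scan after `i` steps is described by `I`. -/
structure Interp.Knows (I : Interp) (w : List Sym) (E : Env) (i : ℕ) (st : State) : Prop where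
  mode : I (.mode st.mode) (i + 1) (i + 1) (i + 1)
  stride : I .stride (i + 1) st.stride st.stride
  target : I .target (i + 1) st.target st.target
  bit : ∀ r, ∀ j ≤ w.length + 1, I (.bit r ((st.reg r).testBit j)) (i + 1) j j
  card : ∀ v < st.seen, E.card v ≤ w.length + 1 → I .card v (E.card v) (E.card v)
  stride_le : st.stride ≤ w.length + 1
  target_le : st.target ≤ w.length + 1

/-- The instantiation of `E` is the one chosen by `I`. -/
def Interp.Chooses (I : Interp) (w : List Sym) (E : Env) : Prop :=
  ∀ v ≤ w.length + 1, 0 < E.card v → E.card v ≤ w.length + 1 → I .card v (E.card v) (E.card v) →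
    I .choice v (E.val v) (E.val v)

namespace Interp.Describes

variable {I : Interp} {w : List Sym} {E : Env}

theorem knows_init (h : I.Describes w) (E : Env) : I.Knows w E 0 .start := by
  have hm : ∀ g, ∀ r ∈ Pred.initRules g, r ∈ Pred.rules :=
    fun g r hr => Pred.mem_rules.2 (.inr (.inr (.inr (.inl ⟨g, hr⟩))))
  have hn := h.next 0 (by omega)
  refine ⟨?_, ?_, ?_, fun r j hj => ?_, fun v hv => absurd hv (Nat.not_lt_zero _), Nat.zero_le _,
    Nat.zero_le _⟩
  · exact (h.rule (hm .x _ (.head _)) [0, 1]) h.first hn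
  · exact (h.rule (hm .x _ (.tail _ (.head _))) [0, 1]) h.first hn
  · exact (h.rule (hm .x _ (.tail _ (.tail _ (.head _)))) [0, 1]) h.first hn
  · cases j with
    | zero =>
      have h_bit := (h.rule (hm r _ (.tail _ (.tail _ (.tail _ (.head _))))) [0, 1]) h.first hn
      cases r <;> exact h_bit
    | succ j =>
      have h_testBit : (State.start.reg r).testBit (j + 1) = false := by
        cases r <;> simp [State.start, State.reg, Nat.testBit_add_one]
      rw [h_testBit]
      exact (h.rule (hm r _ (.tail _ (.tail _ (.tail _ (.tail _ (.head _)))))) [0, 1, j, j + 1])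
        h.first hn (h.next j (by omega))

theorem carry (h : I.Describes w) {i : ℕ} {st : State} (hi : i ≤ w.length)
    (hk : I.Knows w E i st) {j : ℕ} (hj : j ≤ w.length + 1) :
    I (.carry (carryBit st.a st.s j)) (i + 1) j j := by
  have hm : ∀ x y c, ∀ r ∈ Pred.carryRules x y c, r ∈ Pred.rules :=
    fun x y c r hr => Pred.mem_rules.2 (.inr (.inr (.inl ⟨x, y, c, hr⟩)))
  induction j with
  | zero =>
    rw [carryBit_zero]
    exact (h.rule (hm true true true _ (.head _)) [i + 1, 0]) h.first
  | succ j ih =>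
    rw [carryBit_succ]
    exact (h.rule (hm _ _ _ _ (.tail _ (.head _))) [i + 1, j, j + 1])
      (hk.bit .a j (by omega)) (hk.bit .s j (by omega)) (ih (by omega)) (h.next j (by omega))

end Interp.Describes

theorem State.mode_eq_scope_of_reads_variable {st : State} {c : Sym}
    (h : (st.instr c).stride = .mul ∨ (st.instr c).target = .add) :
    st.mode = .scope ∧ c ≠ .semi := by
  revert h
  rw [State.instr]
  generalize st.mode = M
  generalize decide (st.target = 0) = z
  cases M <;> cases c <;> cases z <;> simp [FactorModel.instr]

theorem State.target_ne_zero_of_dec {st : State} {c : Sym} (h : (st.instr c).target = .dec) :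
    st.target ≠ 0 := by
  intro h0
  revert h
  rw [State.instr, h0]
  cases st.mode <;> cases c <;> simp [FactorModel.instr]

theorem Env.reg_step (E : Env) (st : State) (c : Sym) (l : List Sym) (r : Reg) :
    (E.step st c l).reg r = ((st.instr c).reg.src r).eval st := by cases r <;> rfl

theorem Pred.mem_rules_of_mem_instRules {M : Mode} {s : Sym} {z : Bool} {g : Reg} {x y c : Bool}
    {r : Rule} (hr : r ∈ instRules M s z g x y c) : r ∈ rules :=
  mem_rules.2 (.inr (.inr (.inr (.inr (.inr (.inl ⟨M, s, z, g, x, y, c, hr⟩))))))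

theorem Pred.mem_rules_of_mem_fetchRules {M : Mode} {s : Sym} {r : Rule}
    (hr : r ∈ fetchRules M s) : r ∈ rules :=
  mem_rules.2 (.inr (.inr (.inr (.inr (.inl ⟨M, s, hr⟩)))))

namespace Interp.Describes

variable {I : Interp} {w l : List Sym} {E : Env} {n i : ℕ} {st : State} {c : Sym}

theorem sym_of_drop (h : I.Describes w) (hl : w.drop i = c :: l) :
    I (.sym c) (i + 1) (i + 1) (i + 1) :=
  h.sym i c (getElem?_of_drop_eq_cons hl)

theorem num_of_drop (h : I.Describes w) (hl : w.drop i = c :: l)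
    (hn : numAt (c :: l) ≤ w.length + 2) : I .num (i + 1) (numAt (c :: l)) (numAt (c :: l)) := by
  rw [← hl] at hn ⊢
  exact h.num (lt_length_of_drop_eq_cons hl).le hn

theorem inst (h : I.Describes w) (hk : I.Knows w E i st) (hl : w.drop i = c :: l) :
    I (.inst st.mode c (decide (st.target = 0))) (i + 1) (i + 1) (i + 1) := by
  have hlt := lt_length_of_drop_eq_cons hl
  have hs := h.sym_of_drop hl
  have ht := hk.target
  have htle := hk.target_le
  generalize st.target = t at ht htle ⊢
  cases t with
  | zero =>
    exact (h.rule (Pred.mem_rules_of_mem_fetchRules (.head _)) [i + 1, 0]) hk.mode hs ht h.first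
  | succ u =>
    exact (h.rule (Pred.mem_rules_of_mem_fetchRules (.tail _ (.head _))) [i + 1, u + 1, u]) hk.mode
      hs ht (h.next u (by omega))

theorem mode_step (h : I.Describes w) (hk : I.Knows w E i st) (hl : w.drop i = c :: l) :
    I (.mode (E.step st c l).mode) (i + 2) (i + 2) (i + 2) := by
  have hlt := lt_length_of_drop_eq_cons hl
  exact (h.rule (Pred.mem_rules_of_mem_instRules (g := .x) (x := true) (y := true) (c := true)
    (.head _)) [i + 1, i + 2]) (h.inst hk hl) (h.next (i + 1) (by omega))

theorem stride_step (h : I.Describes w) (hk : I.Knows w E i st) (hl : w.drop i = c :: l)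
    (hg : E.Good n (w.length + 1) st c l) :
    I .stride (i + 2) (E.step st c l).stride (E.step st c l).stride := by
  have hlt := lt_length_of_drop_eq_cons hl
  have hinst := h.inst hk hl
  have hnext := h.next (i + 1) (by omega)
  have hst := hk.stride_le
  have hle := hg.stride_le
  have hm : ∀ r ∈ Pred.strideRules (.inst st.mode c (decide (st.target = 0))) (st.instr c).stride,
      r ∈ Pred.rules := fun r hr =>
    Pred.mem_rules_of_mem_instRules (g := .x) (x := true) (y := true) (c := true)
      (List.mem_append_left _ (List.mem_append_right _ hr))
  simp only [Env.step] at hle ⊢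
  cases hop : (st.instr c).stride with
  | keep =>
    rw [hop] at hm
    exact (h.rule (hm _ (.head _)) [i + 1, i + 2, st.stride]) hinst hnext hk.stride
  | one =>
    rw [hop] at hm
    exact (h.rule (hm _ (.head _)) [i + 1, i + 2, 0, 1]) hinst hnext h.first (h.next 0 (by omega))
  | inc =>
    rw [hop] at hm
    exact (h.rule (hm _ (.head _)) [i + 1, i + 2, st.stride, st.stride + 1]) hinst hnext hk.stride
      (h.next st.stride (by omega))
  | mul =>
    obtain ⟨hmode, hc⟩ := State.mode_eq_scope_of_reads_variable (.inl hop)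
    obtain ⟨hseen, hnum, -, hcard, -⟩ := hg.scope hmode hc
    rw [hop] at hm hle
    simp only [StrideOp.eval] at hle ⊢
    have h_times := h.times st.stride (E.card (numAt (c :: l))) (by omega) (by omega) (by omega)
    exact (h.rule (hm _ (.head _)) [i + 1, i + 2, numAt (c :: l), E.card (numAt (c :: l)),
      st.stride, st.stride * E.card (numAt (c :: l))]) hinst hnext (h.num_of_drop hl (by omega))
      (hk.card _ hseen hcard) hk.stride h_times

theorem target_step (h : I.Describes w) (hE : I.Chooses w E) (hk : I.Knows w E i st)
    (hl : w.drop i = c :: l) (hg : E.Good n (w.length + 1) st c l) :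
    I .target (i + 2) (E.step st c l).target (E.step st c l).target := by
  have hlt := lt_length_of_drop_eq_cons hl
  have hinst := h.inst hk hl
  have hnext := h.next (i + 1) (by omega)
  have hst := hk.stride_le
  have htt := hk.target_le
  have hle := hg.target_le
  have hm : ∀ r ∈ Pred.targetRules (.inst st.mode c (decide (st.target = 0))) (st.instr c).target,
      r ∈ Pred.rules := fun r hr =>
    Pred.mem_rules_of_mem_instRules (g := .x) (x := true) (y := true) (c := true)
      (List.mem_append_right _ hr)
  simp only [Env.step] at hle ⊢
  cases hop : (st.instr c).target with
  | keep =>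
    rw [hop] at hm
    exact (h.rule (hm _ (.head _)) [i + 1, i + 2, st.target]) hinst hnext hk.target
  | dec =>
    rw [hop] at hm
    obtain ⟨u, hu⟩ := Nat.exists_eq_succ_of_ne_zero (State.target_ne_zero_of_dec hop)
    have ht := hk.target
    rw [hu] at ht htt
    rw [TargetOp.eval, hu, Nat.succ_sub_one]
    exact (h.rule (hm _ (.head _)) [i + 1, i + 2, u + 1, u]) hinst hnext ht (h.next u (by omega))
  | add =>
    obtain ⟨hmode, hc⟩ := State.mode_eq_scope_of_reads_variable (.inr hop)
    obtain ⟨hseen, hnum, hpos, hcard, hval⟩ := hg.scope hmode hc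
    rw [hop] at hm hle
    simp only [TargetOp.eval] at hle ⊢
    have h_times := h.times st.stride (E.val (numAt (c :: l))) (by omega) (by omega) (by omega)
    have h_plus := h.plus st.target (st.stride * E.val (numAt (c :: l))) (by omega)
    exact (h.rule (hm _ (.head _)) [i + 1, i + 2, numAt (c :: l), E.val (numAt (c :: l)),
      st.stride, st.stride * E.val (numAt (c :: l)), st.target,
      st.target + st.stride * E.val (numAt (c :: l))])
      hinst hnext (h.num_of_drop hl (by omega)) (hE _ hnum hpos hcard (hk.card _ hseen hcard))
      hk.stride h_times hk.target h_plus

theorem bit_step (h : I.Describes w) (hk : I.Knows w E i st) (hl : w.drop i = c :: l) (r : Reg)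
    {j : ℕ} (hj : j ≤ w.length + 1) :
    I (.bit r (((E.step st c l).reg r).testBit j)) (i + 2) j j := by
  have hlt := lt_length_of_drop_eq_cons hl
  have hinst := h.inst hk hl
  have hnext := h.next (i + 1) (by omega)
  have hm : ∀ x y d, ∀ r' ∈ Pred.srcRules (.inst st.mode c (decide (st.target = 0))) r x y d
      ((st.instr c).reg.src r), r' ∈ Pred.rules := fun x y d r' hr =>
    Pred.mem_rules_of_mem_instRules
      (List.mem_append_left _ (List.mem_append_left _ (List.mem_append_right _ hr)))
  rw [Env.reg_step]
  generalize (st.instr c).reg.src r = src at hm ⊢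
  cases src with
  | copy r' =>
    exact (h.rule (hm _ true true _ (.head _)) [i + 1, i + 2, j]) hinst hnext (hk.bit r' j hj)
  | zero =>
    rw [Src.eval, Nat.zero_testBit]
    exact (h.rule (hm true true true _ (.head _)) [i + 1, i + 2, j]) hinst hnext
  | dbl =>
    rw [Src.eval]
    cases j with
    | zero =>
      rw [Nat.testBit_zero, Nat.mul_mod_right, decide_eq_false zero_ne_one]
      exact (h.rule (hm true true true _ (.head _)) [i + 1, i + 2, 0]) hinst hnext h.first
    | succ j =>
      rw [Nat.testBit_add_one, Nat.mul_div_cancel_left _ two_pos]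
      exact (h.rule (hm _ true true _ (.tail _ (.head _))) [i + 1, i + 2, j, j + 1]) hinst hnext
        (hk.bit .s j (by omega)) (h.next j (by omega))
  | sum =>
    rw [Src.eval, testBit_add_eq]
    exact (h.rule (hm _ _ _ _ (.head _)) [i + 1, i + 2, j]) hinst hnext (hk.bit .a j hj)
      (hk.bit .s j hj) (h.carry hlt.le hk hj)

theorem card_step (h : I.Describes w) (hk : I.Knows w E i st) (hl : w.drop i = c :: l)
    (hg : E.Good n (w.length + 1) st c l) {v : ℕ} (hv : v < (E.step st c l).seen)
    (hcard : E.card v ≤ w.length + 1) : I .card v (E.card v) (E.card v) := by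
  have hlt := lt_length_of_drop_eq_cons hl
  simp only [Env.step] at hv
  split_ifs at hv with hc
  · rcases Nat.lt_succ_iff_lt_or_eq.1 hv with hv | rfl
    · exact hk.card v hv hcard
    · obtain ⟨hmode, b, rfl⟩ := hc
      obtain ⟨hseen, -, hnum⟩ := hg.card hmode ⟨b, rfl⟩
      have hm := hk.mode
      have hst := hk.stride
      have hst_le := hk.stride_le
      rw [hmode] at hm
      rw [hseen] at hst
      rw [hnum] at hcard ⊢
      exact (h.rule (Pred.mem_rules_of_mem_fetchRules (M := .card) (s := .bit b)
        (.tail _ (.tail _ (.head _)))) [i + 1, st.seen, numAt (.bit b :: l)]) hm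
        (h.sym_of_drop hl) hst (h.num_of_drop hl (by omega))
  · exact hk.card v hv hcard

theorem knows_step (h : I.Describes w) (hE : I.Chooses w E) (hk : I.Knows w E i st)
    (hl : w.drop i = c :: l) (hg : E.Good n (w.length + 1) st c l) :
    I.Knows w E (i + 1) (E.step st c l) where
  mode := h.mode_step hk hl
  stride := h.stride_step hk hl hg
  target := h.target_step hE hk hl hg
  bit r _ hj := h.bit_step hk hl r hj
  card _ hv hcard := h.card_step hk hl hg hv hcard
  stride_le := hg.stride_le
  target_le := hg.target_le

theorem knows_of_path (h : I.Describes w) (hE : I.Chooses w E) {st' : State} (hi : i ≤ w.length)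
    (hl : w.drop i = l) (hk : I.Knows w E i st) (hp : E.Path n (w.length + 1) st l st' []) :
    I.Knows w E w.length st' := by
  generalize hl' : ([] : List Sym) = l' at hp
  induction hp generalizing i with
  | refl =>
    subst hl'
    rwa [le_antisymm (List.drop_eq_nil_iff.1 hl) hi]
  | step hg _ ih =>
    exact ih (lt_length_of_drop_eq_cons hl) (drop_succ_of_drop_eq_cons hl)
      (h.knows_step hE hk hl hg) hl'

theorem le_of_mod_le (h : I.Describes w) (hk : I.Knows w E w.length st) {j : ℕ}
    (hj : j ≤ w.length + 1) (hle : st.x % 2 ^ j ≤ st.y % 2 ^ j) : I .le j j j := by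
  have hr : ∀ b, ∀ r ∈ Pred.compareRules b, r ∈ Pred.rules :=
    fun b r hr => Pred.mem_rules.2 (.inr (.inr (.inr (.inr (.inr (.inr (.inr ⟨b, hr⟩)))))))
  induction j with
  | zero => exact (h.rule (hr true _ (.head _)) [0]) h.first
  | succ j ih =>
    have hx : I (.bit .x (st.x.testBit j)) (w.length + 1) j j := hk.bit .x j (by omega)
    have hy : I (.bit .y (st.y.testBit j)) (w.length + 1) j j := hk.bit .y j (by omega)
    have hn := h.next j (by omega)
    have hy_lt := Nat.mod_lt st.y (Nat.two_pow_pos j)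
    rw [mod_two_pow_succ, mod_two_pow_succ] at hle
    rcases lt_trichotomy (st.x.testBit j) (st.y.testBit j) with hlt | heq | hgt
    · rw [Bool.lt_iff] at hlt
      rw [hlt.1] at hx
      rw [hlt.2] at hy
      exact (h.rule (hr true _ (.tail _ (.tail _ (.head _)))) [w.length + 1, j, j + 1])
        h.last hn hx hy
    · rw [heq] at hx hle
      exact (h.rule (hr _ _ (.tail _ (.head _))) [w.length + 1, j, j + 1]) h.last hn
        (ih (by omega) (by omega)) hx hy
    · rw [Bool.lt_iff] at hgt
      rw [hgt.1, hgt.2, Bool.toNat_false, Bool.toNat_true] at hle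
      omega

theorem lt_of_knows (h : I.Describes w) (hk : I.Knows w E w.length st) (hm : st.mode = .scope)
    (hx : st.x < 2 ^ (w.length + 1)) (hy : st.y < 2 ^ (w.length + 1)) : st.y < st.x := by
  by_contra! hle
  have hr : ∀ r ∈ Pred.compareRules true, r ∈ Pred.rules :=
    fun r hr => Pred.mem_rules.2 (.inr (.inr (.inr (.inr (.inr (.inr (.inr ⟨true, hr⟩)))))))
  have hmode := hk.mode
  rw [hm] at hmode
  have h_le := h.le_of_mod_le hk le_rfl (by rwa [Nat.mod_eq_of_lt hx, Nat.mod_eq_of_lt hy])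
  exact (h.rule (hr _ (.tail _ (.tail _ (.tail _ (.head _))))) [w.length + 1]) h.last hmode h_le

end Interp.Describes

/-! ### A scan satisfies its description -/

/-- The interpretation of the predicates by a scan of the string `w`; there are `n` variables. -/
def Env.interp (E : Env) (n : ℕ) (w : List Sym) : Interp
  | .first, a, _, _ => a = 0
  | .last, a, _, _ => a = w.length + 1
  | .next, a, b, _ => b = a + 1
  | .sym s, p, _, _ => 0 < p ∧ w[p - 1]? = some s
  | .plus, a, b, c => a + b = c
  | .times, a, b, c => a * b = c
  | .num, p, k, _ => numAt (w.drop (p - 1)) = k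
  | .mode M, p, _, _ => (E.run .start w (p - 1)).mode = M
  | .inst M s z, p, _, _ => 0 < p ∧ w[p - 1]? = some s ∧ (E.run .start w (p - 1)).mode = M ∧
      z = decide ((E.run .start w (p - 1)).target = 0)
  | .stride, p, u, _ => (E.run .start w (p - 1)).stride = u
  | .target, p, u, _ => (E.run .start w (p - 1)).target = u
  | .card, v, c, _ => v < n ∧ E.card v = c
  | .choice, v, a, _ => E.val v = a
  | .free, v, a, _ => a ≤ E.val v
  | .bit r b, p, j, _ => ((E.run .start w (p - 1)).reg r).testBit j = b
  | .carry b, p, j, _ => carryBit (E.run .start w (p - 1)).a (E.run .start w (p - 1)).s j = b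
  | .le, j, _, _ => (E.run .start w w.length).x % 2 ^ j ≤ (E.run .start w w.length).y % 2 ^ j

theorem drop_eq_cons {w : List Sym} {i : ℕ} {s : Sym} (h : w[i]? = some s) :
    w.drop i = s :: w.drop (i + 1) := by
  obtain ⟨hi, rfl⟩ := List.getElem?_eq_some_iff.1 h
  exact List.drop_eq_getElem_cons hi

theorem numAt_drop_of_bit {w : List Sym} {p q : ℕ} {b : Bool}
    (hp : 0 < p ∧ w[p - 1]? = some (.bit b)) (hq : q = p + 1) :
    numAt (w.drop (p - 1)) = b.toNat + 2 * numAt (w.drop (q - 1)) := by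
  rw [drop_eq_cons hp.2, numAt, Nat.sub_add_cancel hp.1, hq, Nat.add_sub_cancel]

theorem numAt_drop_of_not_bit {w : List Sym} {p : ℕ} {s : Sym} (hp : w[p - 1]? = some s)
    (hs : ∀ b, s ≠ .bit b) : numAt (w.drop (p - 1)) = 0 := by
  rw [drop_eq_cons hp]
  cases s with
  | bit b => exact absurd rfl (hs b)
  | _ => rfl

namespace Env

variable {E : Env} {n B : ℕ} {w : List Sym} {st : State} {v : Fin 8 → ℕ} {r : Rule}

theorem Path.reg_lt (hp : E.Path n B .start w st []) :
    st.x < 2 ^ (w.length + 1) ∧ st.y < 2 ^ (w.length + 1) := by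
  obtain ⟨hx, hy⟩ := run_reg_le (E := E) (st := .start) (k := 0) w w.length le_rfl le_rfl le_rfl
    zero_le_one
  rw [hp.run_length, zero_add] at hx hy
  have h_lt := Nat.pow_lt_pow_right one_lt_two (Nat.lt_succ_self w.length)
  exact ⟨hx.trans_lt h_lt, hy.trans_lt h_lt⟩

theorem run_of_inst {M : Mode} {s : Sym} {z : Bool} {p q : ℕ}
    (hi : E.interp n w (.inst M s z) p p p) (hn : E.interp n w .next p q q) :
    w.drop (p - 1) = s :: w.drop p ∧
      E.run .start w (q - 1) = E.step (E.run .start w (p - 1)) s (w.drop p) ∧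
      (E.run .start w (p - 1)).instr s = instr M s z := by
  obtain ⟨hp, hs, rfl, rfl⟩ := hi
  obtain rfl : q = p + 1 := hn
  have h_drop := drop_eq_cons hs
  have h_run := run_succ (E := E) (st := .start) h_drop
  rw [Nat.sub_add_cancel hp] at h_drop h_run
  exact ⟨h_drop, h_run, rfl⟩

theorem sat_of_mem_arithRules (hr : r ∈ Pred.arithRules) : r.Sat (E.interp n w) v := by
  simp only [Pred.arithRules, List.mem_cons, List.not_mem_nil, or_false] at hr
  rcases hr with rfl | rfl | rfl | rfl <;>
    simp only [Rule.Sat, List.foldr_cons, List.foldr_nil, Atom.AnySat, Atom.Sat, Pred.un, Pred.bin,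
      Pred.tri, interp]
  · omega
  · omega
  · intro h0
    rw [h0, mul_zero]
  · intro h_times h_plus h_next
    rw [h_next, Nat.mul_succ, h_times, h_plus]

theorem sat_of_mem_numRules {s : Option Sym} (hr : r ∈ Pred.numRules s) :
    r.Sat (E.interp n w) v := by
  rcases s with _ | (_ | _) | _ | _ | _ | _ <;>
    simp only [Pred.numRules, List.mem_cons, List.not_mem_nil, or_false] at hr <;> subst hr <;>
    simp only [Rule.Sat, List.foldr_cons, List.foldr_nil, Atom.AnySat, Atom.Sat, Pred.un, Pred.bin,
      Pred.tri, interp]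
  · intro h_last h0
    rw [h_last, h0, Nat.add_sub_cancel, List.drop_length, numAt]
    nofun
  · intro h_sym h_next h_num h_dbl
    rw [numAt_drop_of_bit h_sym h_next, h_num, ← h_dbl, Bool.toNat_false, two_mul, zero_add]
  · intro h_sym h_next h_num h_dbl h_succ
    rw [numAt_drop_of_bit h_sym h_next, h_num, h_succ, ← h_dbl, Bool.toNat_true, two_mul, add_comm]
  all_goals
    intro h_sym h0
    rw [numAt_drop_of_not_bit h_sym.2 (by simp), h0]

theorem sat_of_mem_carryRules {x y c : Bool} (hr : r ∈ Pred.carryRules x y c) :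
    r.Sat (E.interp n w) v := by
  simp only [Pred.carryRules, List.mem_cons, List.not_mem_nil, or_false] at hr
  rcases hr with rfl | rfl <;>
    simp only [Rule.Sat, List.foldr_cons, List.foldr_nil, Atom.AnySat, Atom.Sat, Pred.un, Pred.bin,
      interp, State.reg]
  · intro h0
    rw [h0, carryBit_zero]
  · intro h_a h_s h_carry h_next
    rw [h_next, carryBit_succ, h_a, h_s, h_carry]

theorem sat_of_mem_initRules {g : Reg} (hr : r ∈ Pred.initRules g) : r.Sat (E.interp n w) v := by
  have h_run {p q : ℕ} (hp : p = 0) (hq : q = p + 1) : E.run .start w (q - 1) = .start := by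
    rw [hq, Nat.add_sub_cancel, hp, run_zero]
  simp only [Pred.initRules, List.mem_cons, List.not_mem_nil, or_false] at hr
  rcases hr with rfl | rfl | rfl | rfl | rfl <;>
    simp only [Rule.Sat, List.foldr_cons, List.foldr_nil, Atom.AnySat, Atom.Sat, Pred.un, Pred.bin,
      interp] <;>
    intro h0 h1 <;> rw [h_run h0 h1]
  · rfl
  · exact h0.symm
  · exact h0.symm
  · rw [h0]
    cases g <;> rfl
  · intro h_next
    rw [h_next]
    cases g <;> simp [State.start, State.reg, Nat.testBit_add_one]

theorem sat_of_mem_fetchRules (hp : E.Path n B .start w st []) {M : Mode} {s : Sym}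
    (hr : r ∈ Pred.fetchRules M s) : r.Sat (E.interp n w) v := by
  simp only [Pred.fetchRules, List.mem_append, List.mem_cons, List.not_mem_nil, or_false] at hr
  rcases hr with (rfl | rfl) | hr
  · simp only [Rule.Sat, List.foldr_cons, List.foldr_nil, Atom.AnySat, Atom.Sat, Pred.un, Pred.bin,
      interp]
    intro h_mode h_sym h_target h0
    exact ⟨h_sym.1, h_sym.2, h_mode, by simp [h_target, h0]⟩
  · simp only [Rule.Sat, List.foldr_cons, List.foldr_nil, Atom.AnySat, Atom.Sat, Pred.un, Pred.bin,
      interp]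
    intro h_mode h_sym h_target h_succ
    exact ⟨h_sym.1, h_sym.2, h_mode, by simp [h_target, h_succ]⟩
  · split at hr
    · obtain rfl := List.mem_singleton.1 hr
      simp only [Rule.Sat, List.foldr_cons, List.foldr_nil, Atom.AnySat, Atom.Sat, Pred.un,
        Pred.bin, interp]
      intro h_mode h_sym h_stride h_num
      have h_drop := drop_eq_cons h_sym.2
      obtain ⟨h_seen, h_lt, h_card⟩ := (hp.good h_drop).card h_mode ⟨_, rfl⟩
      rw [← h_drop, h_num] at h_card
      rw [← h_stride, h_seen]
      exact ⟨h_lt, h_card⟩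
    · cases hr

theorem sat_of_mem_srcRules {M : Mode} {s : Sym} {z x y c : Bool} {g : Reg}
    (hr : r ∈ Pred.srcRules (.inst M s z) g x y c ((instr M s z).reg.src g)) :
    r.Sat (E.interp n w) v := by
  have h_reg {p q : ℕ} (hi : E.interp n w (.inst M s z) p p p) (hn : E.interp n w .next p q q) :
      (E.run .start w (q - 1)).reg g =
        ((instr M s z).reg.src g).eval (E.run .start w (p - 1)) := by
    obtain ⟨-, h_step, h_instr⟩ := run_of_inst hi hn
    rw [h_step, reg_step, h_instr]
  generalize (instr M s z).reg.src g = src at hr h_reg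
  cases src with
  | copy g' =>
    obtain rfl := List.mem_singleton.1 hr
    intro hi hn (h_bit : ((E.run .start w (v 0 - 1)).reg g').testBit (v 2) = x)
    exact (congrArg (Nat.testBit · (v 2)) (h_reg hi hn)).trans h_bit
  | zero =>
    obtain rfl := List.mem_singleton.1 hr
    intro hi hn
    exact (congrArg (Nat.testBit · (v 2)) (h_reg hi hn)).trans (Nat.zero_testBit _)
  | dbl =>
    rw [Pred.srcRules, List.mem_pair] at hr
    rcases hr with rfl | rfl
    · intro hi hn (h0 : v 2 = 0)
      refine (congrArg (Nat.testBit · (v 2)) (h_reg hi hn)).trans ?_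
      simp only [Src.eval, h0, Nat.testBit_zero, Nat.mul_mod_right, zero_ne_one, decide_false]
    · intro hi hn (h_bit : (E.run .start w (v 0 - 1)).s.testBit (v 2) = x) (h_next : v 3 = v 2 + 1)
      refine (congrArg (Nat.testBit · (v 3)) (h_reg hi hn)).trans ?_
      simp only [Pred.un, Src.eval, h_next, Nat.testBit_add_one, Nat.mul_div_cancel_left _ two_pos,
        h_bit]
  | sum =>
    obtain rfl := List.mem_singleton.1 hr
    intro hi hn (h_a : (E.run .start w (v 0 - 1)).a.testBit (v 2) = x)
      (h_s : (E.run .start w (v 0 - 1)).s.testBit (v 2) = y)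
      (h_carry : carryBit (E.run .start w (v 0 - 1)).a (E.run .start w (v 0 - 1)).s (v 2) = c)
    refine (congrArg (Nat.testBit · (v 2)) (h_reg hi hn)).trans ?_
    simp only [Pred.un, Src.eval, testBit_add_eq, h_a, h_s, h_carry]

theorem sat_of_mem_strideRules {M : Mode} {s : Sym} {z : Bool}
    (hr : r ∈ Pred.strideRules (.inst M s z) (instr M s z).stride) : r.Sat (E.interp n w) v := by
  have h_stride {p q : ℕ} (hi : E.interp n w (.inst M s z) p p p) (hn : E.interp n w .next p q q) :
      (E.run .start w (q - 1)).stride =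
        (instr M s z).stride.eval E (E.run .start w (p - 1)) (w.drop (p - 1)) := by
    obtain ⟨h_drop, h_step, h_instr⟩ := run_of_inst hi hn
    rw [h_step, h_drop, ← h_instr]
    rfl
  generalize (instr M s z).stride = op at hr h_stride
  cases op <;> obtain rfl := List.mem_singleton.1 hr <;> intro hi hn
  · intro h_keep
    exact (h_stride hi hn).trans h_keep
  · intro (h0 : v 2 = 0) (h1 : v 3 = v 2 + 1)
    exact (h_stride hi hn).trans (by rw [StrideOp.eval, Pred.bin, h1, h0])
  · intro (h_keep : (E.run .start w (v 0 - 1)).stride = v 2) (h_next : v 3 = v 2 + 1)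
    exact (h_stride hi hn).trans ((congrArg (· + 1) h_keep).trans h_next.symm)
  · intro (h_num : numAt (w.drop (v 0 - 1)) = v 2) (h_card : v 2 < n ∧ E.card (v 2) = v 3)
      (h_keep : (E.run .start w (v 0 - 1)).stride = v 4) (h_times : v 4 * v 3 = v 5)
    refine (h_stride hi hn).trans (Eq.trans ?_ h_times)
    simp only [StrideOp.eval, Pred.un, h_num, h_card.2, h_keep]

theorem sat_of_mem_targetRules {M : Mode} {s : Sym} {z : Bool}
    (hr : r ∈ Pred.targetRules (.inst M s z) (instr M s z).target) : r.Sat (E.interp n w) v := by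
  have h_target {p q : ℕ} (hi : E.interp n w (.inst M s z) p p p) (hn : E.interp n w .next p q q) :
      (E.run .start w (q - 1)).target =
        (instr M s z).target.eval E (E.run .start w (p - 1)) (w.drop (p - 1)) := by
    obtain ⟨h_drop, h_step, h_instr⟩ := run_of_inst hi hn
    rw [h_step, h_drop, ← h_instr]
    rfl
  generalize (instr M s z).target = op at hr h_target
  cases op <;> obtain rfl := List.mem_singleton.1 hr <;> intro hi hn
  · intro h_keep
    exact (h_target hi hn).trans h_keep
  · intro (h_keep : (E.run .start w (v 0 - 1)).target = v 2) (h_next : v 2 = v 3 + 1)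
    exact (h_target hi hn).trans (Nat.sub_eq_of_eq_add (h_keep.trans h_next))
  · intro (h_num : numAt (w.drop (v 0 - 1)) = v 2) (h_val : E.val (v 2) = v 3)
      (h_stride : (E.run .start w (v 0 - 1)).stride = v 4) (h_times : v 4 * v 3 = v 5)
      (h_keep : (E.run .start w (v 0 - 1)).target = v 6) (h_plus : v 6 + v 5 = v 7)
    refine (h_target hi hn).trans (Eq.trans ?_ h_plus)
    simp only [TargetOp.eval, Pred.un, h_num, h_val, h_stride, h_times, h_keep]

theorem sat_of_mem_instRules {M : Mode} {s : Sym} {z x y c : Bool} {g : Reg}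
    (hr : r ∈ Pred.instRules M s z g x y c) : r.Sat (E.interp n w) v := by
  simp only [Pred.instRules, List.mem_append, List.mem_singleton] at hr
  rcases hr with ((rfl | hr) | hr) | hr
  · intro hi hn
    obtain ⟨-, h_step, h_instr⟩ := run_of_inst hi hn
    exact (congrArg State.mode h_step).trans (congrArg Instr.mode h_instr)
  · exact sat_of_mem_srcRules hr
  · exact sat_of_mem_strideRules hr
  · exact sat_of_mem_targetRules hr

theorem sat_of_mem_choiceRules (hE : ∀ v < n, E.val v < E.card v) (hr : r ∈ Pred.choiceRules) :
    r.Sat (E.interp n w) v := by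
  simp only [Pred.choiceRules, List.mem_cons, List.not_mem_nil, or_false] at hr
  rcases hr with rfl | rfl | rfl <;>
    simp only [Rule.Sat, List.foldr_cons, List.foldr_nil, Atom.AnySat, Atom.Sat, Pred.un, Pred.bin,
      interp]
  · omega
  · omega
  · rintro ⟨h_lt, h_card⟩ h_free
    have h_val := hE _ h_lt
    omega

theorem sat_of_mem_compareRules (hp : E.Path n B .start w st [])
    (hst : st.mode = .scope → st.y < st.x) {b : Bool} (hr : r ∈ Pred.compareRules b) :
    r.Sat (E.interp n w) v := by
  simp only [Pred.compareRules, List.mem_cons, List.not_mem_nil, or_false] at hr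
  rcases hr with rfl | rfl | rfl | rfl <;>
    simp only [Rule.Sat, List.foldr_cons, List.foldr_nil, Atom.AnySat, Atom.Sat, Pred.un, Pred.bin,
      interp, State.reg, hp.run_length]
  · intro h0
    rw [h0, pow_zero, Nat.mod_one, Nat.mod_one]
  · intro h_last h_next h_le h_x h_y
    rw [h_last, Nat.add_sub_cancel, hp.run_length] at h_x h_y
    rw [h_next, mod_two_pow_succ, mod_two_pow_succ, h_x, h_y]
    omega
  · intro h_last h_next h_x h_y
    rw [h_last, Nat.add_sub_cancel, hp.run_length] at h_x h_y
    have h_mod := Nat.mod_lt st.x (Nat.two_pow_pos (v 1))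
    rw [h_next, mod_two_pow_succ, mod_two_pow_succ, h_x, h_y, Bool.toNat_false, Bool.toNat_true]
    omega
  · intro h_last h_mode h_le
    rw [h_last, Nat.add_sub_cancel, hp.run_length] at h_mode
    rw [h_last, Nat.mod_eq_of_lt hp.reg_lt.1, Nat.mod_eq_of_lt hp.reg_lt.2] at h_le
    exact (hst h_mode).not_ge h_le

theorem Path.describes (hp : E.Path n B .start w st []) (hE : ∀ v < n, E.val v < E.card v)
    (hst : st.mode = .scope → st.y < st.x) : (E.interp n w).Describes w where
  first := rfl
  last := rfl
  next _ _ := rfl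
  sym _ _ hj := ⟨Nat.succ_pos _, hj⟩
  rules r hr v _ := by
    rcases Pred.mem_rules.1 hr with hr | ⟨s, hr⟩ | ⟨x, y, c, hr⟩ | ⟨g, hr⟩ | ⟨M, s, hr⟩ |
      ⟨M, s, z, g, x, y, c, hr⟩ | hr | ⟨b, hr⟩
    · exact sat_of_mem_arithRules hr
    · exact sat_of_mem_numRules hr
    · exact sat_of_mem_carryRules hr
    · exact sat_of_mem_initRules hr
    · exact sat_of_mem_fetchRules hp hr
    · exact sat_of_mem_instRules hr
    · exact sat_of_mem_choiceRules hE hr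
    · exact sat_of_mem_compareRules hp hst hr

end Env

theorem Model.env_val_lt_card (M : Model) (x : Instantiation M.card) {v : ℕ} (hv : v < M.numVars) :
    (M.env x).val v < (M.env x).card v := by
  have h_val := M.env_val x ⟨v, hv⟩
  have h_card := M.env_card x ⟨v, hv⟩
  dsimp only at h_val h_card
  rw [h_val, h_card]
  exact (x ⟨v, hv⟩).2

theorem Query.exists_describes (Q : Query) (h : DMPE Q) : ∃ I : Interp, I.Describes Q.encode := by
  obtain ⟨x, hx⟩ := h
  have hE (v : ℕ) (hv : v < Q.model.numVars) := Q.model.env_val_lt_card x hv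
  by_cases hk : 0 ≤ Q.k
  · obtain ⟨st, -, h_lt, hp⟩ := Q.exists_path hk x (Nat.lt_succ_self _)
    exact ⟨_, hp.describes hE fun _ => h_lt.2 hx⟩
  · obtain ⟨st, h_mode, hp⟩ := Env.Path.dead (E := Q.model.env x) (n := Q.model.numVars) (B := 0)
      (not_le.1 hk) _
    exact ⟨_, Env.Path.describes (w := Q.encode) hp hE fun h => by simp [h_mode] at h⟩

open Classical in
/-- An instantiation whose values are chosen by an interpretation, where there is a choice. -/
noncomputable def Interp.instantiation (I : Interp) (M : Model) : Instantiation M.card := fun v =>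
  if h : ∃ a : Fin (M.card v), I .choice v a a then h.choose else ⟨0, M.card_pos v⟩

theorem Interp.Describes.chooses_instantiation {I : Interp} {w : List Sym} (h : I.Describes w)
    (M : Model) : I.Chooses w (M.env (I.instantiation M)) := by
  intro v hv h_pos h_le h_card
  obtain ⟨a, ha, h_choice⟩ := h.exists_choice (by omega) (by omega) h_card
  have hvM : v < M.numVars := by
    by_contra hvM
    simp [Model.env, hvM] at h_pos
  lift v to Fin M.numVars using hvM
  rw [M.env_card] at ha
  have h_exists : ∃ a : Fin (M.card v), I .choice v a a := ⟨⟨a, ha⟩, h_choice⟩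
  rw [M.env_val, Interp.instantiation, dif_pos h_exists]
  exact h_exists.choose_spec

theorem Interp.Describes.dmpe {I : Interp} {Q : Query} (h : I.Describes Q.encode) : DMPE Q := by
  refine ⟨I.instantiation Q.model, ?_⟩
  by_cases hk : 0 ≤ Q.k
  · obtain ⟨st, h_mode, h_lt, hp⟩ := Q.exists_path hk (I.instantiation Q.model) (Nat.lt_succ_self _)
    have h_knows := h.knows_of_path (h.chooses_instantiation Q.model) (Nat.zero_le _)
      List.drop_zero (h.knows_init _) hp
    exact h_lt.1 (h.lt_of_knows h_knows h_mode hp.reg_lt.1 hp.reg_lt.2)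
  · exact (not_le.1 hk).trans_le (NNRat.coe_nonneg _)

theorem dmpe_iff_describes (Q : Query) : DMPE Q ↔ ∃ I : Interp, I.Describes Q.encode :=
  ⟨Q.exists_describes, fun ⟨_, h⟩ => h.dmpe⟩

end FactorModel

theorem mainTheorem9 :
    ∃ r : FactorModel.Query → FactorModel.Query,
      FactorModel.IsPolyTimeReduction FactorModel.Query.encode FactorModel.Query.encode
          FactorModel.DMPE FactorModel.DPR r ∧
        ∀ Q : FactorModel.Query, (r Q).model.IsCNF ∧ (r Q).k = 0 := by
  obtain ⟨r, hr, h⟩ :=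
    FactorModel.scanTheory.exists_reduction FactorModel.Query.encode (by norm_num)
  refine ⟨r, ⟨hr, fun Q => ?_⟩, fun Q => (h Q).1⟩
  rw [(h Q).2, FactorModel.exists_models_iff, FactorModel.dmpe_iff_describes]
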